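/- **Setting.** Let $\mathbb F$ be a field of characteristic $0$, and let $\mathcal V$ be a Poisson vertex algebra over $\mathbb F$: a unital commutative associative $\mathbb F$-algebra with a derivation $\partial$ and a $\lambda$-bracket $\{\cdot_\lambda\cdot\}:\mathcal V\times\mathcal V\to\mathcal V[\lambda]$ which satisfies sesquilinearity, the left and right Leibniz rules, skewsymmetry and the Jacobi identity. Let $\mathcal V((\partial^{-1}))$ be the algebra of scalar pseudodifferential operators over $\mathcal V$; the symbol of $a(\partial)=\sum_n a_n\partial^n$ is $a(z)=\sum_n a_nz^n$ and its formal adjoint is $a^*(\partial)=\sum_n(-\partial)^n\circ a_n$. Let $V$ be a finite-dimensional vector space over $\mathbb F$. For $A(\partial)\in\mathcal V((\partial^{-1}))\otimes\operatorname{End}V$ the symbol $A(z)$ and the adjoint $A^*(\partial)$ are taken in the first tensor factor only, and $\{A(z)_\lambda A(w)\}$ is obtained by taking the $\lambda$-bracket of the first tensor factors, with values in $\operatorname{End}V\otimes\operatorname{End}V$. Let $\Omega\in\operatorname{End}V\otimes\operatorname{End}V$ be the permutation $\Omega(v_1\otimes v_2)=v_2\otimes v_1$. If $V$ carries a non-degenerate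 symmetric or skewsymmetric bilinear form $\langle\cdot|\cdot\rangle$, let $X^\dagger$ be the adjoint of $X\in\operatorname{End}V$ and let $\Omega^\dagger$ be obtained from $\Omega$ by applying $\dagger$ to the first factor. Let $\alpha,\beta,\gamma\in\mathbb F$. The *generalized Adler identity* with parameters $(\alpha,\beta,\gamma)$ is $$ \begin{aligned} \{A(z)_\lambda A(w)\}={}&\alpha\,(\mathbb 1\otimes A(w+\lambda+\partial))(z-w-\lambda-\partial)^{-1}(A^*(\lambda-z)\otimes\mathbb 1)\,\Omega\\ &-\alpha\,\Omega\,\bigl(A(z)\otimes(z-w-\lambda-\partial)^{-1}A(w)\bigr)\\ &-\beta\,(\mathbb 1\otimes A(w+\lambda+\partial))\,\Omega^\dagger(z+w+\partial)^{-1}(A(z)\otimes\mathbb 1)\\ &+\beta\,(A^*(\lambda-z)\otimes\mathbb 1)\,\Omega^\dagger(z+w+\partial)^{-1}(\mathbb 1\otimes A(w))\\ &+\gamma\,\bigl(\mathbb 1\otimes(A(w+\lambda+\partial)-A(w))\bigr)(\lambda+\partial)^{-1}\bigl((A^*(\lambda-z)-A(z))\otimes\mathbb 1\bigr), \end{aligned}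 $$ where $A(w+\lambda+\partial)$ is expanded for large $w$, $A^*(\lambda-z)$ for large $z$, the inverses $(z-w-\lambda-\partial)^{-1}$ and $(z+w+\partial)^{-1}$ for large $z$ in all terms, and the last term contains no negative powers of $\lambda+\partial$. The operator $A(\partial)$ is *of generalized Adler type* with parameters $(\alpha,\beta,\gamma)$ if this identity holds and, in case $\beta\neq0$, $V$ carries a non-degenerate symmetric or skewsymmetric bilinear form and $(A^*(\partial))^\dagger=\eta A(\partial)$ for some $\eta\in\{\pm1\}$. (For $\beta=0$ no form on $V$ is needed.) **Theorem.** Let $A(\partial)\in\mathcal V((\partial^{-1}))\otimes\operatorname{End}V$ be of generalized Adler type with parameters $(\alpha,\beta,\gamma)$ (and sign $\eta$ if $\beta\ne0$). (a) If $A(\partial)$ is invertible, then $A^{-1}(\partial)$ satisfies the generalized Adler identity with parameters $(-\alpha,-\beta,\gamma)$, and, if $\beta\neq0$, $((A^{-1})^*(\partial))^\dagger=\eta A^{-1}(\partial)$. (b) Let $T\in\operatorname{End}V$, with canonical decomposition $T=IJ$, $J=T:V\twoheadrightarrow\operatorname{im}T$, $I:\operatorname{im}T\hookrightarrow V$ the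 inclusion. If $\beta\neq0$, assume that $T^\dagger=\delta T$ with $\delta\in\{\pm1\}$, and equip $\operatorname{im}T$ with the bilinear form $\langle u_1|u_2\rangle^T=\langle J^{-1}(u_1)|I(u_2)\rangle$, which is well defined, non-degenerate, and symmetric or skewsymmetric; let $\dagger_T$ be the corresponding adjoint. Then $JA(\partial)I\in\mathcal V((\partial^{-1}))\otimes\operatorname{End}(\operatorname{im}T)$ satisfies the generalized Adler identity with the same parameters $(\alpha,\beta,\gamma)$, and, if $\beta\neq0$, $(JA^*(\partial)I)^{\dagger_T}=\eta\delta\,JA(\partial)I$. (c) With $T,I,J$ (and $\delta$) as in (b), suppose that the generalized quasideterminant $|A(\partial)|_{I,J}=(JA^{-1}(\partial)I)^{-1}$ exists, i.e. $A(\partial)$ is invertible in $\mathcal V((\partial^{-1}))\otimes\operatorname{End}V$ and $JA^{-1}(\partial)I$ is invertible in $\mathcal V((\partial^{-1}))\otimes\operatorname{End}(\operatorname{im}T)$. Then $|A(\partial)|_{I,J}$ satisfies the generalized Adler identity with parameters $(\alpha,\beta,\gamma)$, and, if $\beta\neq0$, $(|A|_{I,J}^*(\partial))^{\dagger_T}=\eta\delta\,|A(\partial)|_{I,J}$.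 -/

import Mathlib

open scoped TensorProduct Polynomial

namespace GenAdler

noncomputable section

/-! ### Laurent series in an inverse variable -/

/-- The space `R((z⁻¹))`: sequences `n ↦ a n` (the coefficient of `zⁿ`), `n ∈ ℤ`,
which vanish for all sufficiently large `n`. -/
def LaurentInv (F R : Type*) [Field F] [AddCommGroup R] [Module F R] :
    Submodule F (ℤ → R) where
  carrier := {a | ∃ N : ℤ, ∀ n, N < n → a n = 0}
  zero_mem' := ⟨0, fun _ _ => rfl⟩
  add_mem' := by
    rintro a b ⟨N, hN⟩ ⟨M, hM⟩
    refine ⟨max N M, fun n hn => ?_⟩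
    simp [hN n (lt_of_le_of_lt (le_max_left _ _) hn), hM n (lt_of_le_of_lt (le_max_right _ _) hn)]
  smul_mem' := by
    rintro c a ⟨N, hN⟩
    exact ⟨N, fun n hn => by simp [hN n hn]⟩

/-- The finitely supported sequence `j ↦ a (p + j)`, `j ∈ ℕ`, of the coefficients of a series
in `R((z⁻¹))` from `z ^ p` upwards. -/
def tail {F R : Type*} [Field F] [AddCommGroup R] [Module F R] (p : ℤ) :
    LaurentInv F R →ₗ[F] (ℕ →₀ R) where
  toFun a := Finsupp.ofSupportFinite (fun j : ℕ => a.1 (p + j)) (by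
    obtain ⟨N, hN⟩ := a.2
    refine (Set.finite_Iic (N - p).toNat).subset fun j hj => ?_
    by_contra h
    apply hj
    apply hN
    simp only [Set.mem_Iic, not_le] at h
    omega)
  map_add' a b := by ext j; rfl
  map_smul' c a := by ext j; rfl

theorem tail_apply {F R : Type*} [Field F] [AddCommGroup R] [Module F R] (p : ℤ)
    (a : LaurentInv F R) (j : ℕ) : tail p a j = a.1 (p + j) := rfl

/-- `[zᵖ] a(z + D) f` for `a(z) ∈ 𝒱((z⁻¹))`, an `F`-linear operator `D` on a `𝒱`-module `R`
and `f ∈ R`, where `(z + D)ⁿ` is expanded for large `z`: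
`∑ₖ (p+k choose k) a_{p+k} Dᵏ f`. -/
def shiftCoeff {F 𝒱 R : Type*} [Field F] [CommRing 𝒱] [Algebra F 𝒱] [AddCommGroup R]
    [Module F R] [Module 𝒱 R] [IsScalarTower F 𝒱 R] (D : R →ₗ[F] R) (p : ℤ) :
    LaurentInv F 𝒱 →ₗ[F] R →ₗ[F] R :=
  Finsupp.lsum F (fun k : ℕ => Ring.choose (p + k) k •
    (LinearMap.mulRight F (D ^ k : Module.End F R) ∘ₗ (Algebra.lsmul F F R).toLinearMap)) ∘ₗ tail p

theorem shiftCoeff_apply {F 𝒱 R : Type*} [Field F] [CommRing 𝒱] [Algebra F 𝒱] [AddCommGroup R]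
    [Module F R] [Module 𝒱 R] [IsScalarTower F 𝒱 R] (D : R →ₗ[F] R) (p : ℤ)
    (a : LaurentInv F 𝒱) (f : R) :
    shiftCoeff D p a f =
      (tail p a).sum fun k c => Ring.choose (p + k) k • c • (D ^ k : Module.End F R) f := by
  simp only [shiftCoeff, LinearMap.comp_apply, Finsupp.lsum_apply, Finsupp.sum,
    LinearMap.sum_apply]
  rfl

theorem tail_eq_zero {F R : Type*} [Field F] [AddCommGroup R] [Module F R] {p : ℤ}
    {a : LaurentInv F R} {N : ℤ} (hN : ∀ n, N < n → a.1 n = 0) (h : N < p) : tail p a = 0 := by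
  ext j
  rw [tail_apply, hN _ (by omega)]; rfl

theorem shiftCoeff_eq_sum {F 𝒱 R : Type*} [Field F] [CommRing 𝒱] [Algebra F 𝒱] [AddCommGroup R]
    [Module F R] [Module 𝒱 R] [IsScalarTower F 𝒱 R] (D : R →ₗ[F] R) (p : ℤ)
    (a : LaurentInv F 𝒱) {N : ℤ} (hN : ∀ n, N < n → a.1 n = 0) (K : ℕ) (hK : N < p + K) (f : R) :
    shiftCoeff D p a f = ∑ k ∈ Finset.range K,
      Ring.choose (p + k) k • a.1 (p + k) • (D ^ k : Module.End F R) f := by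
  rw [shiftCoeff_apply, Finsupp.sum_of_support_subset _ (s := Finset.range K)]
  · rfl
  · intro j hj
    rw [Finsupp.mem_support_iff, tail_apply] at hj
    by_contra h
    apply hj
    apply hN
    simp only [Finset.mem_range, not_lt] at h
    omega
  · simp

/-! ### The algebra of pseudodifferential operators -/

/-- `𝒱((∂⁻¹))`: the pseudodifferential operators `∑ₙ aₙ ∂ⁿ` over the differential algebra
`(𝒱, d)`, encoded by their symbols `∑ₙ aₙ zⁿ ∈ 𝒱((z⁻¹))`. -/
def PseudoDiffOp {F 𝒱 : Type*} [Field F] [CommRing 𝒱] [Algebra F 𝒱]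
    (_d : Derivation F 𝒱 𝒱) : Type _ :=
  LaurentInv F 𝒱

namespace PseudoDiffOp

variable {F 𝒱 : Type*} [Field F] [CommRing 𝒱] [Algebra F 𝒱] {d : Derivation F 𝒱 𝒱}

instance : AddCommGroup (PseudoDiffOp d) := inferInstanceAs (AddCommGroup (LaurentInv F 𝒱))

instance : Module F (PseudoDiffOp d) := inferInstanceAs (Module F (LaurentInv F 𝒱))

/-- The symbol `a(z) ∈ 𝒱((z⁻¹))` of `a(∂)`. -/
def symbol : PseudoDiffOp d ≃ₗ[F] LaurentInv F 𝒱 := LinearEquiv.refl F _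

/-- The coefficient of `∂ⁿ`. -/
def coeff (a : PseudoDiffOp d) (n : ℤ) : 𝒱 := (symbol a).1 n

@[ext]
theorem ext {a b : PseudoDiffOp d} (h : ∀ n, a.coeff n = b.coeff n) : a = b :=
  Subtype.ext (funext h)

theorem exists_bound (a : PseudoDiffOp d) : ∃ N : ℤ, ∀ n, N < n → a.coeff n = 0 := a.2

@[simp] theorem coeff_add (a b : PseudoDiffOp d) (n : ℤ) :
    (a + b).coeff n = a.coeff n + b.coeff n := rfl

@[simp] theorem coeff_zero (n : ℤ) : (0 : PseudoDiffOp d).coeff n = 0 := rfl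

@[simp] theorem coeff_smul (c : F) (a : PseudoDiffOp d) (n : ℤ) :
    (c • a).coeff n = c • a.coeff n := rfl

/-- `[zᵖ] a(z + ∂) f`, for `f ∈ 𝒱`. -/
def act (a : PseudoDiffOp d) (p : ℤ) : 𝒱 →ₗ[F] 𝒱 := shiftCoeff d.toLinearMap p (symbol a)

theorem act_eq_sum (a : PseudoDiffOp d) {N : ℤ} (hN : ∀ n, N < n → a.coeff n = 0) (p : ℤ)
    (K : ℕ) (hK : N < p + K) (f : 𝒱) :
    a.act p f = ∑ k ∈ Finset.range K,
      Ring.choose (p + k) k • (a.coeff (p + k) * (d.toLinearMap ^ k : Module.End F 𝒱) f) :=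
  shiftCoeff_eq_sum _ p (symbol a) hN K hK f

theorem act_eq_zero (a : PseudoDiffOp d) {N : ℤ} (hN : ∀ n, N < n → a.coeff n = 0) {p : ℤ}
    (h : N < p) : a.act p = 0 := by
  ext f
  rw [act_eq_sum a hN p 0 (by simpa using h)]; simp

theorem act_add (a b : PseudoDiffOp d) (p : ℤ) : (a + b).act p = a.act p + b.act p := by
  simp [act]

theorem act_smul (c : F) (a : PseudoDiffOp d) (p : ℤ) : (c • a).act p = c • a.act p := by
  simp [act]

theorem mul_support (a b : PseudoDiffOp d) {N M : ℤ} (hN : ∀ n, N < n → a.coeff n = 0)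
    (hM : ∀ n, M < n → b.coeff n = 0) (n : ℤ) :
    (Function.support fun m : ℤ => a.act (n - m) (b.coeff m)) ⊆ Finset.Icc (n - N) M := by
  intro m hm
  rw [Finset.coe_Icc, Set.mem_Icc]
  constructor
  · by_contra h
    exact hm (by simp only; rw [act_eq_zero a hN (by omega)]; rfl)
  · by_contra h
    exact hm (by simp only; rw [hM m (by omega), map_zero])

theorem mul_support_finite (a b : PseudoDiffOp d) (n : ℤ) :
    (Function.support fun m : ℤ => a.act (n - m) (b.coeff m)).Finite := by
  obtain ⟨N, hN⟩ := a.exists_bound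
  obtain ⟨M, hM⟩ := b.exists_bound
  exact (Finset.finite_toSet _).subset (mul_support a b hN hM n)

/-- The product of pseudodifferential operators, `(ab)(z) = a(z + ∂) b(z)`, i.e.
`∂ⁿ ∘ f = ∑ₖ (n choose k) f⁽ᵏ⁾ ∂ⁿ⁻ᵏ`. -/
instance : Mul (PseudoDiffOp d) where
  mul a b := symbol.symm ⟨fun n => ∑ᶠ m : ℤ, a.act (n - m) (b.coeff m), by
    obtain ⟨N, hN⟩ := a.exists_bound
    obtain ⟨M, hM⟩ := b.exists_bound
    refine ⟨N + M, fun n hn => ?_⟩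
    change ∑ᶠ m : ℤ, a.act (n - m) (b.coeff m) = 0
    rw [finsum_eq_sum_of_support_subset _ (mul_support a b hN hM n), Finset.Icc_eq_empty (by omega),
      Finset.sum_empty]⟩

instance : One (PseudoDiffOp d) where
  one := symbol.symm ⟨fun n => if n = 0 then 1 else 0, ⟨0, fun _ hn => if_neg hn.ne'⟩⟩

theorem coeff_mul (a b : PseudoDiffOp d) (n : ℤ) :
    (a * b).coeff n = ∑ᶠ m : ℤ, a.act (n - m) (b.coeff m) := rfl

theorem coeff_one (n : ℤ) : (1 : PseudoDiffOp d).coeff n = if n = 0 then 1 else 0 := rfl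

theorem coeff_mul_eq_sum (a b : PseudoDiffOp d) {N M : ℤ} (hN : ∀ n, N < n → a.coeff n = 0)
    (hM : ∀ n, M < n → b.coeff n = 0) (n : ℤ) {s : Finset ℤ} (hs : Finset.Icc (n - N) M ⊆ s) :
    (a * b).coeff n = ∑ m ∈ s, a.act (n - m) (b.coeff m) := by
  rw [coeff_mul, finsum_eq_sum_of_support_subset]
  exact (mul_support a b hN hM n).trans (by exact_mod_cast hs)

theorem leibniz_iterate (n : ℕ) (f g : 𝒱) :
    (d.toLinearMap ^ n : Module.End F 𝒱) (f * g) = ∑ ij ∈ Finset.HasAntidiagonal.antidiagonal n,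
      n.choose ij.1 • ((d.toLinearMap ^ ij.1 : Module.End F 𝒱) f *
        (d.toLinearMap ^ ij.2 : Module.End F 𝒱) g) := by
  induction n with
  | zero => simp
  | succ n ih =>
    rw [Finset.sum_antidiagonal_choose_succ_nsmul (fun i j =>
      (d.toLinearMap ^ i : Module.End F 𝒱) f * (d.toLinearMap ^ j : Module.End F 𝒱) g) n,
      pow_succ', Module.End.mul_apply, ih, map_sum, ← Finset.sum_add_distrib]
    refine Finset.sum_congr rfl fun ij h => ?_
    have hs : n.choose ij.2 = n.choose ij.1 := by
      rw [← Nat.choose_symm_of_eq_add (Finset.HasAntidiagonal.mem_antidiagonal.mp h).symm]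
    rw [map_nsmul, hs, ← nsmul_add, pow_succ', pow_succ', Module.End.mul_apply,
      Module.End.mul_apply]
    congr 1
    change d _ = _ * d _ + d _ * _
    rw [Derivation.leibniz, smul_eq_mul, smul_eq_mul]
    ring

theorem sum_antidiagonal_reassoc {M : Type*} [AddCommMonoid M] (n : ℕ) (f : ℕ → ℕ → ℕ → M) :
    ∑ uv ∈ Finset.HasAntidiagonal.antidiagonal n,
      ∑ kr ∈ Finset.HasAntidiagonal.antidiagonal uv.2, f uv.1 kr.1 kr.2 =
    ∑ tk ∈ Finset.HasAntidiagonal.antidiagonal n,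
      ∑ ur ∈ Finset.HasAntidiagonal.antidiagonal tk.1, f ur.1 tk.2 ur.2 := by
  rw [Finset.sum_sigma', Finset.sum_sigma']
  refine Finset.sum_nbij' (fun x => ⟨(x.1.1 + x.2.2, x.2.1), (x.1.1, x.2.2)⟩)
    (fun x => ⟨(x.2.1, x.1.2 + x.2.2), (x.1.2, x.2.2)⟩) ?_ ?_ ?_ ?_ ?_
  · rintro ⟨⟨a, b⟩, ⟨c, e⟩⟩ h
    simp only [Finset.mem_sigma, Finset.HasAntidiagonal.mem_antidiagonal, and_true] at h ⊢
    omega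
  · rintro ⟨⟨a, b⟩, ⟨c, e⟩⟩ h
    simp only [Finset.mem_sigma, Finset.HasAntidiagonal.mem_antidiagonal, and_true] at h ⊢
    omega
  · rintro ⟨⟨a, b⟩, ⟨c, e⟩⟩ h
    simp only [Finset.mem_sigma, Finset.HasAntidiagonal.mem_antidiagonal] at h
    obtain ⟨h1, rfl⟩ := h
    rfl
  · rintro ⟨⟨a, b⟩, ⟨c, e⟩⟩ h
    simp only [Finset.mem_sigma, Finset.HasAntidiagonal.mem_antidiagonal] at h
    obtain ⟨h1, rfl⟩ := h
    rfl
  · intros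
    rfl

/-- `a(z + ∂) (b (z + ∂)ˡ f) = (a(z + ∂) b) (z + ∂)ˡ f`, coefficientwise. -/
theorem act_mul_aux (a : PseudoDiffOp d) {N : ℤ} (hN : ∀ n, N < n → a.coeff n = 0) (p l : ℤ)
    (K : ℕ) (hK : N < p + K) (b f : 𝒱) :
    ∑ t ∈ Finset.range K, Ring.choose (p + l + t) t •
      (a.act (p + t) b * (d.toLinearMap ^ t : Module.End F 𝒱) f) =
    ∑ u ∈ Finset.range K, Ring.choose l u •
      a.act (p + u) (b * (d.toLinearMap ^ u : Module.End F 𝒱) f) := by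
  have key : ∀ g : ℕ → ℕ → 𝒱, (∀ t k, K ≤ t + k → g t k = 0) →
      ∑ t ∈ Finset.range K, ∑ k ∈ Finset.range K, g t k =
      ∑ n ∈ Finset.range K, ∑ tk ∈ Finset.HasAntidiagonal.antidiagonal n, g tk.1 tk.2 := by
    intro g hg
    simp_rw [Finset.Nat.sum_antidiagonal_eq_sum_range_succ g]
    rw [Finset.sum_range_diag_flip K g]
    refine Finset.sum_congr rfl fun t _ => ?_
    symm
    refine Finset.sum_subset (by simp) fun k _ hk => hg t k ?_
    simp only [Finset.mem_range, not_lt] at hk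
    omega
  have hK' : ∀ t : ℕ, N < p + t + K := fun t => by omega
  simp_rw [act_eq_sum a hN _ K (hK' _), Finset.sum_mul, Finset.smul_sum]
  rw [key, key]
  rotate_left
  · intro t k h
    rw [hN _ (by omega)]; simp
  · intro t k h
    rw [hN _ (by omega)]; simp
  refine Finset.sum_congr rfl fun n _ => ?_
  simp_rw [leibniz_iterate, Finset.mul_sum, Finset.smul_sum]
  have e2 : ∀ uv ∈ Finset.HasAntidiagonal.antidiagonal n,
      (∑ kr ∈ Finset.HasAntidiagonal.antidiagonal uv.2, Ring.choose l uv.1 •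
        Ring.choose (p + uv.1 + uv.2) uv.2 • (a.coeff (p + uv.1 + uv.2) * uv.2.choose kr.1 •
          ((d.toLinearMap ^ kr.1 : Module.End F 𝒱) b * (d.toLinearMap ^ kr.2 : Module.End F 𝒱)
            ((d.toLinearMap ^ uv.1 : Module.End F 𝒱) f)))) =
      ∑ kr ∈ Finset.HasAntidiagonal.antidiagonal uv.2,
        (Ring.choose l uv.1 * (Ring.choose (p + n) kr.1 * Ring.choose (p + n - kr.1) kr.2)) •
          (a.coeff (p + n) * ((d.toLinearMap ^ kr.1 : Module.End F 𝒱) b *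
            (d.toLinearMap ^ (kr.2 + uv.1) : Module.End F 𝒱) f)) := by
    rintro ⟨u, v⟩ huv
    refine Finset.sum_congr rfl ?_
    rintro ⟨k, r⟩ hkr
    simp only [Finset.HasAntidiagonal.mem_antidiagonal] at huv hkr
    subst hkr
    have h1 : p + u + ((k + r : ℕ) : ℤ) = p + n := by rw [← huv]; push_cast; ring
    have h2 := Ring.choose_smul_choose (p + n) (Nat.le_add_right k r)
    rw [Nat.add_sub_cancel_left] at h2
    simp only [h1]
    rw [← h2, pow_add, Module.End.mul_apply]
    simp only [zsmul_eq_mul, nsmul_eq_mul]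
    push_cast
    ring
  rw [Finset.sum_congr rfl e2, sum_antidiagonal_reassoc n fun u k r =>
    (Ring.choose l u * (Ring.choose (p + n) k * Ring.choose (p + n - k) r)) •
      (a.coeff (p + n) * ((d.toLinearMap ^ k : Module.End F 𝒱) b *
        (d.toLinearMap ^ (r + u) : Module.End F 𝒱) f))]
  refine Finset.sum_congr rfl ?_
  rintro ⟨t, k⟩ htk
  simp only [Finset.HasAntidiagonal.mem_antidiagonal] at htk
  have h1 : p + t + k = p + n := by rw [← htk]; push_cast; ring
  have h2 : p + l + t = l + (p + n - k) := by rw [← htk]; push_cast; ring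
  have h3 : ∀ ur ∈ Finset.HasAntidiagonal.antidiagonal t,
      (Ring.choose l ur.1 * (Ring.choose (p + n) k * Ring.choose (p + n - k) ur.2)) •
        (a.coeff (p + n) * ((d.toLinearMap ^ k : Module.End F 𝒱) b *
          (d.toLinearMap ^ (ur.2 + ur.1) : Module.End F 𝒱) f)) =
      (Ring.choose l ur.1 * Ring.choose (p + n - k) ur.2) • Ring.choose (p + n) k •
        (a.coeff (p + n) * ((d.toLinearMap ^ k : Module.End F 𝒱) b *
          (d.toLinearMap ^ t : Module.End F 𝒱) f)) := by
    rintro ⟨u, r⟩ h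
    rw [Finset.HasAntidiagonal.mem_antidiagonal] at h
    simp only at h ⊢
    rw [show r + u = t by omega, smul_smul]
    congr 1
    ring
  rw [Finset.sum_congr rfl h3, ← Finset.sum_smul, ← Ring.add_choose_eq t (Commute.all _ _), ← h2]
  simp only [h1, zsmul_eq_mul]
  ring

/-- `(ab)(z + ∂) f = a(z + ∂) (b(z + ∂) f)`, coefficientwise. -/
theorem act_mul (a b : PseudoDiffOp d) {N M : ℤ} (hN : ∀ n, N < n → a.coeff n = 0)
    (hM : ∀ n, M < n → b.coeff n = 0) (p : ℤ) (f : 𝒱) :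
    (a * b).act p f = ∑ m ∈ Finset.Icc (p - N) M, a.act (p - m) (b.act m f) := by
  have hab : ∀ n, N + M < n → (a * b).coeff n = 0 := fun n hn => by
    rw [coeff_mul_eq_sum a b hN hM n subset_rfl, Finset.Icc_eq_empty (by omega), Finset.sum_empty]
  set K : ℕ := (N + M - p).toNat + 1 with hK
  have hKp : N + M < p + K := by omega
  rw [act_eq_sum _ hab p K hKp]
  have e1 : ∀ t ∈ Finset.range K, Ring.choose (p + t) t •
      ((a * b).coeff (p + t) * (d.toLinearMap ^ t : Module.End F 𝒱) f) =
      ∑ l ∈ Finset.Icc (p - N) M, Ring.choose (p - l + l + t) t •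
        (a.act (p - l + t) (b.coeff l) * (d.toLinearMap ^ t : Module.End F 𝒱) f) := by
    intro t _
    rw [coeff_mul_eq_sum a b hN hM (p + t) (s := Finset.Icc (p - N) M)
      (Finset.Icc_subset_Icc (by omega) le_rfl), Finset.sum_mul, Finset.smul_sum]
    refine Finset.sum_congr rfl fun l _ => ?_
    rw [show p - l + l + t = p + t by ring, show p - l + t = p + t - l by ring]
  have e2 : ∀ m ∈ Finset.Icc (p - N) M, a.act (p - m) (b.act m f) =
      ∑ u ∈ Finset.range K, Ring.choose (m + u) u • a.act (p - m)
        (b.coeff (m + u) * (d.toLinearMap ^ u : Module.End F 𝒱) f) := by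
    intro m hm
    rw [Finset.mem_Icc] at hm
    rw [act_eq_sum b hM m K (by omega), map_sum]
    simp_rw [map_zsmul]
  rw [Finset.sum_congr rfl e1, Finset.sum_congr rfl e2]
  refine Finset.sum_comm.trans (Eq.trans ?_ Finset.sum_comm)
  have e3 : ∀ l ∈ Finset.Icc (p - N) M, (∑ t ∈ Finset.range K, Ring.choose (p - l + l + t) t •
        (a.act (p - l + t) (b.coeff l) * (d.toLinearMap ^ t : Module.End F 𝒱) f)) =
      ∑ u ∈ Finset.range K, Ring.choose l u •
        a.act (p - l + u) (b.coeff l * (d.toLinearMap ^ u : Module.End F 𝒱) f) := by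
    intro l hl
    rw [Finset.mem_Icc] at hl
    exact act_mul_aux a hN (p - l) l K (by omega) _ _
  rw [Finset.sum_congr rfl e3, Finset.sum_comm]
  refine Finset.sum_congr rfl fun u _ => ?_
  have hL : ∀ l ∉ Finset.Icc (p - N + u) M, Ring.choose l u •
      a.act (p - l + u) (b.coeff l * (d.toLinearMap ^ u : Module.End F 𝒱) f) = 0 := by
    intro l hl
    rw [Finset.mem_Icc, not_and_or] at hl
    rcases hl with hl | hl
    · rw [act_eq_zero a hN (by omega)]; simp
    · rw [hM l (by omega)]; simp
  have hR : ∀ m ∉ Finset.Icc (p - N) (M - u), Ring.choose (m + u) u • a.act (p - m)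
      (b.coeff (m + u) * (d.toLinearMap ^ u : Module.End F 𝒱) f) = 0 := by
    intro m hm
    rw [Finset.mem_Icc, not_and_or] at hm
    rcases hm with hm | hm
    · rw [act_eq_zero a hN (by omega)]; simp
    · rw [hM (m + u) (by omega)]; simp
  rw [← Finset.sum_subset (Finset.Icc_subset_Icc (by omega) le_rfl) fun l _ h => hL l h,
    ← Finset.sum_subset (Finset.Icc_subset_Icc le_rfl (by omega)) fun m _ h => hR m h]
  refine Finset.sum_nbij' (fun l => l - u) (fun m => m + u) ?_ ?_ ?_ ?_ ?_
  · intro l hl; rw [Finset.mem_Icc] at hl ⊢; omega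
  · intro l hl; rw [Finset.mem_Icc] at hl ⊢; omega
  · intro l _; ring
  · intro l _; ring
  · intro l _
    rw [sub_add_cancel, show p - (l - u) = p - l + u by ring]

theorem mul_assoc' (a b c : PseudoDiffOp d) : a * b * c = a * (b * c) := by
  obtain ⟨N, hN⟩ := a.exists_bound
  obtain ⟨M, hM⟩ := b.exists_bound
  obtain ⟨L, hL⟩ := c.exists_bound
  have hab : ∀ n, N + M < n → (a * b).coeff n = 0 := fun n hn => by
    rw [coeff_mul_eq_sum a b hN hM n subset_rfl, Finset.Icc_eq_empty (by omega), Finset.sum_empty]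
  have hbc : ∀ n, M + L < n → (b * c).coeff n = 0 := fun n hn => by
    rw [coeff_mul_eq_sum b c hM hL n subset_rfl, Finset.Icc_eq_empty (by omega), Finset.sum_empty]
  ext n
  rw [coeff_mul_eq_sum _ _ hab hL n subset_rfl, coeff_mul_eq_sum _ _ hN hbc n subset_rfl]
  have e1 : ∀ l ∈ Finset.Icc (n - (N + M)) L, (a * b).act (n - l) (c.coeff l) =
      ∑ m ∈ Finset.Icc (n - N) (M + L), a.act (n - m) (b.act (m - l) (c.coeff l)) := by
    intro l hl
    rw [Finset.mem_Icc] at hl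
    rw [act_mul a b hN hM]
    have h0 : ∀ m ∉ Finset.Icc (n - N) (M + l),
        a.act (n - m) (b.act (m - l) (c.coeff l)) = 0 := by
      intro m hm
      rw [Finset.mem_Icc, not_and_or] at hm
      rcases hm with hm | hm
      · rw [act_eq_zero a hN (by omega)]; rfl
      · rw [act_eq_zero b hM (by omega)]; simp
    rw [← Finset.sum_subset (Finset.Icc_subset_Icc le_rfl (by omega)) fun m _ h => h0 m h]
    refine Finset.sum_nbij' (fun m => m + l) (fun m => m - l) ?_ ?_ ?_ ?_ ?_
    · intro m hm; rw [Finset.mem_Icc] at hm ⊢; omega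
    · intro m hm; rw [Finset.mem_Icc] at hm ⊢; omega
    · intro m _; ring
    · intro m _; ring
    · intro m _
      rw [add_sub_cancel_right, show n - l - m = n - (m + l) by ring]
  have e2 : ∀ m ∈ Finset.Icc (n - N) (M + L), a.act (n - m) ((b * c).coeff m) =
      ∑ l ∈ Finset.Icc (n - (N + M)) L, a.act (n - m) (b.act (m - l) (c.coeff l)) := by
    intro m hm
    rw [Finset.mem_Icc] at hm
    rw [coeff_mul_eq_sum b c hM hL m (s := Finset.Icc (n - (N + M)) L)
      (Finset.Icc_subset_Icc (by omega) le_rfl), map_sum]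
  rw [Finset.sum_congr rfl e1, Finset.sum_congr rfl e2, Finset.sum_comm]

theorem act_one (p : ℤ) (f : 𝒱) : (1 : PseudoDiffOp d).act p f = if p = 0 then f else 0 := by
  have h1 : ∀ n, (0 : ℤ) < n → (1 : PseudoDiffOp d).coeff n = 0 := fun n hn => by
    rw [coeff_one, if_neg hn.ne']
  rw [act_eq_sum _ h1 p ((-p).toNat + 1) (by omega)]
  rcases eq_or_ne p 0 with rfl | hp
  · simp [coeff_one]
  · rw [if_neg hp]
    refine Finset.sum_eq_zero fun k _ => ?_
    rw [coeff_one]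
    by_cases h : p + k = 0
    · have hk : 0 < k := by omega
      rw [h, Ring.choose_zero_pos ℤ hk, zero_smul]
    · rw [if_neg h]; simp

theorem act_apply_one (a : PseudoDiffOp d) (p : ℤ) : a.act p 1 = a.coeff p := by
  obtain ⟨N, hN⟩ := a.exists_bound
  rw [act_eq_sum a hN p ((N - p).toNat + 1) (by omega), Finset.sum_range_succ', Finset.sum_eq_zero]
  · simp
  · intro k _
    rw [pow_succ, Module.End.mul_apply]
    have : d.toLinearMap 1 = 0 := d.map_one_eq_zero
    rw [this]; simp

instance : Ring (PseudoDiffOp d) :=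
  { (inferInstance : AddCommGroup (PseudoDiffOp d)), (inferInstance : Mul (PseudoDiffOp d)),
    (inferInstance : One (PseudoDiffOp d)) with
    mul_assoc := mul_assoc'
    one_mul := fun a => by
      ext n
      rw [coeff_mul, finsum_eq_single _ n, act_one, sub_self, if_pos rfl]
      intro m hm
      rw [act_one, if_neg (by omega)]
    mul_one := fun a => by
      ext n
      rw [coeff_mul, finsum_eq_single _ 0, coeff_one, if_pos rfl, act_apply_one, sub_zero]
      intro m hm
      rw [coeff_one, if_neg hm, map_zero]
    zero_mul := fun a => by
      ext n
      rw [coeff_mul]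
      simp [act]
    mul_zero := fun a => by
      ext n
      rw [coeff_mul]
      simp
    left_distrib := fun a b c => by
      ext n
      rw [coeff_add, coeff_mul, coeff_mul, coeff_mul,
        ← finsum_add_distrib (mul_support_finite a b n) (mul_support_finite a c n)]
      simp
    right_distrib := fun a b c => by
      ext n
      rw [coeff_add, coeff_mul, coeff_mul, coeff_mul,
        ← finsum_add_distrib (mul_support_finite a c n) (mul_support_finite b c n)]
      simp [act_add] }

instance : Algebra F (PseudoDiffOp d) :=
  Algebra.ofModule
    (fun c a b => by
      ext n
      rw [coeff_smul, coeff_mul, coeff_mul, smul_finsum' c (mul_support_finite a b n)]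
      simp [act_smul])
    (fun c a b => by
      ext n
      rw [coeff_smul, coeff_mul, coeff_mul, smul_finsum' c (mul_support_finite a b n)]
      simp)

end PseudoDiffOp

/-- For linear maps `φ m k : R → S`, the map `R((z⁻¹)) → S((z⁻¹))` that sends `a(z)` to the series
with coefficients `m ↦ ∑ₖ φ m k (a_{m+k})`. -/
def tailSum {F R S : Type*} [Field F] [AddCommGroup R] [Module F R] [AddCommGroup S] [Module F S]
    (φ : ℤ → ℕ → R →ₗ[F] S) : LaurentInv F R →ₗ[F] LaurentInv F S :=
  (LinearMap.pi fun m => Finsupp.lsum F (φ m) ∘ₗ tail m).codRestrict (LaurentInv F S) (by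
    intro a
    obtain ⟨N, hN⟩ := a.2
    refine ⟨N, fun m hm => ?_⟩
    rw [LinearMap.pi_apply, LinearMap.comp_apply, tail_eq_zero hN hm, map_zero])

/-- The formal adjoint `a*(∂) = ∑ₙ (-∂)ⁿ ∘ aₙ`; the coefficient of `∂ᵐ` is
`∑ₖ (-1)ᵐ⁺ᵏ (m+k choose k) (a_{m+k})⁽ᵏ⁾`. -/
def formalAdjoint {F 𝒱 : Type*} [Field F] [CommRing 𝒱] [Algebra F 𝒱] (d : Derivation F 𝒱 𝒱) :
    PseudoDiffOp d →ₗ[F] PseudoDiffOp d :=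
  PseudoDiffOp.symbol.symm.toLinearMap ∘ₗ
    tailSum (fun m k => (((m + k).negOnePow : ℤ) * Ring.choose (m + k) k) •
      (d.toLinearMap ^ k : Module.End F 𝒱)) ∘ₗ PseudoDiffOp.symbol.toLinearMap

/-! ### Polynomials in `λ` with coefficients in `𝒱` -/

section Lambda

variable {F 𝒱 : Type*} [Field F] [CommRing 𝒱] [Algebra F 𝒱]

/-- `∂` acting on the coefficients of a polynomial in `λ`. -/
def coeffDeriv (d : Derivation F 𝒱 𝒱) : 𝒱[X] →ₗ[F] 𝒱[X] :=
  Polynomial.lsum fun n => (Polynomial.monomial n).restrictScalars F ∘ₗ d.toLinearMap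

/-- `λ + ∂` acting on polynomials in `λ`. -/
def lambdaAdd (d : Derivation F 𝒱 𝒱) : 𝒱[X] →ₗ[F] 𝒱[X] :=
  LinearMap.mulLeft F Polynomial.X + coeffDeriv d

/-- For `p(λ) = ∑ₙ pₙ λⁿ`, an operator `D` on `𝒱[λ]` and `f ∈ 𝒱[λ]`: `p(D) f = ∑ₙ pₙ Dⁿ f`. -/
def substOp (D : 𝒱[X] →ₗ[F] 𝒱[X]) (p f : 𝒱[X]) : 𝒱[X] :=
  p.sum fun n c => c • (D ^ n : Module.End F 𝒱[X]) f

/-- A `λ`-bracket on the differential algebra `(𝒱, d)`; the variable of the polynomials is `λ`. -/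
structure LambdaBracket (d : Derivation F 𝒱 𝒱) where
  /-- `{a_λ b} ∈ 𝒱[λ]` -/
  bracket : 𝒱 →ₗ[F] 𝒱 →ₗ[F] 𝒱[X]
  sesqui_left : ∀ a b, bracket (d a) b = -(Polynomial.X * bracket a b)
  sesqui_right : ∀ a b, bracket a (d b) = lambdaAdd d (bracket a b)
  leibniz_right : ∀ a b c,
    bracket a (b * c) = bracket a b * Polynomial.C c + bracket a c * Polynomial.C b
  leibniz_left : ∀ a b c, bracket (a * b) c =
    substOp (lambdaAdd d) (bracket a c) (Polynomial.C b) +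
      substOp (lambdaAdd d) (bracket b c) (Polynomial.C a)

/-- A Poisson vertex algebra structure on the differential algebra `(𝒱, d)`. -/
structure PoissonVertexStructure (d : Derivation F 𝒱 𝒱) extends LambdaBracket d where
  /-- `{b_λ a} = - ∑ₙ (-λ-∂)ⁿ cₙ`, where `{a_λ b} = ∑ₙ cₙ λⁿ` -/
  skew : ∀ a b, bracket b a = -((bracket a b).sum fun n c =>
    ((-lambdaAdd d) ^ n : Module.End F 𝒱[X]) (Polynomial.C c))
  /-- `{a_λ {b_μ c}} - {b_μ {a_λ c}} = {{a_λ b}_{λ+μ} c}` in `𝒱[λ][μ]`; the inner variable is `λ`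
  and the outer one is `μ` -/
  jacobi : ∀ a b c,
    ((bracket b c).sum fun n f => Polynomial.monomial n (bracket a f)) -
      ((bracket a c).sum fun n f =>
        (bracket b f).map Polynomial.C * Polynomial.C (Polynomial.X ^ n)) =
    (bracket a b).sum fun n f => Polynomial.C (Polynomial.X ^ n) *
      (bracket f c).eval₂ (Polynomial.C.comp Polynomial.C)
        (Polynomial.C Polynomial.X + Polynomial.X)

/-! ### Symbols in two variables

A series in `z^{±1}, w^{±1}` with coefficients in `𝒱[λ]` is a function `ℤ → ℤ → 𝒱[λ]`;
its value at `p q` is the coefficient of `zᵖ w^q`. -/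

variable (d : Derivation F 𝒱 𝒱)

/-- The symbol `a(z)`, with coefficients regarded in `𝒱[λ]`. -/
def symbolConst : PseudoDiffOp d →ₗ[F] LaurentInv F 𝒱[X] :=
  tailSum (fun _ k => if k = 0 then (Polynomial.CAlgHom (R := F) (A := 𝒱)).toLinearMap else 0) ∘ₗ
    PseudoDiffOp.symbol.toLinearMap

/-- `b(λ - z)`, expanded for large `z`:
the coefficient of `zᵐ` is `∑ₖ (-1)ᵐ (m+k choose k) b_{m+k} λᵏ`. -/
def evalLambdaSub : PseudoDiffOp d →ₗ[F] LaurentInv F 𝒱[X] :=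
  tailSum (fun m k => ((m.negOnePow : ℤ) * Ring.choose (m + k) k) •
    (Polynomial.monomial k).restrictScalars F) ∘ₗ PseudoDiffOp.symbol.toLinearMap

/-- `a*(λ - z)`. -/
def adjointEval : PseudoDiffOp d →ₗ[F] LaurentInv F 𝒱[X] := evalLambdaSub d ∘ₗ formalAdjoint d

/-- `b(w + λ + ∂) (z - s (w + D))⁻¹ g(z)`, for `s = ±1`, with
`(z - s (w + D))⁻¹ = ∑ⱼ sʲ z⁻¹⁻ʲ (w + D)ʲ`. All operators act on everything to their right. -/
def kernelLeft (s : ℤ) (D : 𝒱[X] →ₗ[F] 𝒱[X]) :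
    LaurentInv F 𝒱[X] →ₗ[F] PseudoDiffOp d →ₗ[F] (ℤ → ℤ → 𝒱[X]) :=
  LinearMap.mk₂ F
    (fun g b p q => (tail (p + 1) g).sum fun j f => s ^ j • ∑ i ∈ Finset.range (j + 1),
      j.choose i • shiftCoeff (lambdaAdd d) (q - i) b.symbol
        ((D ^ (j - i) : Module.End F 𝒱[X]) f))
    (by
      intro g g' b
      funext p q
      simp only [map_add, Pi.add_apply]
      rw [Finsupp.sum_add_index'] <;> simp [Finset.sum_add_distrib])
    (by
      intro c g b
      funext p q
      simp only [map_smul, Pi.smul_apply]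
      rw [Finsupp.sum_smul_index', Finsupp.smul_sum] <;>
        simp [Finset.smul_sum, smul_comm])
    (by
      intro g b b'
      funext p q
      simp [Finset.sum_add_distrib])
    (by
      intro c g b
      funext p q
      simp [Finset.smul_sum, Finsupp.smul_sum, smul_comm])

/-- `g(z) (z - s (w + D))⁻¹ b(w)`, for `s = ±1`, with
`(z - s (w + D))⁻¹ = ∑ⱼ sʲ z⁻¹⁻ʲ (w + D)ʲ`; here `D` acts on the coefficients of `b(w)`. -/
def kernelRight (s : ℤ) (D : 𝒱[X] →ₗ[F] 𝒱[X]) :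
    LaurentInv F 𝒱[X] →ₗ[F] PseudoDiffOp d →ₗ[F] (ℤ → ℤ → 𝒱[X]) :=
  LinearMap.mk₂ F
    (fun g b p q => (tail (p + 1) g).sum fun j f => s ^ j • ∑ i ∈ Finset.range (j + 1),
      j.choose i • (f * (D ^ (j - i) : Module.End F 𝒱[X]) (Polynomial.C (b.coeff (q - i)))))
    (by
      intro g g' b
      funext p q
      simp only [map_add, Pi.add_apply]
      rw [Finsupp.sum_add_index'] <;> simp [Finset.sum_add_distrib, add_mul])
    (by
      intro c g b
      funext p q
      simp only [map_smul, Pi.smul_apply]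
      rw [Finsupp.sum_smul_index' (fun j => by simp), Finsupp.smul_sum]
      refine Finset.sum_congr rfl fun j _ => ?_
      dsimp only
      rw [smul_comm c (s ^ j)]
      congr 1
      rw [Finset.smul_sum]
      refine Finset.sum_congr rfl fun i _ => ?_
      rw [smul_comm c, smul_mul_assoc])
    (by
      intro g b b'
      funext p q
      simp [Finset.sum_add_distrib, mul_add])
    (by
      intro c g b
      funext p q
      rw [Pi.smul_apply, Pi.smul_apply, Finsupp.smul_sum]
      refine Finset.sum_congr rfl fun j _ => ?_
      dsimp only
      rw [smul_comm c (s ^ j)]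
      congr 1
      rw [Finset.smul_sum]
      refine Finset.sum_congr rfl fun i _ => ?_
      rw [smul_comm c, PseudoDiffOp.coeff_smul, ← Polynomial.smul_C, map_smul, mul_smul_comm])

/-- `(b(w + λ + ∂) - b(w)) (λ + ∂)⁻¹ g(z)`: since
`(w + λ + ∂)ⁿ - wⁿ = ∑_{k ≥ 1} (n choose k) wⁿ⁻ᵏ (λ + ∂)ᵏ`, no negative power of `λ + ∂` occurs. -/
def kernelDiff : LaurentInv F 𝒱[X] →ₗ[F] PseudoDiffOp d →ₗ[F] (ℤ → ℤ → 𝒱[X]) :=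
  LinearMap.mk₂ F
    (fun g b p q => (tail (q + 1) b.symbol).sum fun j c =>
      Ring.choose (q + 1 + j) (j + 1) • c • (lambdaAdd d ^ j : Module.End F 𝒱[X]) (g.1 p))
    (by
      intro g g' b
      funext p q
      simp)
    (by
      intro c g b
      funext p q
      rw [Pi.smul_apply, Pi.smul_apply, Finsupp.smul_sum]
      refine Finset.sum_congr rfl fun j _ => ?_
      change _ • _ • (_ : Module.End F 𝒱[X]) (c • g.1 p) = _
      dsimp only
      rw [map_smul, smul_comm c, smul_comm c])
    (by
      intro g b b'
      funext p q
      simp only [map_add, Pi.add_apply]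
      rw [Finsupp.sum_add_index'] <;> simp [add_smul])
    (by
      intro c g b
      funext p q
      simp only [map_smul, Pi.smul_apply]
      rw [Finsupp.sum_smul_index' (fun j => by simp), Finsupp.smul_sum]
      refine Finset.sum_congr rfl fun j _ => ?_
      dsimp only
      rw [smul_comm c, smul_assoc])

/-- `{a(z)_λ b(w)} = ∑ {aₚ_λ b_q} zᵖ w^q`. -/
def LambdaBracket.symbolBracket {d : Derivation F 𝒱 𝒱} (P : LambdaBracket d) :
    PseudoDiffOp d →ₗ[F] PseudoDiffOp d →ₗ[F] (ℤ → ℤ → 𝒱[X]) :=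
  LinearMap.mk₂ F (fun a b p q => P.bracket (a.coeff p) (b.coeff q))
    (by intros; funext p q; simp) (by intros; funext p q; simp)
    (by intros; funext p q; simp) (by intros; funext p q; simp)

end Lambda

/-! ### Linear algebra -/

section LinearAlgebra

variable {F V : Type*} [Field F] [AddCommGroup V] [Module F V]

variable (F V) in
/-- The permutation `Ω ∈ End V ⊗ End V`, `Ω (v₁ ⊗ v₂) = v₂ ⊗ v₁`. -/
def permOmega [FiniteDimensional F V] : Module.End F V ⊗[F] Module.End F V :=
  (homTensorHomEquiv F V V V V).symm (TensorProduct.comm F V V).toLinearMap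

open Classical in
/-- `A ↦ A†`, the adjoint with respect to the bilinear form `B`: `B u (A† v) = B (A u) v`.
It is set to `0` if `B` is degenerate. -/
def formAdjoint [FiniteDimensional F V] (B : LinearMap.BilinForm F V) :
    Module.End F V →ₗ[F] Module.End F V :=
  if h : B.flip.Nondegenerate then
    (LinearEquiv.conj (LinearMap.BilinForm.toDual B.flip h).symm).toLinearMap ∘ₗ
      Module.Dual.transpose
  else 0

theorem apply_formAdjoint [FiniteDimensional F V] {B : LinearMap.BilinForm F V}
    (hB : B.Nondegenerate) (A : Module.End F V) (u v : V) :
    B u (formAdjoint B A v) = B (A u) v := by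
  have h : B.flip.Nondegenerate := LinearMap.BilinForm.Nondegenerate.flip hB
  rw [formAdjoint, dif_pos h]
  change B.flip ((LinearMap.BilinForm.toDual B.flip h).symm
    (Module.Dual.transpose A (LinearMap.BilinForm.toDual B.flip h v))) u = _
  rw [LinearMap.BilinForm.apply_toDual_symm_apply]
  rfl

/-- `Ω† = (Ω')† ⊗ Ω''`. -/
def permOmegaDagger [FiniteDimensional F V] (B : LinearMap.BilinForm F V) :
    Module.End F V ⊗[F] Module.End F V :=
  TensorProduct.map (formAdjoint B) LinearMap.id (permOmega F V)

/-- `(X, Y) ↦ (X ⊗ Y) W`. -/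
def tmulMul (W : Module.End F V ⊗[F] Module.End F V) :
    Module.End F V →ₗ[F] Module.End F V →ₗ[F] Module.End F V ⊗[F] Module.End F V :=
  (TensorProduct.mk F _ _).compr₂ (LinearMap.mulRight F W)

theorem tmulMul_apply (W : Module.End F V ⊗[F] Module.End F V) (X Y : Module.End F V) :
    tmulMul W X Y = (X ⊗ₜ[F] Y) * W := rfl

/-- `(X, Y) ↦ W (X ⊗ Y)`. -/
def mulTmul (W : Module.End F V ⊗[F] Module.End F V) :
    Module.End F V →ₗ[F] Module.End F V →ₗ[F] Module.End F V ⊗[F] Module.End F V :=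
  (TensorProduct.mk F _ _).compr₂ (LinearMap.mulLeft F W)

theorem mulTmul_apply (W : Module.End F V ⊗[F] Module.End F V) (X Y : Module.End F V) :
    mulTmul W X Y = W * (X ⊗ₜ[F] Y) := rfl

/-- `(X, Y) ↦ (1 ⊗ Y) W (X ⊗ 1)`. -/
def sandwichRL (W : Module.End F V ⊗[F] Module.End F V) :
    Module.End F V →ₗ[F] Module.End F V →ₗ[F] Module.End F V ⊗[F] Module.End F V :=
  ((LinearMap.mul F (Module.End F V ⊗[F] Module.End F V)).compl₁₂
    (LinearMap.mulRight F W ∘ₗ TensorProduct.mk F _ _ 1) ((TensorProduct.mk F _ _).flip 1)).flip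

theorem sandwichRL_apply (W : Module.End F V ⊗[F] Module.End F V) (X Y : Module.End F V) :
    sandwichRL W X Y = (1 ⊗ₜ[F] Y) * W * (X ⊗ₜ[F] 1) := rfl

/-- `(X, Y) ↦ (X ⊗ 1) W (1 ⊗ Y)`. -/
def sandwichLR (W : Module.End F V ⊗[F] Module.End F V) :
    Module.End F V →ₗ[F] Module.End F V →ₗ[F] Module.End F V ⊗[F] Module.End F V :=
  (LinearMap.mul F (Module.End F V ⊗[F] Module.End F V)).compl₁₂
    (LinearMap.mulRight F W ∘ₗ (TensorProduct.mk F _ _).flip 1) (TensorProduct.mk F _ _ 1)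

theorem sandwichLR_apply (W : Module.End F V ⊗[F] Module.End F V) (X Y : Module.End F V) :
    sandwichLR W X Y = (X ⊗ₜ[F] 1) * W * (1 ⊗ₜ[F] Y) := rfl

/-- `X ↦ J X I`, for the canonical decomposition `T = I J`, where `J = T : V ↠ im T` and
`I : im T ↪ V` is the inclusion. -/
def compress (T : Module.End F V) : Module.End F V →ₗ[F] Module.End F (LinearMap.range T) where
  toFun X := T.rangeRestrict ∘ₗ X ∘ₗ (LinearMap.range T).subtype
  map_add' X Y := by ext; simp
  map_smul' c X := by ext; simp

/-- The bilinear form `⟨u₁|u₂⟩ᵀ = ⟨J⁻¹ u₁ | I u₂⟩` on `im T`. A preimage under `J` is chosen; see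
`inducedForm_apply` for the independence of this choice. -/
def inducedForm (B : LinearMap.BilinForm F V) (T : Module.End F V) :
    LinearMap.BilinForm F (LinearMap.range T) :=
  B.compl₁₂ (T.rangeRestrict.exists_rightInverse_of_surjective T.range_rangeRestrict).choose
    (LinearMap.range T).subtype

theorem inducedForm_apply [FiniteDimensional F V] {B : LinearMap.BilinForm F V}
    (hB : B.Nondegenerate) {T : Module.End F V} {δ : F} (hδ : δ ≠ 0)
    (hT : formAdjoint B T = δ • T) (v : V) (u : LinearMap.range T) :
    inducedForm B T (T.rangeRestrict v) u = B v u := by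
  have hs := (T.rangeRestrict.exists_rightInverse_of_surjective T.range_rangeRestrict).choose_spec
  set s := (T.rangeRestrict.exists_rightInverse_of_surjective T.range_rangeRestrict).choose with hsd
  change B (s (T.rangeRestrict v)) u = B v u
  obtain ⟨w, hw⟩ := u.2
  have key : ∀ x, B (T x) w = δ * B x u := fun x => by
    rw [← apply_formAdjoint hB, hT, ← hw]; simp
  have h1 : T (s (T.rangeRestrict v)) = T v :=
    congrArg Subtype.val (LinearMap.congr_fun hs (T.rangeRestrict v))
  have h2 := key (s (T.rangeRestrict v))
  rw [h1, key] at h2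
  exact (mul_left_cancel₀ hδ h2).symm

end LinearAlgebra

/-! ### Operators of generalized Adler type -/

section Adler

variable {F 𝒱 V : Type*} [Field F] [CommRing 𝒱] [Algebra F 𝒱] [AddCommGroup V] [Module F V]
  {d : Derivation F 𝒱 𝒱}

/-- `A ↦ J A(∂) I`, from `𝒱((∂⁻¹)) ⊗ End V` to `𝒱((∂⁻¹)) ⊗ End (im T)`. -/
def sandwich (T : Module.End F V) :
    PseudoDiffOp d ⊗[F] Module.End F V →ₗ[F]
      PseudoDiffOp d ⊗[F] Module.End F (LinearMap.range T) :=
  TensorProduct.map LinearMap.id (compress T)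

/-- The generalized quasideterminant `|A|_{I,J} = (J A⁻¹ I)⁻¹`
(meaningful if `QuasideterminantExists T A`). -/
def quasideterminant (T : Module.End F V) (A : PseudoDiffOp d ⊗[F] Module.End F V) :
    PseudoDiffOp d ⊗[F] Module.End F (LinearMap.range T) :=
  Ring.inverse (sandwich T (Ring.inverse A))

/-- `A` is invertible, and so is `J A⁻¹ I`. -/
def QuasideterminantExists (T : Module.End F V) (A : PseudoDiffOp d ⊗[F] Module.End F V) : Prop :=
  IsUnit A ∧ IsUnit (sandwich T (Ring.inverse A))

/-- The generalized Adler identity, with all terms expanded for large `z`. In each summand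
`TensorProduct.map₂ f g` sends `(a ⊗ X, b ⊗ Y)` to `f a b ⊗ g X Y`; `a ⊗ X` stands for `A(z)` and
`b ⊗ Y` for `A(w)`. -/
def AdlerIdentity [FiniteDimensional F V] (P : PoissonVertexStructure d)
    (B : LinearMap.BilinForm F V) (α β γ : F) (A : PseudoDiffOp d ⊗[F] Module.End F V) : Prop :=
  TensorProduct.map₂ P.symbolBracket (TensorProduct.mk F _ _) A A =
    α • TensorProduct.map₂ (kernelLeft d 1 (lambdaAdd d) ∘ₗ adjointEval d)
      (tmulMul (permOmega F V)) A A
    - α • TensorProduct.map₂ (kernelRight d 1 (lambdaAdd d) ∘ₗ symbolConst d)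
      (mulTmul (permOmega F V)) A A
    - β • TensorProduct.map₂ (kernelLeft d (-1) (coeffDeriv d) ∘ₗ symbolConst d)
      (sandwichRL (permOmegaDagger B)) A A
    + β • TensorProduct.map₂ (kernelRight d (-1) (coeffDeriv d) ∘ₗ adjointEval d)
      (sandwichLR (permOmegaDagger B)) A A
    + γ • TensorProduct.map₂ (kernelDiff d ∘ₗ (adjointEval d - symbolConst d))
      (TensorProduct.mk F _ _) A A

/-- `A(∂)` is of generalized Adler type with parameters `α, β, γ`, with respect to the bilinear
form `B` and the sign `η`. For `β = 0` the form and the sign play no role. -/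
structure IsGeneralizedAdler [FiniteDimensional F V] (P : PoissonVertexStructure d)
    (B : LinearMap.BilinForm F V) (α β γ η : F)
    (A : PseudoDiffOp d ⊗[F] Module.End F V) : Prop where
  identity : AdlerIdentity P B α β γ A
  nondegenerate : β ≠ 0 → B.Nondegenerate
  symmetric_or_skew : β ≠ 0 → ∃ ε : F, (ε = 1 ∨ ε = -1) ∧ ∀ u v, B u v = ε * B v u
  sign : β ≠ 0 → η = 1 ∨ η = -1
  /-- `(A*(∂))† = η A(∂)` -/
  adjoint : β ≠ 0 → TensorProduct.map (formalAdjoint d) (formAdjoint B) A = η • A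

end Adler

end

end GenAdler

open GenAdler

/-!
The terms of the generalized Adler identity, expanded for large `z`, are double series in
`𝒱[λ]((w⁻¹))((z⁻¹))` with values in `End V ⊗ End V`. On this space the algebra
`𝒱((∂⁻¹)) ⊗ End V` acts from the left and from the right in the variable `z` (through the first
factor `End V`) and in the variable `w` (through the second one), and all four actions commute. For
the actions on series, `z`, `w`, `z - λ` and `w + λ + ∂` are the actions of `∂` from the right in
`z`, from the right in `w`, from the left in `z` and from the left in `w`
(`BimodulePair`, `seriesPair`). The bimodule laws come from the associativity of the
pseudodifferential operators over square-zero extensions `𝒱 ⊕ M` (`DiffModule.SqZero`).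

In these terms the identity is transparent. By the Leibniz rules and sesquilinearity, the bracket
`{a(z)_λ b(w)}` is a biderivation (`bracketSeries_mul_left`, `bracketSeries_mul_right`). The
`γ`-term is a biderivation too: `a*(λ - z) - a(z)` is the commutator of `a` with `1`, and
`(b(w + λ + ∂) - b(w)) (λ + ∂)⁻¹ f` is the commutator of `b` with a formal primitive of `f`
(`gammaSeries_mul_left`, `gammaSeries_mul_right`). The two `α`-terms are obtained from one kernel
`(z - w - λ)⁻¹ Ω` by letting `A` act twice from the left, or twice from the right. The two
`β`-terms are obtained from the kernel `(z + w)⁻¹ Ω†` by letting `A` act once from the left and once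
from the right. To see this, one moves the action of `A` through the inverse of an operator that
commutes with it, such as the sum of two actions of `∂` (`zLeft_alphaKernel` and its companions).

Inverses: a biderivation satisfies `g(A⁻¹, A⁻¹) = L_z L_w R_z R_w g(A, A)`, where all four actions
are those of `A⁻¹`. Applied to the right-hand side of the identity for `A`, these actions cancel
those of `A` and leave the complementary ones. So the two `α`-terms are exchanged, and so are the
two `β`-terms (`BimodulePair.AdlerShape.inverse`), which changes the signs of `α` and `β`. The
condition on adjoints passes to the inverse since `A ↦ (A*)†` is an antihomomorphism
(`formalAdjoint_mul`, `formAdjoint_mul`).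

Compression by `T = I J` only concerns the factors `End V`: one applies `X ⊗ Y ↦ J X I ⊗ J Y I` to
the identity for `A`. For the terms with `Ω` this is clear. For those with `Ω†` it follows from
`(J ⊗ 1) Ω† (1 ⊗ I) = (1 ⊗ I) Ω† (J ⊗ 1)` and its mirror image, where `Ω†` on the right belongs to
the induced form on the image of `T` (`permOmegaDagger_left`, `permOmegaDagger_right`). The
quasideterminant is the inverse of a compression of the inverse.
-/

namespace GenAdler

noncomputable section

/-! ### Functoriality of Laurent series and of pseudodifferential operators -/

section Functoriality

variable {F R S : Type*} [Field F] [AddCommGroup R] [Module F R] [AddCommGroup S] [Module F S]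

-- Shortcuts: for coefficients which are themselves Laurent series, the operations found through
-- `Submodule` are not recognized as those of the additive group.
instance : Neg (LaurentInv F R) := (inferInstance : AddCommGroup (LaurentInv F R)).toNeg

instance : Sub (LaurentInv F R) := (inferInstance : AddCommGroup (LaurentInv F R)).toSub

/-- The map `R((z⁻¹)) → S((z⁻¹))` which applies a linear map to every coefficient. -/
def LaurentInv.map (T : R →ₗ[F] S) : LaurentInv F R →ₗ[F] LaurentInv F S :=
  (LinearMap.pi fun n => T ∘ₗ LinearMap.proj n ∘ₗ (LaurentInv F R).subtype).codRestrict
    (LaurentInv F S) (by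
      intro a
      obtain ⟨N, hN⟩ := a.2
      exact ⟨N, fun n hn => by simp [hN n hn]⟩)

@[simp] theorem LaurentInv.map_coeff (T : R →ₗ[F] S) (a : LaurentInv F R) (n : ℤ) :
    (LaurentInv.map T a).1 n = T (a.1 n) := rfl

theorem LaurentInv.ext {a b : LaurentInv F R} (h : ∀ n, a.1 n = b.1 n) : a = b :=
  Subtype.ext (funext h)

@[simp] theorem LaurentInv.add_coeff (a b : LaurentInv F R) (n : ℤ) :
    (a + b).1 n = a.1 n + b.1 n := rfl

@[simp] theorem LaurentInv.sub_coeff (a b : LaurentInv F R) (n : ℤ) :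
    (a - b).1 n = a.1 n - b.1 n := rfl

@[simp] theorem LaurentInv.zero_coeff (n : ℤ) : (0 : LaurentInv F R).1 n = 0 := rfl

@[simp] theorem LaurentInv.smul_coeff (c : F) (a : LaurentInv F R) (n : ℤ) :
    (c • a).1 n = c • a.1 n := rfl

variable {𝒱 𝒲 : Type*} [CommRing 𝒱] [Algebra F 𝒱] [CommRing 𝒲] [Algebra F 𝒲]
  {d : Derivation F 𝒱 𝒱} {e : Derivation F 𝒲 𝒲}

/-- A homomorphism of differential algebras applied to the coefficients of pseudodifferential
operators. -/
def PseudoDiffOp.mapLinear (d : Derivation F 𝒱 𝒱) (e : Derivation F 𝒲 𝒲) (φ : 𝒱 →ₗ[F] 𝒲) :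
    PseudoDiffOp d →ₗ[F] PseudoDiffOp e :=
  PseudoDiffOp.symbol.symm.toLinearMap ∘ₗ LaurentInv.map φ ∘ₗ PseudoDiffOp.symbol.toLinearMap

@[simp] theorem PseudoDiffOp.mapLinear_coeff (φ : 𝒱 →ₗ[F] 𝒲) (a : PseudoDiffOp d) (n : ℤ) :
    (PseudoDiffOp.mapLinear d e φ a).coeff n = φ (a.coeff n) := rfl

theorem derivation_pow_comm (φ : 𝒱 →ₐ[F] 𝒲) (h : ∀ f, φ (d f) = e (φ f)) (k : ℕ) (f : 𝒱) :
    φ ((d.toLinearMap ^ k : Module.End F 𝒱) f) = (e.toLinearMap ^ k : Module.End F 𝒲) (φ f) := by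
  induction k generalizing f with
  | zero => simp
  | succ k ih => rw [pow_succ, pow_succ, Module.End.mul_apply, Module.End.mul_apply, ih]; simp [h]

theorem PseudoDiffOp.mapLinear_mul (φ : 𝒱 →ₐ[F] 𝒲) (h : ∀ f, φ (d f) = e (φ f))
    (a b : PseudoDiffOp d) :
    PseudoDiffOp.mapLinear d e φ.toLinearMap (a * b) =
      PseudoDiffOp.mapLinear d e φ.toLinearMap a * PseudoDiffOp.mapLinear d e φ.toLinearMap b := by
  obtain ⟨N, hN⟩ := a.exists_bound
  obtain ⟨M, hM⟩ := b.exists_bound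
  have hN' : ∀ n, N < n → (PseudoDiffOp.mapLinear d e φ.toLinearMap a).coeff n = 0 :=
    fun n hn => by rw [PseudoDiffOp.mapLinear_coeff, hN n hn, map_zero]
  have hM' : ∀ n, M < n → (PseudoDiffOp.mapLinear d e φ.toLinearMap b).coeff n = 0 :=
    fun n hn => by rw [PseudoDiffOp.mapLinear_coeff, hM n hn, map_zero]
  ext n
  rw [PseudoDiffOp.mapLinear_coeff, PseudoDiffOp.coeff_mul_eq_sum a b hN hM n subset_rfl,
    PseudoDiffOp.coeff_mul_eq_sum _ _ hN' hM' n subset_rfl, map_sum]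
  refine Finset.sum_congr rfl fun m _ => ?_
  have hK : N < n - m + ((N - (n - m)).toNat + 1 : ℕ) := by omega
  rw [PseudoDiffOp.act_eq_sum a hN _ _ hK, PseudoDiffOp.act_eq_sum _ hN' _ _ hK, map_sum]
  refine Finset.sum_congr rfl fun k _ => ?_
  simp [derivation_pow_comm φ h]

theorem PseudoDiffOp.mapLinear_one (φ : 𝒱 →ₐ[F] 𝒲) :
    PseudoDiffOp.mapLinear d e φ.toLinearMap 1 = 1 := by
  ext n
  rw [PseudoDiffOp.mapLinear_coeff, PseudoDiffOp.coeff_one, PseudoDiffOp.coeff_one]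
  split_ifs <;> simp

end Functoriality

/-! ### Differential modules and their Laurent series -/

/-- A module `M` over the differential algebra `(𝒱, d)` with a compatible operator `D`. The action
of `𝒱` is explicit data, since `𝒱[λ]` carries two such structures. -/
structure DiffModule {F 𝒱 : Type*} [Field F] [CommRing 𝒱] [Algebra F 𝒱] (d : Derivation F 𝒱 𝒱)
    (M : Type*) [AddCommGroup M] [Module F M] where
  /-- the action of `𝒱` -/
  act : 𝒱 →ₐ[F] Module.End F M
  /-- the operator over `d` -/
  D : Module.End F M
  leibniz : ∀ f m, D (act f m) = act (d f) m + act f (D m)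

namespace DiffModule

variable {F 𝒱 M M' : Type*} [Field F] [CommRing 𝒱] [Algebra F 𝒱] {d : Derivation F 𝒱 𝒱}
  [AddCommGroup M] [Module F M] [AddCommGroup M'] [Module F M']

/-- The space `M` with its action of `𝒱` as an instance. -/
def Carrier (_C : DiffModule d M) : Type _ := M

section Instances

variable (C : DiffModule d M)

instance : AddCommGroup C.Carrier := inferInstanceAs (AddCommGroup M)

instance : Module F C.Carrier := inferInstanceAs (Module F M)

instance : Module 𝒱 C.Carrier := Module.compHom M C.act.toRingHom

instance : Module 𝒱ᵐᵒᵖ C.Carrier :=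
  Module.compHom C.Carrier ((RingHom.id 𝒱).fromOpposite fun _ _ => mul_comm _ _)

instance : IsCentralScalar 𝒱 C.Carrier := ⟨fun _ _ => rfl⟩

/-- The identity, as a map from `M` to `M` with its `𝒱`-module structure. -/
def toCarrier : M ≃ₗ[F] C.Carrier := LinearEquiv.refl F M

instance : IsScalarTower F 𝒱 C.Carrier :=
  ⟨fun c f m => by
    exact LinearMap.congr_fun (map_smul C.act c f) (C.toCarrier.symm m)⟩

instance : IsScalarTower F 𝒱ᵐᵒᵖ C.Carrier :=
  ⟨fun c f m => by
    exact LinearMap.congr_fun (map_smul C.act c f.unop) (C.toCarrier.symm m)⟩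

/-- The square-zero extension `𝒱 ⊕ M`. It is a differential algebra, and `M((z⁻¹))` is a two-sided
ideal in its algebra of pseudodifferential operators. In this way the bimodule structure of
`M((z⁻¹))` over `𝒱((∂⁻¹))` follows from the associativity of that algebra. -/
abbrev SqZero : Type _ := TrivSqZeroExt 𝒱 C.Carrier

/-- The projection of the square-zero extension to `M`. -/
def sqSnd : C.SqZero →ₗ[F] M :=
  C.toCarrier.symm.toLinearMap ∘ₗ (TrivSqZeroExt.sndHom 𝒱 C.Carrier).restrictScalars F

/-- The inclusion of `M` in the square-zero extension. -/
def sqInr : M →ₗ[F] C.SqZero :=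
  (TrivSqZeroExt.inrHom 𝒱 C.Carrier).restrictScalars F ∘ₗ C.toCarrier.toLinearMap

@[simp] theorem sqSnd_inr (m : M) : C.sqSnd (C.sqInr m) = m := rfl

@[simp] theorem fst_sqInr (m : M) : (C.sqInr m).fst = 0 := rfl

theorem sq_ext {x y : C.SqZero} (h1 : x.fst = y.fst) (h2 : C.sqSnd x = C.sqSnd y) : x = y :=
  TrivSqZeroExt.ext h1 h2

@[simp] theorem sqSnd_inl (f : 𝒱) : C.sqSnd (TrivSqZeroExt.inl f) = 0 := rfl

theorem sqSnd_mul (x y : C.SqZero) :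
    C.sqSnd (x * y) = C.act x.fst (C.sqSnd y) + C.act y.fst (C.sqSnd x) := rfl

/-- The derivation `d ⊕ D` of the square-zero extension. -/
def sqDeriv : Derivation F C.SqZero C.SqZero :=
  Derivation.mk'
    ((TrivSqZeroExt.inlAlgHom F 𝒱 C.Carrier).toLinearMap ∘ₗ d.toLinearMap ∘ₗ
        (TrivSqZeroExt.fstHom F 𝒱 C.Carrier).toLinearMap +
      C.sqInr ∘ₗ C.D ∘ₗ C.sqSnd)
    (by
      intro x y
      refine C.sq_ext ?_ ?_
      · simp
      · simp [sqSnd_mul, C.leibniz]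
        abel)

@[simp] theorem fst_sqDeriv (x : C.SqZero) : (C.sqDeriv x).fst = d x.fst := by
  simp [sqDeriv]

@[simp] theorem sqSnd_sqDeriv (x : C.SqZero) : C.sqSnd (C.sqDeriv x) = C.D (C.sqSnd x) := by
  simp [sqDeriv]

/-- The algebra homomorphism `f ↦ f + δ f` to the square-zero extension, for a derivation `δ`. -/
def sqSection (δ : 𝒱 →ₗ[F] M) (hδ : ∀ f g, δ (f * g) = C.act f (δ g) + C.act g (δ f)) :
    𝒱 →ₐ[F] C.SqZero :=
  AlgHom.ofLinearMap ((TrivSqZeroExt.inlAlgHom F 𝒱 C.Carrier).toLinearMap + C.sqInr ∘ₗ δ)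
    (by
      have h := hδ 1 1
      simp only [mul_one, map_one, Module.End.one_apply] at h
      have h0 : δ 1 = 0 := by simpa using h
      refine C.sq_ext ?_ ?_ <;> simp [h0])
    (by
      intro f g
      refine C.sq_ext ?_ ?_
      · simp
      · simp [sqSnd_mul, hδ])

/-- The homomorphism of square-zero extensions induced by a map of modules. -/
def sqMap (C' : DiffModule d M') (T : M →ₗ[F] M')
    (hT : ∀ f m, T (C.act f m) = C'.act f (T m)) : C.SqZero →ₐ[F] C'.SqZero :=
  AlgHom.ofLinearMap
    ((TrivSqZeroExt.inlAlgHom F 𝒱 C'.Carrier).toLinearMap ∘ₗ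
      (TrivSqZeroExt.fstHom F 𝒱 C.Carrier).toLinearMap + C'.sqInr ∘ₗ T ∘ₗ C.sqSnd)
    (by
      have h0 : C.sqSnd 1 = 0 := rfl
      refine C'.sq_ext ?_ ?_ <;> simp [h0])
    (by
      intro x y
      refine C'.sq_ext ?_ ?_
      · simp
      · simp [sqSnd_mul, hT])

theorem sqDeriv_pow_inr (k : ℕ) (m : M) :
    (C.sqDeriv.toLinearMap ^ k : Module.End F C.SqZero) (C.sqInr m) =
      C.sqInr ((C.D ^ k : Module.End F M) m) := by
  induction k generalizing m with
  | zero => rfl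
  | succ k ih =>
    have h : C.sqDeriv (C.sqInr m) = C.sqInr (C.D m) := by
      refine C.sq_ext ?_ ?_ <;> simp
    rw [pow_succ, pow_succ, Module.End.mul_apply, Module.End.mul_apply, ← ih, ← h]
    rfl

end Instances

section Actions

variable (C : DiffModule d M)

/-- The inclusion of `𝒱((∂⁻¹))` in the operators over the square-zero extension. -/
def opInl : PseudoDiffOp d →ₗ[F] PseudoDiffOp C.sqDeriv :=
  PseudoDiffOp.mapLinear d C.sqDeriv (TrivSqZeroExt.inlAlgHom F 𝒱 C.Carrier).toLinearMap

/-- The projection of the operators over the square-zero extension to `𝒱((∂⁻¹))`. -/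
def opFst : PseudoDiffOp C.sqDeriv →ₗ[F] PseudoDiffOp d :=
  PseudoDiffOp.mapLinear C.sqDeriv d (TrivSqZeroExt.fstHom F 𝒱 C.Carrier).toLinearMap

/-- The inclusion of `M((z⁻¹))` in the operators over the square-zero extension. -/
def opInr : LaurentInv F M →ₗ[F] PseudoDiffOp C.sqDeriv :=
  PseudoDiffOp.symbol.symm.toLinearMap ∘ₗ LaurentInv.map C.sqInr

/-- The projection of the operators over the square-zero extension to `M((z⁻¹))`. -/
def opSnd : PseudoDiffOp C.sqDeriv →ₗ[F] LaurentInv F M :=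
  LaurentInv.map C.sqSnd ∘ₗ PseudoDiffOp.symbol.toLinearMap

theorem opInr_coeff (G : LaurentInv F M) (n : ℤ) : (C.opInr G).coeff n = C.sqInr (G.1 n) := rfl

theorem opInl_mul (a b : PseudoDiffOp d) : C.opInl (a * b) = C.opInl a * C.opInl b :=
  PseudoDiffOp.mapLinear_mul _ (fun f => by refine C.sq_ext ?_ ?_ <;> simp) a b

theorem opInl_one : C.opInl 1 = 1 := PseudoDiffOp.mapLinear_one _

theorem opFst_mul (x y : PseudoDiffOp C.sqDeriv) : C.opFst (x * y) = C.opFst x * C.opFst y :=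
  PseudoDiffOp.mapLinear_mul _ (fun f => by simp) x y

@[simp] theorem opFst_opInr (G : LaurentInv F M) : C.opFst (C.opInr G) = 0 :=
  PseudoDiffOp.ext fun _ => rfl

@[simp] theorem opSnd_opInr (G : LaurentInv F M) : C.opSnd (C.opInr G) = G := rfl

theorem opInr_opSnd {x : PseudoDiffOp C.sqDeriv} (hx : C.opFst x = 0) :
    C.opInr (C.opSnd x) = x := by
  refine PseudoDiffOp.ext fun n => C.sq_ext ?_ rfl
  exact (congrArg (fun y => PseudoDiffOp.coeff y n) hx).symm

/-- `M((z⁻¹))` is a square-zero ideal. -/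
theorem opInr_mul_opInr (G H : LaurentInv F M) : C.opInr G * C.opInr H = 0 := by
  ext1 n
  obtain ⟨N, hN⟩ := (C.opInr G).exists_bound
  obtain ⟨K, hK⟩ := (C.opInr H).exists_bound
  rw [PseudoDiffOp.coeff_mul_eq_sum _ _ hN hK n subset_rfl, PseudoDiffOp.coeff_zero]
  refine Finset.sum_eq_zero fun m _ => ?_
  rw [PseudoDiffOp.act_eq_sum _ hN (n - m) ((N - (n - m)).toNat + 1) (by omega)]
  refine Finset.sum_eq_zero fun k _ => ?_
  rw [opInr_coeff, opInr_coeff, sqDeriv_pow_inr]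
  change _ • (TrivSqZeroExt.inr _ * TrivSqZeroExt.inr _) = _
  rw [TrivSqZeroExt.inr_mul_inr, smul_zero]

/-- The left action `a(z + D) G(z)` of `𝒱((∂⁻¹))` on `M((z⁻¹))`. -/
def left : PseudoDiffOp d →ₗ[F] Module.End F (LaurentInv F M) :=
  LinearMap.mk₂ F (fun a G => C.opSnd (C.opInl a * C.opInr G))
    (by intros; simp [add_mul]) (by intros; simp) (by intros; simp [mul_add]) (by intros; simp)

/-- The right action `G(z + ∂) a(z)` of `𝒱((∂⁻¹))` on `M((z⁻¹))`; here `∂` acts on the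
coefficients of `a(z)` only. -/
def right : PseudoDiffOp d →ₗ[F] Module.End F (LaurentInv F M) :=
  LinearMap.mk₂ F (fun a G => C.opSnd (C.opInr G * C.opInl a))
    (by intros; simp [mul_add]) (by intros; simp) (by intros; simp [add_mul]) (by intros; simp)

theorem opInr_left (a : PseudoDiffOp d) (G : LaurentInv F M) :
    C.opInr (C.left a G) = C.opInl a * C.opInr G :=
  C.opInr_opSnd (x := C.opInl a * C.opInr G) (by rw [opFst_mul, opFst_opInr, mul_zero])

theorem opInr_right (a : PseudoDiffOp d) (G : LaurentInv F M) :
    C.opInr (C.right a G) = C.opInr G * C.opInl a :=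
  C.opInr_opSnd (x := C.opInr G * C.opInl a) (by rw [opFst_mul, opFst_opInr, zero_mul])

theorem opInr_injective : Function.Injective C.opInr :=
  Function.LeftInverse.injective C.opSnd_opInr

theorem left_mul (a b : PseudoDiffOp d) : C.left (a * b) = C.left a * C.left b := by
  ext1 G
  apply C.opInr_injective
  rw [opInr_left, Module.End.mul_apply, opInr_left, opInr_left, opInl_mul, mul_assoc]

theorem left_one : C.left 1 = 1 := by
  ext1 G
  apply C.opInr_injective
  rw [opInr_left, opInl_one, one_mul, Module.End.one_apply]

theorem right_mul (a b : PseudoDiffOp d) : C.right (a * b) = C.right b * C.right a := by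
  ext1 G
  apply C.opInr_injective
  rw [opInr_right, Module.End.mul_apply, opInr_right, opInr_right, opInl_mul, mul_assoc]

theorem right_one : C.right 1 = 1 := by
  ext1 G
  apply C.opInr_injective
  rw [opInr_right, opInl_one, mul_one, Module.End.one_apply]

theorem left_right_comm (a b : PseudoDiffOp d) : Commute (C.left a) (C.right b) := by
  ext1 G
  apply C.opInr_injective
  rw [Module.End.mul_apply, Module.End.mul_apply, opInr_left, opInr_right, opInr_right, opInr_left,
    mul_assoc]

/-- A derivation `δ : 𝒱 → M` over the derivations induces a derivation `𝒱((∂⁻¹)) → M((z⁻¹))`: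
`f ↦ f + δ f` is a homomorphism of differential algebras. -/
theorem map_mul_of_derivation (δ : 𝒱 →ₗ[F] M)
    (hδ : ∀ f g, δ (f * g) = C.act f (δ g) + C.act g (δ f)) (hd : ∀ f, δ (d f) = C.D (δ f))
    (a b : PseudoDiffOp d) :
    LaurentInv.map δ (a * b).symbol =
      C.left a (LaurentInv.map δ b.symbol) + C.right b (LaurentInv.map δ a.symbol) := by
  have h := PseudoDiffOp.mapLinear_mul (d := d) (e := C.sqDeriv) (C.sqSection δ hδ) (fun f => by
    refine C.sq_ext ?_ ?_ <;> simp [sqSection, hd]) a b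
  have h1 : ∀ a : PseudoDiffOp d, PseudoDiffOp.mapLinear d C.sqDeriv
      (C.sqSection δ hδ).toLinearMap a = C.opInl a + C.opInr (LaurentInv.map δ a.symbol) :=
    fun a => rfl
  rw [h1, h1, h1, add_mul, mul_add, mul_add, opInr_mul_opInr, opInl_mul, ← opInr_left,
    ← opInr_right, add_zero, add_assoc, ← map_add] at h
  exact C.opInr_injective (add_left_cancel h)

/-- A map of modules induces a homomorphism of operators over the square-zero extensions. -/
theorem opMap_inl_inr (C' : DiffModule d M') (T : M →ₗ[F] M')
    (hT : ∀ f m, T (C.act f m) = C'.act f (T m)) (a : PseudoDiffOp d) (G : LaurentInv F M) :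
    PseudoDiffOp.mapLinear C.sqDeriv C'.sqDeriv (C.sqMap C' T hT).toLinearMap (C.opInl a) =
        C'.opInl a ∧
      PseudoDiffOp.mapLinear C.sqDeriv C'.sqDeriv (C.sqMap C' T hT).toLinearMap (C.opInr G) =
        C'.opInr (LaurentInv.map T G) := by
  constructor
  · refine PseudoDiffOp.ext fun n => C'.sq_ext ?_ ?_
    · change _ + (0 : 𝒱) = _
      rw [add_zero]; rfl
    · change (0 : M') + T 0 = 0
      simp
  · refine PseudoDiffOp.ext fun n => C'.sq_ext ?_ ?_
    · change _ + (0 : 𝒱) = _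
      rw [add_zero]; rfl
    · change (0 : M') + _ = _
      exact zero_add _

/-- The left action commutes with maps of differential modules. -/
theorem map_left (C' : DiffModule d M') (T : M →ₗ[F] M')
    (hT : ∀ f m, T (C.act f m) = C'.act f (T m)) (hD : ∀ m, T (C.D m) = C'.D (T m))
    (a : PseudoDiffOp d) (G : LaurentInv F M) :
    LaurentInv.map T (C.left a G) = C'.left a (LaurentInv.map T G) := by
  apply C'.opInr_injective
  rw [opInr_left, ← (C.opMap_inl_inr C' T hT a G).1, ← (C.opMap_inl_inr C' T hT a G).2,
    ← PseudoDiffOp.mapLinear_mul, ← opInr_left, (C.opMap_inl_inr C' T hT a _).2]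
  intro x
  refine C'.sq_ext ?_ ?_ <;> simp [sqMap, hD]

end Actions

end DiffModule

/-! ### Coefficients of the actions on Laurent series -/

section Coefficients

namespace DiffModule

variable {F 𝒱 M : Type*} [Field F] [CommRing 𝒱] [Algebra F 𝒱] {d : Derivation F 𝒱 𝒱}
  [AddCommGroup M] [Module F M] (C : DiffModule d M)

/-- The coefficient of `zᵖ` in `a(z + D)`. -/
def leftCoeff (a : PseudoDiffOp d) (p : ℤ) : Module.End F M :=
  (tail p a.symbol).sum fun k c => Ring.choose (p + k) k • (C.act c * C.D ^ k)

theorem leftCoeff_eq_sum (a : PseudoDiffOp d) {N : ℤ} (hN : ∀ n, N < n → a.coeff n = 0) (p : ℤ)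
    (K : ℕ) (hK : N < p + K) :
    C.leftCoeff a p = ∑ k ∈ Finset.range K,
      Ring.choose (p + k) k • (C.act (a.coeff (p + k)) * C.D ^ k) := by
  rw [leftCoeff, Finsupp.sum_of_support_subset _ (s := Finset.range K)]
  · rfl
  · intro j hj
    rw [Finsupp.mem_support_iff, tail_apply] at hj
    by_contra h
    apply hj
    apply hN
    simp only [Finset.mem_range, not_lt] at h
    omega
  · simp

theorem leftCoeff_eq_zero (a : PseudoDiffOp d) {N : ℤ} (hN : ∀ n, N < n → a.coeff n = 0) {p : ℤ}
    (h : N < p) : C.leftCoeff a p = 0 := by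
  rw [C.leftCoeff_eq_sum a hN p 0 (by simpa using h), Finset.sum_range_zero]

theorem sqDeriv_pow_inl (k : ℕ) (f : 𝒱) :
    (C.sqDeriv.toLinearMap ^ k : Module.End F C.SqZero) (TrivSqZeroExt.inl f) =
      TrivSqZeroExt.inl ((d.toLinearMap ^ k : Module.End F 𝒱) f) :=
  (derivation_pow_comm (TrivSqZeroExt.inlAlgHom F 𝒱 C.Carrier)
    (fun f => by refine C.sq_ext ?_ ?_ <;> simp) k f).symm

theorem opInl_bound {a : PseudoDiffOp d} {N : ℤ} (hN : ∀ n, N < n → a.coeff n = 0) (n : ℤ)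
    (hn : N < n) : (C.opInl a).coeff n = 0 := by
  rw [opInl, PseudoDiffOp.mapLinear_coeff, hN n hn, map_zero]

theorem opInr_bound {G : LaurentInv F M} {N : ℤ} (hN : ∀ n, N < n → G.1 n = 0) (n : ℤ)
    (hn : N < n) : (C.opInr G).coeff n = 0 := by
  rw [opInr_coeff, hN n hn, map_zero]

theorem act_opInl (a : PseudoDiffOp d) (p : ℤ) (m : M) :
    (C.opInl a).act p (C.sqInr m) = C.sqInr (C.leftCoeff a p m) := by
  obtain ⟨N, hN⟩ := a.exists_bound
  have hK : N < p + ((N - p).toNat + 1 : ℕ) := by omega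
  rw [PseudoDiffOp.act_eq_sum _ (C.opInl_bound hN) p _ hK, C.leftCoeff_eq_sum a hN p _ hK,
    LinearMap.sum_apply, map_sum]
  refine Finset.sum_congr rfl fun k _ => ?_
  rw [sqDeriv_pow_inr, LinearMap.smul_apply, map_zsmul]
  congr 1
  refine C.sq_ext ?_ ?_
  · simp
  · rw [sqSnd_mul, sqSnd_inr, sqSnd_inr, fst_sqInr, map_zero, LinearMap.zero_apply, add_zero]
    rfl

/-- The coefficients of `a(z + D) G(z)`. -/
theorem left_coeff (a : PseudoDiffOp d) (G : LaurentInv F M) {N K : ℤ}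
    (hN : ∀ n, N < n → a.coeff n = 0) (hK : ∀ n, K < n → G.1 n = 0) (n : ℤ) {s : Finset ℤ}
    (hs : Finset.Icc (n - N) K ⊆ s) :
    (C.left a G).1 n = ∑ m ∈ s, C.leftCoeff a (n - m) (G.1 m) := by
  change C.sqSnd ((C.opInl a * C.opInr G).coeff n) = _
  rw [PseudoDiffOp.coeff_mul_eq_sum _ _ (C.opInl_bound hN) (C.opInr_bound hK) n hs, map_sum]
  refine Finset.sum_congr rfl fun m _ => ?_
  rw [opInr_coeff, act_opInl, sqSnd_inr]

theorem left_coeff_finsum (a : PseudoDiffOp d) (G : LaurentInv F M) (n : ℤ) :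
    (C.left a G).1 n = ∑ᶠ m, C.leftCoeff a (n - m) (G.1 m) := by
  obtain ⟨N, hN⟩ := a.exists_bound
  obtain ⟨K, hK⟩ := G.2
  rw [C.left_coeff a G hN hK n subset_rfl, finsum_eq_sum_of_support_subset]
  intro m hm
  rw [Finset.coe_Icc, Set.mem_Icc]
  constructor
  · by_contra h
    exact hm (by simp only; rw [C.leftCoeff_eq_zero a hN (by omega)]; rfl)
  · by_contra h
    exact hm (by simp only; rw [hK m (by omega), map_zero])

theorem act_opInr (G : LaurentInv F M) {N : ℤ} (hN : ∀ n, N < n → G.1 n = 0) (p : ℤ) (f : 𝒱)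
    (K : ℕ) (hK : N < p + K) :
    C.sqSnd ((C.opInr G).act p (TrivSqZeroExt.inl f)) = ∑ k ∈ Finset.range K,
      Ring.choose (p + k) k • C.act ((d.toLinearMap ^ k : Module.End F 𝒱) f) (G.1 (p + k)) := by
  rw [PseudoDiffOp.act_eq_sum _ (C.opInr_bound hN) p _ hK, map_sum]
  refine Finset.sum_congr rfl fun k _ => ?_
  rw [sqDeriv_pow_inl, map_zsmul, sqSnd_mul, opInr_coeff, sqSnd_inr, sqSnd_inl, map_zero, zero_add,
    TrivSqZeroExt.fst_inl]

/-- The coefficients of `G(z + ∂) a(z)`. -/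
theorem right_coeff (a : PseudoDiffOp d) (G : LaurentInv F M) {N K : ℤ}
    (hN : ∀ n, N < n → a.coeff n = 0) (hK : ∀ n, K < n → G.1 n = 0) (n : ℤ) {s : Finset ℤ}
    (hs : Finset.Icc (n - K) N ⊆ s) :
    (C.right a G).1 n = ∑ m ∈ s, ∑ k ∈ Finset.range ((K - (n - m)).toNat + 1),
      Ring.choose (n - m + k) k •
        C.act ((d.toLinearMap ^ k : Module.End F 𝒱) (a.coeff m)) (G.1 (n - m + k)) := by
  change C.sqSnd ((C.opInr G * C.opInl a).coeff n) = _
  rw [PseudoDiffOp.coeff_mul_eq_sum _ _ (C.opInr_bound hK) (C.opInl_bound hN) n hs, map_sum]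
  refine Finset.sum_congr rfl fun m _ => ?_
  exact C.act_opInr G hK _ _ _ (by omega)

/-- The right action does not involve `D`, so it commutes with every operator commuting with the
action of `𝒱`. -/
theorem map_right {M' : Type*} [AddCommGroup M'] [Module F M'] (C' : DiffModule d M')
    (T : M →ₗ[F] M') (hT : ∀ f m, T (C.act f m) = C'.act f (T m))
    (a : PseudoDiffOp d) (G : LaurentInv F M) :
    LaurentInv.map T (C.right a G) = C'.right a (LaurentInv.map T G) := by
  obtain ⟨N, hN⟩ := a.exists_bound
  obtain ⟨K, hK⟩ := G.2
  refine LaurentInv.ext fun n => ?_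
  rw [LaurentInv.map_coeff, C.right_coeff a G hN hK n subset_rfl,
    C'.right_coeff a _ hN (K := K) (fun n hn => by rw [LaurentInv.map_coeff, hK n hn, map_zero]) n
      subset_rfl, map_sum]
  refine Finset.sum_congr rfl fun m _ => ?_
  rw [map_sum]
  refine Finset.sum_congr rfl fun k _ => ?_
  rw [map_zsmul, hT, LaurentInv.map_coeff]

end DiffModule

/-- The monomial `m z⁰`. -/
def LaurentInv.const {F R : Type*} [Field F] [AddCommGroup R] [Module F R] :
    R →ₗ[F] LaurentInv F R :=
  (LinearMap.single F (fun _ : ℤ => R) 0).codRestrict (LaurentInv F R)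
    (fun m => ⟨0, fun n hn => by simp [hn.ne']⟩)

theorem LaurentInv.const_coeff {F R : Type*} [Field F] [AddCommGroup R] [Module F R] (m : R)
    (n : ℤ) : (LaurentInv.const (F := F) m).1 n = if n = 0 then m else 0 := by
  change (Pi.single 0 m : ℤ → R) n = _
  rw [Pi.single_apply]

@[simp] theorem LaurentInv.const_coeff_zero {F R : Type*} [Field F] [AddCommGroup R] [Module F R]
    (m : R) : (LaurentInv.const (F := F) m).1 0 = m := by
  rw [const_coeff, if_pos rfl]

theorem LaurentInv.map_const {F R S : Type*} [Field F] [AddCommGroup R] [Module F R]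
    [AddCommGroup S] [Module F S] (T : R →ₗ[F] S) (m : R) :
    LaurentInv.map T (LaurentInv.const m) = LaurentInv.const (T m) := by
  refine LaurentInv.ext fun n => ?_
  rw [map_coeff, const_coeff, const_coeff]
  split_ifs <;> simp

/-- Multiplication by `z` on `R((z⁻¹))`. -/
def LaurentInv.mulVar {F R : Type*} [Field F] [AddCommGroup R] [Module F R] :
    Module.End F (LaurentInv F R) :=
  (LinearMap.funLeft F R (fun n : ℤ => n - 1) ∘ₗ (LaurentInv F R).subtype).codRestrict
    (LaurentInv F R) (by
      intro a
      obtain ⟨N, hN⟩ := a.2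
      exact ⟨N + 1, fun n hn => hN (n - 1) (by omega)⟩)

@[simp] theorem LaurentInv.mulVar_coeff {F R : Type*} [Field F] [AddCommGroup R] [Module F R]
    (G : LaurentInv F R) (n : ℤ) : (LaurentInv.mulVar G).1 n = G.1 (n - 1) := rfl

theorem LaurentInv.mulVar_pow_coeff {F R : Type*} [Field F] [AddCommGroup R] [Module F R]
    (k : ℕ) (G : LaurentInv F R) (n : ℤ) :
    ((LaurentInv.mulVar ^ k : Module.End F (LaurentInv F R)) G).1 n = G.1 (n - k) := by
  induction k generalizing n with
  | zero => simp
  | succ k ih =>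
    rw [pow_succ', Module.End.mul_apply, mulVar_coeff, ih]
    exact congrArg G.1 (by push_cast; ring)

/-- The operator `∂`, with symbol `z`. -/
def PseudoDiffOp.del {F 𝒱 : Type*} [Field F] [CommRing 𝒱] [Algebra F 𝒱] (d : Derivation F 𝒱 𝒱) :
    PseudoDiffOp d :=
  PseudoDiffOp.symbol.symm (LaurentInv.mulVar (LaurentInv.const 1))

namespace DiffModule

variable {F 𝒱 M : Type*} [Field F] [CommRing 𝒱] [Algebra F 𝒱] {d : Derivation F 𝒱 𝒱}
  [AddCommGroup M] [Module F M] (C : DiffModule d M)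

theorem del_coeff (n : ℤ) : (PseudoDiffOp.del d).coeff n = if n = 1 then 1 else 0 := by
  change (LaurentInv.const (F := F) (1 : 𝒱)).1 (n - 1) = _
  rw [LaurentInv.const_coeff]
  simp only [sub_eq_zero]

theorem left_const (a : PseudoDiffOp d) (m : M) (n : ℤ) :
    (C.left a (LaurentInv.const m)).1 n = C.leftCoeff a n m := by
  rw [left_coeff_finsum, finsum_eq_single _ 0]
  · simp
  · intro k hk
    rw [LaurentInv.const_coeff, if_neg hk, map_zero]

theorem right_const (a : PseudoDiffOp d) (m : M) (n : ℤ) :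
    (C.right a (LaurentInv.const m)).1 n = C.act (a.coeff n) m := by
  obtain ⟨N, hN⟩ := a.exists_bound
  rw [C.right_coeff a (LaurentInv.const m) hN (K := 0)
    (fun n hn => by rw [LaurentInv.const_coeff, if_neg hn.ne']) n
    (s := insert n (Finset.Icc (n - 0) N)) (Finset.subset_insert _ _),
    Finset.sum_eq_single n]
  · rw [Finset.sum_eq_single 0]
    · simp
    · intro k _ hk
      rw [LaurentInv.const_coeff, if_neg (by omega), map_zero, smul_zero]
    · simp
  · intro b _ hb
    refine Finset.sum_eq_zero fun k _ => ?_
    rw [LaurentInv.const_coeff]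
    split_ifs with h
    · rw [h, Ring.choose_zero_pos ℤ (by omega), zero_smul]
    · rw [map_zero, smul_zero]
  · simp

theorem leftCoeff_del (p : ℤ) :
    C.leftCoeff (PseudoDiffOp.del d) p = if p = 1 then 1 else if p = 0 then C.D else 0 := by
  have h1 : ∀ n, (1 : ℤ) < n → (PseudoDiffOp.del d).coeff n = 0 := fun n hn => by
    rw [del_coeff, if_neg hn.ne']
  by_cases hp : 1 < p
  · rw [C.leftCoeff_eq_zero _ h1 hp, if_neg (by omega), if_neg (by omega)]
  · rw [C.leftCoeff_eq_sum _ h1 p ((1 - p).toNat + 1) (by omega),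
      Finset.sum_eq_single (1 - p).toNat]
    · have e : p + ((1 - p).toNat : ℤ) = 1 := by omega
      rw [e, del_coeff, if_pos rfl, map_one, one_mul]
      split_ifs with h h'
      · subst h; simp
      · subst h'; simp
      · have : (1 : ℤ) = ((1 : ℕ) : ℤ) := rfl
        rw [this, Ring.choose_natCast, Nat.choose_eq_zero_of_lt (by omega)]
        simp
    · intro k _ hk
      rw [del_coeff, if_neg (by omega), map_zero, zero_mul, smul_zero]
    · simp

theorem left_del (G : LaurentInv F M) :
    C.left (PseudoDiffOp.del d) G = LaurentInv.mulVar G + LaurentInv.map C.D G := by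
  refine LaurentInv.ext fun n => ?_
  rw [left_coeff_finsum, finsum_eq_sum_of_support_subset (s := {n - 1, n}),
    Finset.sum_pair (by omega)]
  · simp [leftCoeff_del]
  · intro m hm
    by_contra h
    apply hm
    simp only [Finset.coe_insert, Finset.coe_singleton, Set.mem_insert_iff,
      Set.mem_singleton_iff, not_or] at h
    simp only [leftCoeff_del]
    rw [if_neg (by omega), if_neg (by omega), LinearMap.zero_apply]

theorem right_del (G : LaurentInv F M) :
    C.right (PseudoDiffOp.del d) G = LaurentInv.mulVar G := by
  obtain ⟨K, hK⟩ := G.2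
  refine LaurentInv.ext fun n => ?_
  rw [C.right_coeff _ G (N := 1) (fun n hn => by rw [del_coeff, if_neg hn.ne']) hK n
    (s := insert 1 (Finset.Icc (n - K) 1)) (Finset.subset_insert _ _), Finset.sum_eq_single 1]
  · rw [Finset.sum_eq_single 0]
    · simp [del_coeff]
    · intro k _ hk
      obtain ⟨k, rfl⟩ := Nat.exists_eq_succ_of_ne_zero hk
      have h1 : d.toLinearMap 1 = 0 := d.map_one_eq_zero
      rw [del_coeff, if_pos rfl, pow_succ, Module.End.mul_apply, h1]
      simp
    · simp
  · intro b _ hb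
    refine Finset.sum_eq_zero fun k _ => ?_
    rw [del_coeff, if_neg hb]
    simp
  · simp

end DiffModule

end Coefficients

/-! ### The two differential module structures on `𝒱[λ]` -/

section PolynomialModules

variable {F 𝒱 : Type*} [Field F] [CommRing 𝒱] [Algebra F 𝒱] (d : Derivation F 𝒱 𝒱)

theorem coeffDeriv_monomial (n : ℕ) (f : 𝒱) :
    coeffDeriv d (Polynomial.monomial n f) = Polynomial.monomial n (d f) := by
  change ((Polynomial.monomial n f).sum fun n c => Polynomial.monomial n (d c)) = _
  rw [Polynomial.sum_monomial_index]
  simp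

theorem coeffDeriv_C (f : 𝒱) : coeffDeriv d (Polynomial.C f) = Polynomial.C (d f) :=
  coeffDeriv_monomial d 0 f

theorem coeffDeriv_mul (p q : 𝒱[X]) :
    coeffDeriv d (p * q) = coeffDeriv d p * q + p * coeffDeriv d q := by
  induction p using Polynomial.induction_on' with
  | add p p' hp hp' => rw [add_mul, map_add, hp, hp', map_add]; ring
  | monomial n f =>
    induction q using Polynomial.induction_on' with
    | add q q' hq hq' => rw [mul_add, map_add, hq, hq', map_add]; ring
    | monomial m g =>
      rw [Polynomial.monomial_mul_monomial, coeffDeriv_monomial, coeffDeriv_monomial,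
        coeffDeriv_monomial, Polynomial.monomial_mul_monomial, Polynomial.monomial_mul_monomial,
        Derivation.leibniz, smul_eq_mul, smul_eq_mul, ← map_add, add_comm (f * d g), mul_comm g]

theorem coeffDeriv_X_mul (p : 𝒱[X]) :
    coeffDeriv d (Polynomial.X * p) = Polynomial.X * coeffDeriv d p := by
  rw [coeffDeriv_mul, ← Polynomial.monomial_one_one_eq_X, coeffDeriv_monomial,
    d.map_one_eq_zero, map_zero, zero_mul, zero_add]

theorem coeffDeriv_one : coeffDeriv d (1 : 𝒱[X]) = 0 := by
  rw [← Polynomial.C_1, coeffDeriv_C, d.map_one_eq_zero, Polynomial.C_0]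

theorem lambdaAdd_apply (p : 𝒱[X]) : lambdaAdd d p = Polynomial.X * p + coeffDeriv d p := rfl

theorem lambdaAdd_smul (f : 𝒱) (p : 𝒱[X]) :
    lambdaAdd d (f • p) = d f • p + f • lambdaAdd d p := by
  simp only [lambdaAdd_apply, Polynomial.smul_eq_C_mul, coeffDeriv_mul, coeffDeriv_C]
  ring

theorem lambdaAdd_X_mul (p : 𝒱[X]) :
    lambdaAdd d (Polynomial.X * p) = Polynomial.X * lambdaAdd d p := by
  simp only [lambdaAdd_apply, coeffDeriv_X_mul, mul_add]

theorem lambdaAdd_pow_one (n : ℕ) :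
    (lambdaAdd d ^ n : Module.End F 𝒱[X]) 1 = Polynomial.X ^ n := by
  induction n with
  | zero => simp
  | succ n ih =>
    have h : coeffDeriv d (Polynomial.X ^ n : 𝒱[X]) = 0 := by
      rw [← Polynomial.monomial_one_right_eq_X_pow, coeffDeriv_monomial, d.map_one_eq_zero,
        map_zero]
    rw [pow_succ', Module.End.mul_apply, ih, lambdaAdd_apply, h, add_zero, pow_succ']

/-- As a module over `𝒱` with the operator `λ + ∂`, the space `𝒱[λ]` is generated by `1`. -/
theorem end_ext_of_lambdaAdd {T T' : Module.End F 𝒱[X]} (hT : ∀ (f : 𝒱) p, T (f • p) = f • T p)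
    (hT' : ∀ (f : 𝒱) p, T' (f • p) = f • T' p) (hD : ∀ p, T (lambdaAdd d p) = lambdaAdd d (T p))
    (hD' : ∀ p, T' (lambdaAdd d p) = lambdaAdd d (T' p)) (h1 : T 1 = T' 1) : T = T' := by
  have hpow : ∀ n : ℕ, T ((lambdaAdd d ^ n : Module.End F 𝒱[X]) 1) =
      T' ((lambdaAdd d ^ n : Module.End F 𝒱[X]) 1) := by
    intro n
    induction n with
    | zero => simpa using h1
    | succ n ih => rw [pow_succ', Module.End.mul_apply, hD, hD', ih]
  ext1 p
  induction p using Polynomial.induction_on' with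
  | add p q hp hq => rw [map_add, map_add, hp, hq]
  | monomial n f =>
    rw [← mul_one f, ← smul_eq_mul, ← Polynomial.smul_monomial,
      Polynomial.monomial_one_right_eq_X_pow, ← lambdaAdd_pow_one d, hT, hT', hpow]

/-- The differential module `𝒱[λ]` in which `𝒱` acts by multiplication and `D = λ + ∂`; it governs
the second argument of a `λ`-bracket. -/
def sndModule : DiffModule d 𝒱[X] where
  act := Algebra.lsmul F F 𝒱[X]
  D := lambdaAdd d
  leibniz := lambdaAdd_smul d

theorem sndModule_act (f : 𝒱) (p : 𝒱[X]) : (sndModule d).act f p = f • p := rfl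

/-- `(f, p) ↦ p(λ + ∂) f`. This is the action which occurs in the left Leibniz rule
`{f g_λ h} = {f_{λ+∂} h}_→ g + {g_{λ+∂} h}_→ f`. -/
def substAct : 𝒱 →ₗ[F] Module.End F 𝒱[X] :=
  LinearMap.mk₂ F (fun f p => substOp (lambdaAdd d) p (Polynomial.C f))
    (by
      intro f g p
      simp [substOp, Polynomial.sum, Finset.sum_add_distrib])
    (by
      intro c f p
      simp only [substOp, Polynomial.sum, Finset.smul_sum]
      refine Finset.sum_congr rfl fun n _ => ?_
      rw [← Polynomial.smul_C, map_smul, smul_comm])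
    (by
      intro f p q
      exact Polynomial.sum_add_index p q _ (fun _ => zero_smul _ _) (fun _ _ _ => add_smul _ _ _))
    (by
      intro c f p
      simp only [substOp]
      rw [← algebraMap_smul 𝒱 c p, Polynomial.sum_smul_index p (algebraMap F 𝒱 c)
        (fun n c => c • (lambdaAdd d ^ n : Module.End F 𝒱[X]) (Polynomial.C f))
        (fun _ => zero_smul _ _)]
      simp only [Polynomial.sum, Finset.smul_sum]
      refine Finset.sum_congr rfl fun n _ => ?_
      rw [← smul_eq_mul, algebraMap_smul, smul_assoc])

theorem substAct_monomial (f g : 𝒱) (n : ℕ) :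
    substAct d f (Polynomial.monomial n g) =
      g • (lambdaAdd d ^ n : Module.End F 𝒱[X]) (Polynomial.C f) := by
  exact Polynomial.sum_monomial_index g
    (fun n c => c • (lambdaAdd d ^ n : Module.End F 𝒱[X]) (Polynomial.C f)) (zero_smul _ _)

theorem substAct_one (f : 𝒱) : substAct d f 1 = Polynomial.C f := by
  rw [← Polynomial.monomial_zero_one, substAct_monomial]
  simp

theorem substAct_smul (f g : 𝒱) (p : 𝒱[X]) : substAct d f (g • p) = g • substAct d f p := by
  induction p using Polynomial.induction_on' with
  | add p q hp hq => rw [smul_add, map_add, hp, hq, map_add, smul_add]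
  | monomial n h => rw [Polynomial.smul_monomial, substAct_monomial, substAct_monomial, smul_assoc]

/-- The action of `f` in the first argument commutes with that of `λ + ∂` in the second one. -/
theorem substAct_lambdaAdd (f : 𝒱) (p : 𝒱[X]) :
    substAct d f (lambdaAdd d p) = lambdaAdd d (substAct d f p) := by
  induction p using Polynomial.induction_on' with
  | add p q hp hq => simp only [map_add, hp, hq]
  | monomial n h =>
    rw [lambdaAdd_apply, Polynomial.X_mul_monomial, coeffDeriv_monomial, map_add,
      substAct_monomial, substAct_monomial, substAct_monomial, lambdaAdd_smul, pow_succ',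
      Module.End.mul_apply, add_comm]

/-- The differential module `𝒱[λ]` in which `f ∈ 𝒱` acts by `p ↦ p(λ + ∂) f` and `D = -λ`; it
governs the first argument of a `λ`-bracket. -/
def fstModule : DiffModule d 𝒱[X] where
  act := AlgHom.ofLinearMap (substAct d)
    (end_ext_of_lambdaAdd d (substAct_smul d 1) (fun _ _ => rfl) (substAct_lambdaAdd d 1)
      (fun _ => rfl) (by rw [substAct_one]; rfl))
    (fun f g => end_ext_of_lambdaAdd d (substAct_smul d _)
      (fun h p => by simp only [Module.End.mul_apply, substAct_smul]) (substAct_lambdaAdd d _)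
      (fun p => by simp only [Module.End.mul_apply, substAct_lambdaAdd])
      (by
        rw [Module.End.mul_apply, substAct_one, substAct_one, ← mul_one (Polynomial.C g),
          ← Polynomial.smul_eq_C_mul, substAct_smul, substAct_one, Polynomial.smul_eq_C_mul,
          map_mul, mul_comm]))
  D := -LinearMap.mulLeft F Polynomial.X
  leibniz := by
    intro f m
    -- Both sides commute with `𝒱` and with `λ + ∂`, so they are compared at `1` only.
    have h : -LinearMap.mulLeft F Polynomial.X * substAct d f = substAct d (d f) +
        substAct d f * -LinearMap.mulLeft F Polynomial.X := by
      refine end_ext_of_lambdaAdd d ?_ ?_ ?_ ?_ ?_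
      · intro g p
        simp [substAct_smul]
      · intro g p
        have h : -(Polynomial.X * g • p) = g • (-(Polynomial.X * p)) := by simp
        simp only [LinearMap.add_apply, Module.End.mul_apply, LinearMap.neg_apply,
          LinearMap.mulLeft_apply, substAct_smul, h, smul_add]
      · intro p
        simp [substAct_lambdaAdd, lambdaAdd_X_mul]
      · intro p
        have h : -(Polynomial.X * lambdaAdd d p) = lambdaAdd d (-(Polynomial.X * p)) := by
          rw [map_neg, lambdaAdd_X_mul]
        simp only [LinearMap.add_apply, Module.End.mul_apply, LinearMap.neg_apply,
          LinearMap.mulLeft_apply, substAct_lambdaAdd, h, map_add]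
      · have h : (-(Polynomial.X * 1) : 𝒱[X]) = -lambdaAdd d 1 := by
          rw [lambdaAdd_apply, coeffDeriv_one, add_zero]
        simp only [LinearMap.add_apply, Module.End.mul_apply, LinearMap.neg_apply,
          LinearMap.mulLeft_apply, h, map_neg, substAct_lambdaAdd, substAct_one]
        rw [lambdaAdd_apply, coeffDeriv_C]
        ring
    exact LinearMap.congr_fun h m

theorem fstModule_act (f : 𝒱) (p : 𝒱[X]) : (fstModule d).act f p = substAct d f p := rfl

theorem fstModule_D (p : 𝒱[X]) : (fstModule d).D p = -(Polynomial.X * p) := rfl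

end PolynomialModules

/-! ### Iterated Laurent series and resolvents -/

section Resolvent

variable {F M M' : Type*} [Field F] [AddCommGroup M] [Module F M] [AddCommGroup M'] [Module F M']

/-- `LaurentInv.map` as a homomorphism of endomorphism algebras. -/
def LaurentInv.mapEnd : Module.End F M →ₐ[F] Module.End F (LaurentInv F M) :=
  AlgHom.ofLinearMap
    { toFun := LaurentInv.map, map_add' := fun _ _ => rfl, map_smul' := fun _ _ => rfl }
    rfl (fun _ _ => rfl)

@[simp] theorem LaurentInv.mapEnd_apply (T : Module.End F M) :
    LaurentInv.mapEnd T = LaurentInv.map T := rfl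

theorem LaurentInv.commute_mulVar_map (T : Module.End F M) :
    Commute LaurentInv.mulVar (LaurentInv.map T) := rfl

/-- Laurent series with coefficients in a differential module, with coefficientwise operations. -/
def DiffModule.laurent {𝒱 : Type*} [CommRing 𝒱] [Algebra F 𝒱] {d : Derivation F 𝒱 𝒱}
    (C : DiffModule d M) : DiffModule d (LaurentInv F M) where
  act := LaurentInv.mapEnd.comp C.act
  D := LaurentInv.map C.D
  leibniz f G := LaurentInv.ext fun n => C.leibniz f (G.1 n)

/-- `(z - Y)⁻¹ G(z)`, expanded for large `z`. -/
def resolvent (Y : Module.End F M) : Module.End F (LaurentInv F M) :=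
  (LinearMap.pi fun p : ℤ => Finsupp.lsum F (fun j => Y ^ j) ∘ₗ tail (p + 1)).codRestrict
    (LaurentInv F M) (by
      intro a
      obtain ⟨N, hN⟩ := a.2
      refine ⟨N, fun m hm => ?_⟩
      rw [LinearMap.pi_apply, LinearMap.comp_apply, tail_eq_zero hN (by omega), map_zero])

theorem resolvent_coeff (Y : Module.End F M) (G : LaurentInv F M) (p : ℤ) :
    (resolvent Y G).1 p = (tail (p + 1) G).sum fun j m => (Y ^ j) m := rfl

/-- A sum over the finitely many nonzero coefficients from `zᵖ` upwards, as a sum over a range. -/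
theorem tail_sum_eq {G : LaurentInv F M} {N : ℤ} (hN : ∀ n, N < n → G.1 n = 0) (p : ℤ)
    (T : ℕ → M →ₗ[F] M') (K : ℕ) (hK : N < p + K) :
    ((tail p G).sum fun j m => T j m) = ∑ j ∈ Finset.range K, T j (G.1 (p + j)) := by
  rw [Finsupp.sum_of_support_subset _ (s := Finset.range K)]
  · rfl
  · intro j hj
    rw [Finsupp.mem_support_iff, tail_apply] at hj
    by_contra h
    apply hj
    apply hN
    simp only [Finset.mem_range, not_lt] at h
    omega
  · simp

theorem resolvent_spec (Y : Module.End F M) (G : LaurentInv F M) :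
    LaurentInv.mulVar (resolvent Y G) - LaurentInv.map Y (resolvent Y G) = G := by
  obtain ⟨N, hN⟩ := G.2
  refine LaurentInv.ext fun p => ?_
  rw [LaurentInv.sub_coeff, LaurentInv.mulVar_coeff, LaurentInv.map_coeff, resolvent_coeff,
    resolvent_coeff, sub_add_cancel,
    tail_sum_eq hN p (fun j => (Y ^ j : Module.End F M)) ((N - p).toNat + 1 + 1) (by omega),
    tail_sum_eq hN (p + 1) (fun j => (Y ^ j : Module.End F M)) ((N - p).toNat + 1) (by omega),
    Finset.sum_range_succ', map_sum]
  simp only [pow_succ', Module.End.mul_apply, Nat.cast_add, Nat.cast_one, Nat.cast_zero, pow_zero,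
    Module.End.one_apply, add_zero]
  have h : ∀ j : ℕ, p + ((j : ℤ) + 1) = p + 1 + j := fun j => by ring
  simp only [h, add_sub_cancel_left]

/-- A series bounded above is determined by its image under `z - Y`. -/
theorem eq_zero_of_mulVar_eq (Y : Module.End F M) {H : LaurentInv F M}
    (h : LaurentInv.mulVar H = LaurentInv.map Y H) : H = 0 := by
  obtain ⟨N, hN⟩ := H.2
  have hstep : ∀ n, H.1 (n - 1) = Y (H.1 n) := fun n =>
    congrArg (fun G : LaurentInv F M => G.1 n) h
  have key : ∀ k : ℕ, ∀ n : ℤ, N < n + k → H.1 n = 0 := by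
    intro k
    induction k with
    | zero => intro n hn; exact hN n (by simpa using hn)
    | succ k ih =>
      intro n hn
      have := hstep (n + 1)
      rw [add_sub_cancel_right, ih (n + 1) (by push_cast at hn; omega), map_zero] at this
      exact this
  exact LaurentInv.ext fun n => key (N - n + 1).toNat n (by omega)

theorem eq_resolvent (Y : Module.End F M) {G H : LaurentInv F M}
    (h : LaurentInv.mulVar H - LaurentInv.map Y H = G) : H = resolvent Y G := by
  rw [← sub_eq_zero]
  apply eq_zero_of_mulVar_eq Y
  rw [← sub_eq_zero, map_sub, map_sub, sub_sub_sub_comm, h, resolvent_spec, sub_self]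

/-- A map which intertwines `z - Y` and `z - Y'` intertwines their inverses. -/
theorem apply_resolvent {Y : Module.End F M} {Y' : Module.End F M'}
    (Φ : LaurentInv F M →ₗ[F] LaurentInv F M')
    (h : ∀ H, Φ (LaurentInv.mulVar H - LaurentInv.map Y H) =
      LaurentInv.mulVar (Φ H) - LaurentInv.map Y' (Φ H)) (G : LaurentInv F M) :
    Φ (resolvent Y G) = resolvent Y' (Φ G) :=
  eq_resolvent Y' (by rw [← h, resolvent_spec])

/-- `(z - Y - E)⁻¹ G = (z - Y)⁻¹ G` if `E G = 0` and `E` commutes with `Y`. -/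
theorem resolvent_add {Y E : Module.End F M} (hE : Commute Y E) {G : LaurentInv F M}
    (hG : LaurentInv.map E G = 0) : resolvent (Y + E) G = resolvent Y G := by
  symm
  have h : LaurentInv.map E (resolvent Y G) = 0 := by
    rw [apply_resolvent (Y' := Y) (LaurentInv.map E), hG, map_zero]
    intro H
    rw [map_sub]
    congr 1
    exact LaurentInv.ext fun n => (LinearMap.congr_fun hE (H.1 n)).symm
  refine eq_resolvent _ ?_
  have h2 : LaurentInv.map (Y + E) (resolvent Y G) =
    LaurentInv.map Y (resolvent Y G) + LaurentInv.map E (resolvent Y G) := rfl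
  rw [h2, h, add_zero, resolvent_spec]

theorem resolvent_neg_add {Y E : Module.End F M} (hE : Commute Y E) {G : LaurentInv F M}
    (hG : LaurentInv.map E G = 0) : resolvent (-(Y + E)) G = resolvent (-Y) G := by
  rw [neg_add]
  refine resolvent_add hE.neg_left.neg_right ?_
  have h : LaurentInv.map (-E) G = -LaurentInv.map E G := rfl
  rw [h, hG, neg_zero]

theorem resolvent_map_coeff {R : Type*} [AddCommGroup R] [Module F R] (Y : Module.End F M)
    (T : R →ₗ[F] M) (g : LaurentInv F R) (p : ℤ) :
    (resolvent Y (LaurentInv.map T g)).1 p =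
      (tail (p + 1) g).sum fun j f => (Y ^ j) (T f) := by
  obtain ⟨N, hN⟩ := g.2
  have hN' : ∀ n, N < n → (LaurentInv.map T g).1 n = 0 := fun n hn => by
    rw [LaurentInv.map_coeff, hN n hn, map_zero]
  have hK : N < p + 1 + ((N - p).toNat : ℕ) := by omega
  rw [resolvent_coeff, tail_sum_eq hN' _ (fun j => (Y ^ j : Module.End F M)) _ hK]
  exact (tail_sum_eq hN _ (fun j => (Y ^ j : Module.End F M) ∘ₗ T) _ hK).symm

end Resolvent

/-! ### Series in two variables as a double bimodule -/

section DoubleSeries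

variable {F 𝒱 : Type*} [Field F] [CommRing 𝒱] [Algebra F 𝒱] (d : Derivation F 𝒱 𝒱)

variable (F 𝒱) in
/-- The space `𝒱[λ]((w⁻¹))((z⁻¹))`; the outer variable is `z`. All terms of the generalized Adler
identity lie in it when they are expanded for large `z`. -/
abbrev DoubleSeries : Type _ := LaurentInv F (LaurentInv F 𝒱[X])

/-- The coefficients of a double series. -/
def expand : DoubleSeries F 𝒱 →ₗ[F] (ℤ → ℤ → 𝒱[X]) where
  toFun G p q := (G.1 p).1 q
  map_add' _ _ := rfl
  map_smul' _ _ := rfl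

theorem expand_apply (G : DoubleSeries F 𝒱) (p q : ℤ) : expand G p q = (G.1 p).1 q := rfl

theorem expand_injective : Function.Injective (expand (F := F) (𝒱 := 𝒱)) := fun _ _ h =>
  LaurentInv.ext fun p => LaurentInv.ext fun q => congrFun (congrFun h p) q

/-- The action of `a(∂)` from the left in the variable `z`. -/
def zLeft : PseudoDiffOp d →ₗ[F] Module.End F (DoubleSeries F 𝒱) := (fstModule d).laurent.left

/-- The action of `a(∂)` from the right in the variable `z`. -/
def zRight : PseudoDiffOp d →ₗ[F] Module.End F (DoubleSeries F 𝒱) := (fstModule d).laurent.right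

/-- The action of `b(∂)` from the left in the variable `w`. -/
def wLeft : PseudoDiffOp d →ₗ[F] Module.End F (DoubleSeries F 𝒱) :=
  LaurentInv.mapEnd.toLinearMap ∘ₗ (sndModule d).left

/-- The action of `b(∂)` from the right in the variable `w`. -/
def wRight : PseudoDiffOp d →ₗ[F] Module.End F (DoubleSeries F 𝒱) :=
  LaurentInv.mapEnd.toLinearMap ∘ₗ (sndModule d).right

theorem wLeft_apply (b : PseudoDiffOp d) : wLeft d b = LaurentInv.map ((sndModule d).left b) := rfl

theorem wRight_apply (b : PseudoDiffOp d) :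
    wRight d b = LaurentInv.map ((sndModule d).right b) := rfl

theorem zLeft_mul (a b : PseudoDiffOp d) : zLeft d (a * b) = zLeft d a * zLeft d b :=
  DiffModule.left_mul _ a b

theorem zRight_mul (a b : PseudoDiffOp d) : zRight d (a * b) = zRight d b * zRight d a :=
  DiffModule.right_mul _ a b

theorem wLeft_mul (a b : PseudoDiffOp d) : wLeft d (a * b) = wLeft d a * wLeft d b := by
  rw [wLeft_apply, DiffModule.left_mul]; rfl

theorem wRight_mul (a b : PseudoDiffOp d) : wRight d (a * b) = wRight d b * wRight d a := by
  rw [wRight_apply, DiffModule.right_mul]; rfl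

theorem zLeft_one : zLeft d 1 = 1 := DiffModule.left_one _

theorem zRight_one : zRight d 1 = 1 := DiffModule.right_one _

theorem wLeft_one : wLeft d 1 = 1 := by rw [wLeft_apply, DiffModule.left_one]; rfl

theorem wRight_one : wRight d 1 = 1 := by rw [wRight_apply, DiffModule.right_one]; rfl

theorem commute_zLeft_zRight (a b : PseudoDiffOp d) : Commute (zLeft d a) (zRight d b) :=
  DiffModule.left_right_comm _ a b

theorem commute_wLeft_wRight (a b : PseudoDiffOp d) : Commute (wLeft d a) (wRight d b) :=
  ((sndModule d).left_right_comm a b).map (LaurentInv.mapEnd (F := F))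

theorem commute_snd_left_map (b : PseudoDiffOp d) (T : Module.End F 𝒱[X])
    (hT : ∀ (f : 𝒱) p, T (f • p) = f • T p) (hD : ∀ p, T (lambdaAdd d p) = lambdaAdd d (T p)) :
    Commute ((sndModule d).left b) (LaurentInv.map T) := by
  ext1 G
  exact ((sndModule d).map_left (sndModule d) T hT hD b G).symm

theorem commute_snd_right_map (b : PseudoDiffOp d) (T : Module.End F 𝒱[X])
    (hT : ∀ (f : 𝒱) p, T (f • p) = f • T p) :
    Commute ((sndModule d).right b) (LaurentInv.map T) := by
  ext1 G
  exact ((sndModule d).map_right (sndModule d) T hT b G).symm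

theorem fst_D_smul (f : 𝒱) (p : 𝒱[X]) : (fstModule d).D (f • p) = f • (fstModule d).D p := by
  simp [fstModule_D]

theorem fst_D_lambdaAdd (p : 𝒱[X]) :
    (fstModule d).D (lambdaAdd d p) = lambdaAdd d ((fstModule d).D p) := by
  rw [fstModule_D, fstModule_D, map_neg, lambdaAdd_X_mul]

theorem commute_zLeft_wLeft (a b : PseudoDiffOp d) : Commute (zLeft d a) (wLeft d b) := by
  ext1 G
  refine ((fstModule d).laurent.map_left (fstModule d).laurent ((sndModule d).left b)
    (fun f m => ?_) (fun m => ?_) a G).symm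
  · exact LinearMap.congr_fun (commute_snd_left_map d b ((fstModule d).act f)
      (fun g p => substAct_smul d f g p) (substAct_lambdaAdd d f)) m
  · exact LinearMap.congr_fun (commute_snd_left_map d b (fstModule d).D (fst_D_smul d)
      (fst_D_lambdaAdd d)) m

theorem commute_zLeft_wRight (a b : PseudoDiffOp d) : Commute (zLeft d a) (wRight d b) := by
  ext1 G
  refine ((fstModule d).laurent.map_left (fstModule d).laurent ((sndModule d).right b)
    (fun f m => ?_) (fun m => ?_) a G).symm
  · exact LinearMap.congr_fun (commute_snd_right_map d b ((fstModule d).act f)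
      (fun g p => substAct_smul d f g p)) m
  · exact LinearMap.congr_fun (commute_snd_right_map d b (fstModule d).D (fst_D_smul d)) m

theorem commute_zRight_wLeft (a b : PseudoDiffOp d) : Commute (zRight d a) (wLeft d b) := by
  ext1 G
  refine ((fstModule d).laurent.map_right (fstModule d).laurent ((sndModule d).left b)
    (fun f m => ?_) a G).symm
  exact LinearMap.congr_fun (commute_snd_left_map d b ((fstModule d).act f)
    (fun g p => substAct_smul d f g p) (substAct_lambdaAdd d f)) m

theorem commute_zRight_wRight (a b : PseudoDiffOp d) : Commute (zRight d a) (wRight d b) := by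
  ext1 G
  refine ((fstModule d).laurent.map_right (fstModule d).laurent ((sndModule d).right b)
    (fun f m => ?_) a G).symm
  exact LinearMap.congr_fun (commute_snd_right_map d b ((fstModule d).act f)
    (fun g p => substAct_smul d f g p)) m

/-! ### The bracket and the `γ`-term are biderivations -/

/-- `{a(z)_λ b(w)}` as a double series. -/
def bracketSeries {d : Derivation F 𝒱 𝒱} (P : LambdaBracket d) :
    PseudoDiffOp d →ₗ[F] PseudoDiffOp d →ₗ[F] DoubleSeries F 𝒱 :=
  LinearMap.mk₂ F
    (fun a b => LaurentInv.map
      ({ toFun := fun f => LaurentInv.map (P.bracket f) b.symbol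
         map_add' := fun f g => LaurentInv.ext fun q => by simp
         map_smul' := fun c f => LaurentInv.ext fun q => by simp } : 𝒱 →ₗ[F] LaurentInv F 𝒱[X])
      a.symbol)
    (by intros; simp) (by intros; simp)
    (fun a b b' => LaurentInv.ext fun p => LaurentInv.ext fun q => by simp)
    (fun c a b => LaurentInv.ext fun p => LaurentInv.ext fun q => by simp)

theorem expand_bracketSeries {d : Derivation F 𝒱 𝒱} (P : LambdaBracket d) (a b : PseudoDiffOp d) :
    expand (bracketSeries P a b) = P.symbolBracket a b := rfl

/-- This is the left Leibniz rule together with sesquilinearity in the first argument. -/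
theorem bracketSeries_mul_left {d : Derivation F 𝒱 𝒱} (P : LambdaBracket d)
    (a a' b : PseudoDiffOp d) :
    bracketSeries P (a * a') b =
      zLeft d a (bracketSeries P a' b) + zRight d a' (bracketSeries P a b) := by
  refine (fstModule d).laurent.map_mul_of_derivation _ ?_ ?_ a a'
  · intro f g
    refine LaurentInv.ext fun q => ?_
    exact (P.leibniz_left f g _).trans (add_comm _ _)
  · intro f
    exact LaurentInv.ext fun q => P.sesqui_left f _

/-- This is the right Leibniz rule together with sesquilinearity in the second argument. -/
theorem bracketSeries_mul_right {d : Derivation F 𝒱 𝒱} (P : LambdaBracket d)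
    (a b b' : PseudoDiffOp d) :
    bracketSeries P a (b * b') =
      wLeft d b (bracketSeries P a b') + wRight d b' (bracketSeries P a b) := by
  refine LaurentInv.ext fun p => ?_
  refine (sndModule d).map_mul_of_derivation (P.bracket (a.coeff p)) ?_ ?_ b b'
  · intro f g
    rw [P.leibniz_right, add_comm, sndModule_act, sndModule_act, Polynomial.smul_eq_C_mul,
      Polynomial.smul_eq_C_mul, mul_comm, mul_comm (P.bracket _ f)]
  · intro f
    exact P.sesqui_right _ f

/-- The extension of `𝒱[λ]` by a free generator `(0, 1)` which `λ + ∂` sends to `f`, so that this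
generator plays the role of `(λ + ∂)⁻¹ f`. -/
def primitiveModule (f : 𝒱[X]) : DiffModule d (𝒱[X] × 𝒱) where
  act := Algebra.lsmul F F (𝒱[X] × 𝒱)
  D := LinearMap.prod
    (lambdaAdd d ∘ₗ LinearMap.fst F _ _ +
      (LinearMap.toSpanSingleton 𝒱 𝒱[X] f).restrictScalars F ∘ₗ LinearMap.snd F _ _)
    (d.toLinearMap ∘ₗ LinearMap.snd F _ _)
  leibniz g m := by
    refine Prod.ext ?_ ?_
    · change lambdaAdd d (g • m.1) + (g • m.2) • f =
        d g • m.1 + g • (lambdaAdd d m.1 + m.2 • f)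
      rw [lambdaAdd_smul, smul_add, smul_assoc, add_assoc]
    · change d (g • m.2) = d g • m.2 + g • d m.2
      simp only [smul_eq_mul, Derivation.leibniz]
      ring

/-- `(b(w + λ + ∂) - b(w)) (λ + ∂)⁻¹ f`. -/
def quotDiff : 𝒱[X] →ₗ[F] PseudoDiffOp d →ₗ[F] LaurentInv F 𝒱[X] :=
  LinearMap.mk₂ F
    (fun f b => (LinearMap.pi fun q : ℤ => Finsupp.lsum F (fun j : ℕ =>
        Ring.choose (q + 1 + j) (j + 1) • (LinearMap.toSpanSingleton 𝒱 𝒱[X]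
          ((lambdaAdd d ^ j : Module.End F 𝒱[X]) f)).restrictScalars F) ∘ₗ
            tail (q + 1)).codRestrict (LaurentInv F 𝒱[X]) (by
      intro a
      obtain ⟨N, hN⟩ := a.2
      refine ⟨N, fun m hm => ?_⟩
      rw [LinearMap.pi_apply, LinearMap.comp_apply, tail_eq_zero hN (by omega), map_zero])
        b.symbol)
    (by
      intro f g b
      refine LaurentInv.ext fun q => ?_
      simp only [LaurentInv.add_coeff, LinearMap.codRestrict_apply, LinearMap.pi_apply,
        LinearMap.comp_apply, Finsupp.lsum_apply, Finsupp.sum, ← Finset.sum_add_distrib]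
      refine Finset.sum_congr rfl fun j _ => ?_
      simp)
    (by
      intro c f b
      refine LaurentInv.ext fun q => ?_
      simp only [LaurentInv.smul_coeff, LinearMap.codRestrict_apply, LinearMap.pi_apply,
        LinearMap.comp_apply, Finsupp.lsum_apply, Finsupp.sum, Finset.smul_sum]
      refine Finset.sum_congr rfl fun j _ => ?_
      simp only [LinearMap.smul_apply, LinearMap.coe_restrictScalars,
        LinearMap.toSpanSingleton_apply, map_smul]
      rw [smul_comm c, smul_comm c])
    (by intros; rw [map_add, map_add])
    (by intros; rw [map_smul, map_smul])

theorem quotDiff_coeff_eq_sum (f : 𝒱[X]) (b : PseudoDiffOp d) {N : ℤ}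
    (hN : ∀ n, N < n → b.coeff n = 0) (q : ℤ) (K : ℕ) (hK : N < q + 1 + K) :
    (quotDiff d f b).1 q = ∑ j ∈ Finset.range K,
      Ring.choose (q + 1 + j) (j + 1) • b.coeff (q + 1 + j) •
        (lambdaAdd d ^ j : Module.End F 𝒱[X]) f :=
  tail_sum_eq (G := b.symbol) hN (q + 1) (fun j : ℕ =>
        Ring.choose (q + 1 + j) (j + 1) • (LinearMap.toSpanSingleton 𝒱 𝒱[X]
          ((lambdaAdd d ^ j : Module.End F 𝒱[X]) f)).restrictScalars F) K hK

theorem primitiveModule_D_pow (f : 𝒱[X]) (k : ℕ) :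
    ((primitiveModule d f).D ^ (k + 1)) (0, 1) =
      ((lambdaAdd d ^ k : Module.End F 𝒱[X]) f, (0 : 𝒱)) := by
  induction k with
  | zero =>
    rw [zero_add, pow_one, pow_zero]
    refine Prod.ext ?_ ?_
    · change lambdaAdd d 0 + (1 : 𝒱) • f = f
      rw [map_zero, zero_add, one_smul]
    · exact d.map_one_eq_zero
  | succ k ih =>
    rw [pow_succ', Module.End.mul_apply, ih, pow_succ']
    refine Prod.ext ?_ ?_
    · change lambdaAdd d _ + (0 : 𝒱) • f = _
      rw [zero_smul, add_zero]; rfl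
    · exact d.map_zero

/-- `quotDiff d f` is the commutator with the primitive `(λ + ∂)⁻¹ f`. -/
theorem commutator_primitive (f : 𝒱[X]) (b : PseudoDiffOp d) :
    (primitiveModule d f).left b (LaurentInv.const (0, 1)) -
        (primitiveModule d f).right b (LaurentInv.const (0, 1)) =
      LaurentInv.map (LinearMap.inl F 𝒱[X] 𝒱) (quotDiff d f b) := by
  obtain ⟨N, hN⟩ := b.exists_bound
  refine LaurentInv.ext fun q => ?_
  have hK : N < q + 1 + ((N - q).toNat : ℕ) := by omega
  have hK' : N < q + ((N - q).toNat + 1 : ℕ) := by omega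
  rw [LaurentInv.sub_coeff, DiffModule.left_const, DiffModule.right_const, LaurentInv.map_coeff,
    DiffModule.leftCoeff_eq_sum _ b hN q _ hK', quotDiff_coeff_eq_sum d f b hN q _ hK, map_sum,
    Finset.sum_range_succ']
  simp only [LinearMap.add_apply, LinearMap.sum_apply, LinearMap.smul_apply, Module.End.mul_apply,
    primitiveModule_D_pow]
  have h0 : Ring.choose (q + ((0 : ℕ) : ℤ)) 0 • (primitiveModule d f).act (b.coeff (q + (0 : ℕ)))
      (((primitiveModule d f).D ^ 0) (0, 1)) = (primitiveModule d f).act (b.coeff q) (0, 1) := by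
    simp
  rw [h0, add_sub_cancel_right]
  refine Finset.sum_congr rfl fun k _ => ?_
  have e : q + ((k + 1 : ℕ) : ℤ) = q + 1 + k := by push_cast; ring
  rw [e, map_zsmul]
  congr 1
  refine Prod.ext rfl ?_
  exact smul_zero (M := 𝒱) (b.coeff (q + 1 + k))

/-- The commutator with a fixed element of a bimodule is a derivation; here the element lies in an
extension of `𝒱[λ]`, but its commutators do not. -/
theorem quotDiff_mul (f : 𝒱[X]) (b b' : PseudoDiffOp d) :
    quotDiff d f (b * b') =
      (sndModule d).left b (quotDiff d f b') + (sndModule d).right b' (quotDiff d f b) := by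
  have hD : ∀ p, LinearMap.inl F 𝒱[X] 𝒱 (lambdaAdd d p) =
      (primitiveModule d f).D (LinearMap.inl F 𝒱[X] 𝒱 p) := by
    intro p
    refine Prod.ext ?_ ?_
    · change _ = lambdaAdd d p + (0 : 𝒱) • f
      rw [zero_smul, add_zero]; rfl
    · exact d.map_zero.symm
  have hS : ∀ (g : 𝒱) p, LinearMap.inl F 𝒱[X] 𝒱 (g • p) =
      (primitiveModule d f).act g (LinearMap.inl F 𝒱[X] 𝒱 p) := by
    intro g p
    exact Prod.ext rfl (smul_zero g).symm
  have hinj : Function.Injective (LaurentInv.map (LinearMap.inl F 𝒱[X] 𝒱)) := fun G H h =>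
    LaurentInv.ext fun n => LinearMap.inl_injective (congrArg (fun G => G.1 n) h)
  apply hinj
  rw [map_add, (sndModule d).map_left (primitiveModule d f) _ hS hD,
    (sndModule d).map_right (primitiveModule d f) _ hS, ← commutator_primitive,
    ← commutator_primitive, ← commutator_primitive, DiffModule.left_mul, DiffModule.right_mul,
    map_sub, map_sub, Module.End.mul_apply, Module.End.mul_apply]
  have h := LinearMap.congr_fun ((primitiveModule d f).left_right_comm b b')
    (LaurentInv.const (0, 1))
  rw [Module.End.mul_apply, Module.End.mul_apply] at h
  rw [h]
  abel

/-- `(b(w + λ + ∂) - b(w)) (λ + ∂)⁻¹` commutes with every operator that commutes with `𝒱` and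
`λ + ∂`. -/
theorem map_quotDiff (b : PseudoDiffOp d) (T : Module.End F 𝒱[X])
    (hT : ∀ (f : 𝒱) p, T (f • p) = f • T p) (hD : ∀ p, T (lambdaAdd d p) = lambdaAdd d (T p))
    (f : 𝒱[X]) : quotDiff d (T f) b = LaurentInv.map T (quotDiff d f b) := by
  obtain ⟨N, hN⟩ := b.exists_bound
  refine LaurentInv.ext fun q => ?_
  have hK : N < q + 1 + ((N - q).toNat : ℕ) := by omega
  have hpow : ∀ j : ℕ, (lambdaAdd d ^ j : Module.End F 𝒱[X]) (T f) =
      T ((lambdaAdd d ^ j : Module.End F 𝒱[X]) f) := fun j => by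
    have h : Commute (lambdaAdd d : Module.End F 𝒱[X]) T := by
      ext1 p
      exact (hD p).symm
    exact LinearMap.congr_fun (h.pow_left j) f
  rw [LaurentInv.map_coeff, quotDiff_coeff_eq_sum d _ b hN q _ hK,
    quotDiff_coeff_eq_sum d _ b hN q _ hK, map_sum]
  refine Finset.sum_congr rfl fun j _ => ?_
  rw [map_zsmul, hT, hpow]

/-- `(b(w + λ + ∂) - b(w)) (λ + ∂)⁻¹ (a*(λ - z) - a(z))` as a double series. -/
def gammaSeries : PseudoDiffOp d →ₗ[F] PseudoDiffOp d →ₗ[F] DoubleSeries F 𝒱 :=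
  LinearMap.mk₂ F
    (fun a b => LaurentInv.map ((quotDiff d).flip b)
      ((fstModule d).left a (LaurentInv.const 1) - (fstModule d).right a (LaurentInv.const 1)))
    (by intros; simp only [map_add, LinearMap.add_apply, map_sub]; abel)
    (by intros; simp only [map_smul, LinearMap.smul_apply, map_sub, smul_sub])
    (fun a b b' => LaurentInv.ext fun p => by simp only [LaurentInv.map_coeff, map_add,
      LinearMap.add_apply, LaurentInv.add_coeff])
    (fun c a b => LaurentInv.ext fun p => by simp only [LaurentInv.map_coeff, map_smul,
      LinearMap.smul_apply, LaurentInv.smul_coeff])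

theorem gammaSeries_apply (a b : PseudoDiffOp d) :
    gammaSeries d a b = LaurentInv.map ((quotDiff d).flip b)
      ((fstModule d).left a (LaurentInv.const 1) -
        (fstModule d).right a (LaurentInv.const 1)) := rfl

/-- `a*(λ - z) - a(z)` is the commutator of `a` with the constant series `1`, hence a derivation
in `a`. -/
theorem gammaSeries_mul_left (a a' b : PseudoDiffOp d) :
    gammaSeries d (a * a') b =
      zLeft d a (gammaSeries d a' b) + zRight d a' (gammaSeries d a b) := by
  have hS : ∀ (g : 𝒱) p, (quotDiff d).flip b ((fstModule d).act g p) =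
      (fstModule d).laurent.act g ((quotDiff d).flip b p) := fun g p =>
    map_quotDiff d b _ (fun f p => substAct_smul d g f p) (substAct_lambdaAdd d g) p
  have hD : ∀ p, (quotDiff d).flip b ((fstModule d).D p) =
      (fstModule d).laurent.D ((quotDiff d).flip b p) := fun p =>
    map_quotDiff d b _ (fst_D_smul d) (fst_D_lambdaAdd d) p
  rw [gammaSeries_apply, gammaSeries_apply, gammaSeries_apply, zLeft, zRight,
    ← (fstModule d).map_left _ _ hS hD, ← (fstModule d).map_right _ _ hS, ← map_add,
    DiffModule.left_mul, DiffModule.right_mul]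
  have h := LinearMap.congr_fun ((fstModule d).left_right_comm a a')
    (LaurentInv.const (1 : 𝒱[X]))
  simp only [Module.End.mul_apply] at h ⊢
  simp only [map_sub, map_add, h]
  abel

theorem gammaSeries_mul_right (a b b' : PseudoDiffOp d) :
    gammaSeries d a (b * b') =
      wLeft d b (gammaSeries d a b') + wRight d b' (gammaSeries d a b) :=
  LaurentInv.ext fun _ => quotDiff_mul d _ b b'

end DoubleSeries

/-! ### The formal adjoint -/

section Adjoint

variable {F 𝒱 : Type*} [Field F] [CommRing 𝒱] [Algebra F 𝒱] (d : Derivation F 𝒱 𝒱)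

theorem tailSum_coeff_eq_sum {R S : Type*} [AddCommGroup R] [Module F R] [AddCommGroup S]
    [Module F S] (φ : ℤ → ℕ → R →ₗ[F] S) (a : LaurentInv F R) {N : ℤ}
    (hN : ∀ n, N < n → a.1 n = 0) (p : ℤ) (K : ℕ) (hK : N < p + K) :
    (tailSum φ a).1 p = ∑ j ∈ Finset.range K, φ p j (a.1 (p + j)) :=
  tail_sum_eq hN p (φ p) K hK

theorem formalAdjoint_coeff (a : PseudoDiffOp d) {N : ℤ} (hN : ∀ n, N < n → a.coeff n = 0)
    (p : ℤ) (K : ℕ) (hK : N < p + K) :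
    (formalAdjoint d a).coeff p = ∑ k ∈ Finset.range K,
      (((p + k).negOnePow : ℤ) * Ring.choose (p + k) k) •
        (d.toLinearMap ^ k : Module.End F 𝒱) (a.coeff (p + k)) :=
  tailSum_coeff_eq_sum _ a.symbol hN p K hK

theorem formalAdjoint_bound {a : PseudoDiffOp d} {N : ℤ} (hN : ∀ n, N < n → a.coeff n = 0) (n : ℤ)
    (hn : N < n) : (formalAdjoint d a).coeff n = 0 := by
  rw [formalAdjoint_coeff d a hN n 0 (by simpa using hn), Finset.sum_range_zero]

theorem evalLambdaSub_coeff (a : PseudoDiffOp d) {N : ℤ} (hN : ∀ n, N < n → a.coeff n = 0)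
    (p : ℤ) (K : ℕ) (hK : N < p + K) :
    (evalLambdaSub d a).1 p = ∑ k ∈ Finset.range K,
      ((p.negOnePow : ℤ) * Ring.choose (p + k) k) • Polynomial.monomial k (a.coeff (p + k)) :=
  tailSum_coeff_eq_sum _ a.symbol hN p K hK

/-- The coefficient of `λ⁰` in `b(λ - z)` is `b(-z)`. -/
theorem evalLambdaSub_injective : Function.Injective (evalLambdaSub d) := by
  rw [← LinearMap.ker_eq_bot, LinearMap.ker_eq_bot']
  intro a ha
  obtain ⟨N, hN⟩ := a.exists_bound
  ext p
  have h := evalLambdaSub_coeff d a hN p ((N - p).toNat + 1) (by omega)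
  rw [ha, LaurentInv.zero_coeff] at h
  have h0 := congrArg (fun q : 𝒱[X] => q.coeff 0) h
  simp only [Polynomial.coeff_zero, Polynomial.finsetSum_coeff, Polynomial.coeff_smul,
    Polynomial.coeff_monomial] at h0
  rw [Finset.sum_eq_single 0 (by intro b _ hb; rw [if_neg hb, smul_zero]) (by simp), if_pos rfl,
    Ring.choose_zero_right, mul_one, Nat.cast_zero, add_zero] at h0
  rcases Int.even_or_odd p with hp | hp
  · rw [Int.negOnePow_even p hp] at h0
    simpa using h0.symm
  · rw [Int.negOnePow_odd p hp] at h0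
    simpa using h0.symm

theorem symbolConst_eq (a : PseudoDiffOp d) :
    symbolConst d a = LaurentInv.map (Polynomial.CAlgHom (R := F) (A := 𝒱)).toLinearMap
      a.symbol := by
  obtain ⟨N, hN⟩ := a.exists_bound
  refine LaurentInv.ext fun p => ?_
  refine (tailSum_coeff_eq_sum _ a.symbol hN p ((N - p).toNat + 1) (by omega)).trans ?_
  rw [Finset.sum_eq_single 0]
  · rw [if_pos rfl, Nat.cast_zero, add_zero]; rfl
  · intro k _ hk
    rw [if_neg hk, LinearMap.zero_apply]
  · simp

/-- `a(z)`, obtained by the right action in `z` on `1`. -/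
theorem right_one_eq_symbolConst (a : PseudoDiffOp d) :
    (fstModule d).right a (LaurentInv.const 1) = symbolConst d a := by
  refine LaurentInv.ext fun p => ?_
  rw [symbolConst_eq, DiffModule.right_const, fstModule_act, substAct_one]
  rfl

theorem coeffDeriv_pow_C (k : ℕ) (f : 𝒱) :
    (coeffDeriv d ^ k : Module.End F 𝒱[X]) (Polynomial.C f) =
      Polynomial.C ((d.toLinearMap ^ k : Module.End F 𝒱) f) := by
  induction k generalizing f with
  | zero => rfl
  | succ k ih =>
    rw [pow_succ, pow_succ, Module.End.mul_apply, Module.End.mul_apply, coeffDeriv_C, ih]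
    rfl

theorem mulLeft_X_pow (k : ℕ) (p : 𝒱[X]) :
    (LinearMap.mulLeft F (Polynomial.X : 𝒱[X]) ^ k : Module.End F 𝒱[X]) p =
      Polynomial.X ^ k * p := by
  rw [LinearMap.pow_mulLeft, LinearMap.mulLeft_apply]

theorem lambdaAdd_pow_C (n : ℕ) (f : 𝒱) :
    (lambdaAdd d ^ n : Module.End F 𝒱[X]) (Polynomial.C f) =
      ∑ kj ∈ Finset.HasAntidiagonal.antidiagonal n, n.choose kj.1 •
        Polynomial.monomial kj.1 ((d.toLinearMap ^ kj.2 : Module.End F 𝒱) f) := by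
  have hc : Commute (LinearMap.mulLeft F (Polynomial.X : 𝒱[X]) : Module.End F 𝒱[X])
      (coeffDeriv d) := by
    ext1 p
    exact (coeffDeriv_X_mul d p).symm
  rw [lambdaAdd, hc.add_pow', LinearMap.sum_apply]
  refine Finset.sum_congr rfl fun kj _ => ?_
  rw [LinearMap.smul_apply, Module.End.mul_apply, coeffDeriv_pow_C, mulLeft_X_pow, mul_comm,
    Polynomial.C_mul_X_pow_eq_monomial]

/-- `a*(λ - z)`, obtained by the left action in `z` on `1`. -/
theorem left_one_eq_adjointEval (a : PseudoDiffOp d) :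
    (fstModule d).left a (LaurentInv.const 1) = adjointEval d a := by
  obtain ⟨N, hN⟩ := a.exists_bound
  refine LaurentInv.ext fun p => ?_
  set K : ℕ := (N - p).toNat + 1 with hK
  have hKp : N < p + K := by omega
  rw [DiffModule.left_const, DiffModule.leftCoeff_eq_sum _ a hN p K hKp, adjointEval,
    LinearMap.comp_apply, evalLambdaSub_coeff d _ (formalAdjoint_bound d hN) p K hKp,
    LinearMap.sum_apply]
  set g : ℕ → ℕ → 𝒱[X] := fun k j => ((((k + j : ℕ) : ℤ).negOnePow : ℤ) *
    (Ring.choose (p + (k + j : ℕ)) j * Ring.choose (p + k) k)) • Polynomial.monomial k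
      ((d.toLinearMap ^ j : Module.End F 𝒱) (a.coeff (p + (k + j : ℕ)))) with hg
  have e1 : ∀ n ∈ Finset.range K, (Ring.choose (p + n) n •
      ((fstModule d).act (a.coeff (p + n)) * (fstModule d).D ^ n)) (1 : 𝒱[X]) =
      ∑ kj ∈ Finset.HasAntidiagonal.antidiagonal n, g kj.1 kj.2 := by
    intro n _
    have h1 : ((fstModule d).D ^ n : Module.End F 𝒱[X]) 1 =
        ((n : ℤ).negOnePow : ℤ) • (lambdaAdd d ^ n : Module.End F 𝒱[X]) 1 := by
      have hD : (fstModule d).D = LinearMap.mulLeft F (-Polynomial.X : 𝒱[X]) := by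
        ext1 q
        rw [fstModule_D, LinearMap.mulLeft_apply, neg_mul]
      rw [lambdaAdd_pow_one, hD, LinearMap.pow_mulLeft, LinearMap.mulLeft_apply, mul_one]
      rcases Nat.even_or_odd n with h | h
      · rw [h.neg_pow, Int.negOnePow_even _ (by exact_mod_cast h)]; simp
      · rw [h.neg_pow, Int.negOnePow_odd _ (by exact_mod_cast h)]; simp
    have h2 : ∀ m : ℕ, substAct d (a.coeff (p + n)) ((lambdaAdd d ^ m : Module.End F 𝒱[X]) 1) =
        (lambdaAdd d ^ m : Module.End F 𝒱[X]) (Polynomial.C (a.coeff (p + n))) := by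
      intro m
      induction m with
      | zero => exact substAct_one d _
      | succ m ih =>
        rw [pow_succ', Module.End.mul_apply, Module.End.mul_apply, substAct_lambdaAdd, ih]
    rw [LinearMap.smul_apply, Module.End.mul_apply, h1, map_zsmul, fstModule_act, h2,
      lambdaAdd_pow_C, Finset.smul_sum, Finset.smul_sum]
    refine Finset.sum_congr rfl fun kj hkj => ?_
    rw [Finset.HasAntidiagonal.mem_antidiagonal] at hkj
    have h3 := Ring.choose_smul_choose (p + n : ℤ) (show kj.2 ≤ n by omega)
    rw [show n - kj.2 = kj.1 by omega, show p + n - kj.2 = p + kj.1 by omega,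
      ← Nat.choose_symm_of_eq_add hkj.symm] at h3
    simp only [hg]
    rw [hkj, ← h3, ← natCast_zsmul, smul_smul, smul_smul]
    congr 1
    simp only [nsmul_eq_mul]
    ring
  have hN' : ∀ k j : ℕ, K ≤ k + j → g k j = 0 := fun k j h => by
    simp only [hg]
    rw [hN _ (by push_cast; omega), map_zero, map_zero, smul_zero]
  have e2 : ∀ k ∈ Finset.range K, (((p.negOnePow : ℤ) * Ring.choose (p + k) k) •
      Polynomial.monomial k ((formalAdjoint d a).coeff (p + k)) : 𝒱[X]) =
      ∑ j ∈ Finset.range K, g k j := by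
    intro k _
    rw [formalAdjoint_coeff d a hN (p + k) K (by omega), map_sum, Finset.smul_sum]
    refine Finset.sum_congr rfl fun j _ => ?_
    have e : p + k + j = p + ((k + j : ℕ) : ℤ) := by push_cast; ring
    rw [map_zsmul, smul_smul, e, Int.negOnePow_add p ((k + j : ℕ) : ℤ)]
    simp only [hg]
    congr 1
    have hs : ((p.negOnePow : ℤˣ) : ℤ) * ((p.negOnePow : ℤˣ) : ℤ) = 1 := by
      rw [← Units.val_mul, Int.units_mul_self, Units.val_one]
    rw [Units.val_mul]
    linear_combination (((((k + j : ℕ) : ℤ).negOnePow : ℤˣ) : ℤ) *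
      (Ring.choose (p + (k + j : ℕ)) j * Ring.choose (p + k) k)) * hs
  -- Both sides are the sum of `g k j` over `k + j < K`.
  rw [Finset.sum_congr rfl e1, Finset.sum_congr rfl e2]
  simp_rw [Finset.Nat.sum_antidiagonal_eq_sum_range_succ g]
  rw [Finset.sum_range_diag_flip K g]
  refine Finset.sum_congr rfl fun k _ => Finset.sum_subset (by simp) fun j _ hj => hN' k j ?_
  simp only [Finset.mem_range, not_lt] at hj
  omega

/-- `G(z) ↦ G(-z)`. -/
def LaurentInv.negVar {R : Type*} [AddCommGroup R] [Module F R] :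
    Module.End F (LaurentInv F R) :=
  tailSum fun m k => if k = 0 then (m.negOnePow : ℤ) • LinearMap.id else 0

theorem LaurentInv.negVar_coeff {R : Type*} [AddCommGroup R] [Module F R] (G : LaurentInv F R)
    (p : ℤ) : (LaurentInv.negVar G).1 p = (p.negOnePow : ℤ) • G.1 p := by
  obtain ⟨N, hN⟩ := G.2
  refine (tailSum_coeff_eq_sum _ G hN p ((N - p).toNat + 1) (by omega)).trans ?_
  rw [Finset.sum_eq_single 0]
  · rw [if_pos rfl, Nat.cast_zero, add_zero]; rfl
  · intro k _ hk
    rw [if_neg hk, LinearMap.zero_apply]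
  · simp

theorem LaurentInv.negVar_negVar {R : Type*} [AddCommGroup R] [Module F R]
    (G : LaurentInv F R) : LaurentInv.negVar (LaurentInv.negVar G) = G :=
  LaurentInv.ext fun p => by
    rw [negVar_coeff, negVar_coeff, smul_smul, ← Units.val_mul, Int.units_mul_self, Units.val_one,
      one_smul]

/-- `b(z + λ + ∂) 1 = b(z + λ)`, from which `b(λ - z)` is obtained by `z ↦ -z`. -/
theorem evalLambdaSub_eq (b : PseudoDiffOp d) :
    evalLambdaSub d b = LaurentInv.negVar ((sndModule d).left b (LaurentInv.const 1)) := by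
  obtain ⟨N, hN⟩ := b.exists_bound
  refine LaurentInv.ext fun p => ?_
  have hK : N < p + ((N - p).toNat + 1 : ℕ) := by omega
  rw [LaurentInv.negVar_coeff, DiffModule.left_const, DiffModule.leftCoeff_eq_sum _ b hN p _ hK,
    evalLambdaSub_coeff d b hN p _ hK, LinearMap.sum_apply, Finset.smul_sum]
  refine Finset.sum_congr rfl fun k _ => ?_
  have h : ((sndModule d).D ^ k : Module.End F 𝒱[X]) 1 = Polynomial.X ^ k := lambdaAdd_pow_one d k
  rw [LinearMap.smul_apply, Module.End.mul_apply, h, sndModule_act, smul_smul,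
    ← Polynomial.C_mul_X_pow_eq_monomial, Polynomial.smul_eq_C_mul]

theorem commute_leftCoeff (a b : PseudoDiffOp d) (p q : ℤ) :
    Commute ((fstModule d).leftCoeff a p) ((sndModule d).leftCoeff b q) := by
  have h1 : ∀ f g : 𝒱, Commute ((fstModule d).act f) ((sndModule d).act g) := fun f g => by
    ext1 m; exact substAct_smul d f g m
  have h2 : ∀ f : 𝒱, Commute ((fstModule d).act f) (sndModule d).D := fun f => by
    ext1 m; exact substAct_lambdaAdd d f m
  have h3 : ∀ g : 𝒱, Commute (fstModule d).D ((sndModule d).act g) := fun g => by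
    ext1 m; exact fst_D_smul d g m
  have h4 : Commute (fstModule d).D (sndModule d).D := by
    ext1 m; exact fst_D_lambdaAdd d m
  refine Commute.sum_left _ _ _ fun k _ => Commute.sum_right _ _ _ fun l _ => ?_
  exact ((((h1 _ _).mul_right ((h2 _).pow_right _)).mul_left
    (((h3 _).pow_left _).mul_right (h4.pow_pow _ _))).smul_left _).smul_right _

/-- The left action of `a` for the first structure on `𝒱[λ]` and of `b`, with `z` replaced by `-z`,
for the second structure commute on `1`. -/
theorem left_negVar_left (a b : PseudoDiffOp d) :
    (fstModule d).left a (LaurentInv.negVar ((sndModule d).left b (LaurentInv.const 1))) =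
      LaurentInv.negVar ((sndModule d).left b (LaurentInv.negVar
        ((fstModule d).left a (LaurentInv.const 1)))) := by
  refine LaurentInv.ext fun n => ?_
  rw [DiffModule.left_coeff_finsum, LaurentInv.negVar_coeff, DiffModule.left_coeff_finsum]
  have hfin : (Function.support fun m => (sndModule d).leftCoeff b (n - m)
      ((LaurentInv.negVar ((fstModule d).left a (LaurentInv.const (1 : 𝒱[X])))).1 m)).Finite := by
    obtain ⟨N, hN⟩ := b.exists_bound
    obtain ⟨K, hK⟩ :=
      (LaurentInv.negVar ((fstModule d).left a (LaurentInv.const (1 : 𝒱[X])))).2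
    refine (Finset.finite_toSet (Finset.Icc (n - N) K)).subset fun m hm => ?_
    rw [Finset.coe_Icc, Set.mem_Icc]
    constructor
    · by_contra h
      exact hm (by simp only; rw [DiffModule.leftCoeff_eq_zero _ b hN (by omega)]; rfl)
    · by_contra h
      exact hm (by simp only; rw [hK m (by omega), map_zero])
  -- The substitution `m ↦ n - m` exchanges the degrees of the two factors.
  rw [smul_finsum' _ hfin, ← finsum_comp_equiv (Equiv.subLeft n)]
  refine finsum_congr fun m => ?_
  rw [Equiv.subLeft_apply, LaurentInv.negVar_coeff, LaurentInv.negVar_coeff,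
    DiffModule.left_const, DiffModule.left_const, map_zsmul, map_zsmul, sub_sub_cancel, smul_smul,
    Int.negOnePow_sub, ← Units.val_mul]
  have h := LinearMap.congr_fun (commute_leftCoeff d a b m (n - m)) 1
  rw [Module.End.mul_apply, Module.End.mul_apply] at h
  rw [h]

/-- `(ab)*(λ - z)` is the left action of `a` on `b*(λ - z)`. Written with the action of `b*` on `1`
in the variable `-z`, which commutes with that of `a`, it becomes `(b* a*)(λ - z)`. -/
theorem formalAdjoint_mul (a b : PseudoDiffOp d) :
    formalAdjoint d (a * b) = formalAdjoint d b * formalAdjoint d a := by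
  apply evalLambdaSub_injective
  have h : ∀ a, evalLambdaSub d (formalAdjoint d a) =
    (fstModule d).left a (LaurentInv.const 1) := fun a => (left_one_eq_adjointEval d a).symm
  rw [h, DiffModule.left_mul, Module.End.mul_apply, ← h b, evalLambdaSub_eq, left_negVar_left,
    ← h a, evalLambdaSub_eq, LaurentInv.negVar_negVar, evalLambdaSub_eq d (_ * _),
    DiffModule.left_mul, Module.End.mul_apply]

theorem formalAdjoint_one : formalAdjoint d 1 = 1 := by
  apply evalLambdaSub_injective
  have h : evalLambdaSub d (formalAdjoint d 1) =
    (fstModule d).left 1 (LaurentInv.const 1) := (left_one_eq_adjointEval d 1).symm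
  rw [h, evalLambdaSub_eq, DiffModule.left_one, DiffModule.left_one]
  refine LaurentInv.ext fun p => ?_
  rw [LaurentInv.negVar_coeff]
  simp only [Module.End.one_apply, LaurentInv.const_coeff]
  split_ifs with h
  · rw [h]; simp
  · simp

end Adjoint

/-! ### The kernels of the generalized Adler identity -/

section Kernels

variable {F 𝒱 : Type*} [Field F] [CommRing 𝒱] [Algebra F 𝒱] (d : Derivation F 𝒱 𝒱)

/-- The operator `w + D` on `𝒱[λ]((w⁻¹))`. -/
def varAdd {M : Type*} [AddCommGroup M] [Module F M] (D : Module.End F M) :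
    Module.End F (LaurentInv F M) :=
  LaurentInv.mulVar + LaurentInv.map D

theorem varAdd_pow {M : Type*} [AddCommGroup M] [Module F M] (D : Module.End F M) (j : ℕ) :
    varAdd D ^ j = ∑ i ∈ Finset.range (j + 1),
      j.choose i • (LaurentInv.mulVar ^ i * LaurentInv.map (D ^ (j - i))) := by
  rw [varAdd, (LaurentInv.commute_mulVar_map D).add_pow]
  refine Finset.sum_congr rfl fun i _ => ?_
  rw [← LaurentInv.mapEnd_apply (D ^ (j - i)), map_pow, nsmul_eq_mul,
    (Nat.cast_commute _ _).eq]
  rfl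

theorem LaurentInv.sum_coeff {M : Type*} [AddCommGroup M] [Module F M] (s : Finset ℕ)
    (f : ℕ → LaurentInv F M) (q : ℤ) : (∑ i ∈ s, f i).1 q = ∑ i ∈ s, (f i).1 q :=
  map_sum (LinearMap.proj q ∘ₗ (LaurentInv F M).subtype) f s

theorem LaurentInv.zsmul_coeff {M : Type*} [AddCommGroup M] [Module F M] (c : ℤ)
    (a : LaurentInv F M) (q : ℤ) : (c • a).1 q = c • a.1 q := rfl

theorem LaurentInv.nsmul_coeff {M : Type*} [AddCommGroup M] [Module F M] (c : ℕ)
    (a : LaurentInv F M) (q : ℤ) : (c • a).1 q = c • a.1 q := rfl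

theorem varAdd_pow_coeff {M : Type*} [AddCommGroup M] [Module F M] (D : Module.End F M) (j : ℕ)
    (G : LaurentInv F M) (q : ℤ) :
    ((varAdd D ^ j) G).1 q =
      ∑ i ∈ Finset.range (j + 1), j.choose i • (D ^ (j - i)) (G.1 (q - i)) := by
  rw [varAdd_pow, LinearMap.sum_apply, LaurentInv.sum_coeff]
  refine Finset.sum_congr rfl fun i _ => ?_
  rw [LinearMap.smul_apply, Module.End.mul_apply, LaurentInv.nsmul_coeff,
    LaurentInv.mulVar_pow_coeff, LaurentInv.map_coeff]

theorem LaurentInv.finsuppSum_coeff {R M : Type*} [AddCommGroup R] [AddCommGroup M] [Module F M]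
    (s : ℕ →₀ R) (f : ℕ → R → LaurentInv F M) (q : ℤ) :
    (s.sum f).1 q = s.sum fun j r => (f j r).1 q := by
  change (LinearMap.proj (φ := fun _ : ℤ => M) q ∘ₗ (LaurentInv F M).subtype)
    (∑ j ∈ s.support, f j (s j)) = _
  rw [map_sum]
  rfl

theorem neg_one_zsmul_end {M : Type*} [AddCommGroup M] [Module F M]
    (T : Module.End F (LaurentInv F M)) : (-1 : ℤ) • T = -T :=
  LinearMap.ext fun G => LaurentInv.ext fun n => neg_one_zsmul ((T G).1 n)

theorem zsmul_end_pow {M : Type*} [AddCommGroup M] [Module F M] (s : ℤ) (T : Module.End F M)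
    (j : ℕ) (m : M) : ((s • T) ^ j) m = s ^ j • (T ^ j) m := by
  rw [smul_pow, LinearMap.smul_apply]

theorem sub_map_neg {M : Type*} [AddCommGroup M] [Module F M] (Y : Module.End F M)
    (H : LaurentInv F M) :
    LaurentInv.mulVar H - LaurentInv.map (-Y) H = LaurentInv.mulVar H + LaurentInv.map Y H := by
  have h : LaurentInv.map (-Y) H = -LaurentInv.map Y H := rfl
  rw [h, sub_neg_eq_add]

theorem left_del_of_neg {M : Type*} [AddCommGroup M] [Module F M] {d : Derivation F 𝒱 𝒱}
    (C : DiffModule d M) {E : Module.End F M} (hE : C.D = -E) (H : LaurentInv F M) :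
    C.left (PseudoDiffOp.del d) H = LaurentInv.mulVar H - LaurentInv.map E H := by
  have h : LaurentInv.map (-E) H = -LaurentInv.map E H := rfl
  rw [C.left_del, hE, h, sub_eq_add_neg]

theorem leftCoeff_sndModule (b : PseudoDiffOp d) (q : ℤ) (f : 𝒱[X]) :
    (sndModule d).leftCoeff b q f = shiftCoeff (lambdaAdd d) q b.symbol f := by
  obtain ⟨N, hN⟩ := b.exists_bound
  have hK : N < q + ((N - q).toNat + 1 : ℕ) := by omega
  rw [DiffModule.leftCoeff_eq_sum _ b hN q _ hK, shiftCoeff_eq_sum _ q b.symbol hN _ hK,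
    LinearMap.sum_apply]
  rfl

theorem commute_left_mulVar (b : PseudoDiffOp d) :
    Commute ((sndModule d).left b) LaurentInv.mulVar := by
  have h := (sndModule d).left_right_comm b (PseudoDiffOp.del d)
  rwa [show (sndModule d).right (PseudoDiffOp.del d) = LaurentInv.mulVar from
    LinearMap.ext (DiffModule.right_del _)] at h

/-- `b(w + λ + ∂) (z - s (w + D))⁻¹ g(z)` is the left action of `b` in `w` on
`(z - s (w + D))⁻¹ g(z)`. -/
theorem kernelLeft_eq (s : ℤ) (D : Module.End F 𝒱[X]) (g : LaurentInv F 𝒱[X])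
    (b : PseudoDiffOp d) :
    kernelLeft d s D g b =
      expand (wLeft d b (resolvent (s • varAdd D) (LaurentInv.map LaurentInv.const g))) := by
  funext p q
  have hk : kernelLeft d s D g b p q = (tail (p + 1) g).sum fun j f => s ^ j •
      ∑ i ∈ Finset.range (j + 1), j.choose i • shiftCoeff (lambdaAdd d) (q - i) b.symbol
        ((D ^ (j - i) : Module.End F 𝒱[X]) f) := rfl
  rw [hk, expand_apply, wLeft_apply, LaurentInv.map_coeff, resolvent_map_coeff, map_finsuppSum,
    LaurentInv.finsuppSum_coeff]
  refine Finset.sum_congr rfl fun j _ => ?_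
  have h : ∀ (i : ℕ) (f : 𝒱[X]), ((sndModule d).left b ((LaurentInv.mulVar ^ i :
      Module.End F (LaurentInv F 𝒱[X])) (LaurentInv.const f))).1 q =
      shiftCoeff (lambdaAdd d) (q - i) b.symbol f := by
    intro i f
    have h1 := LinearMap.congr_fun ((commute_left_mulVar d b).pow_right i) (LaurentInv.const f)
    rw [Module.End.mul_apply, Module.End.mul_apply] at h1
    rw [h1, LaurentInv.mulVar_pow_coeff, DiffModule.left_const, leftCoeff_sndModule]
  dsimp only
  rw [zsmul_end_pow, varAdd_pow, map_zsmul, LinearMap.sum_apply, map_sum, LaurentInv.zsmul_coeff,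
    LaurentInv.sum_coeff]
  congr 1
  refine Finset.sum_congr rfl fun i _ => ?_
  rw [LinearMap.smul_apply, map_nsmul, LaurentInv.nsmul_coeff, Module.End.mul_apply,
    LaurentInv.map_const, h]

/-- The right action of `b` sends `(w + e)ʲ f` to `f (w + e + ∂)ʲ b(w)`, where `∂` acts on the
coefficients of `b` only. -/
theorem right_varAdd_pow (b : PseudoDiffOp d) {e : 𝒱[X]} (he : coeffDeriv d e = 0) (j : ℕ)
    (f : 𝒱[X]) :
    (sndModule d).right b ((varAdd (LinearMap.mulLeft F e) ^ j) (LaurentInv.const f)) =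
      LaurentInv.map (LinearMap.mulLeft F f)
        ((varAdd (LinearMap.mulLeft F e + coeffDeriv d) ^ j)
          ((sndModule d).right b (LaurentInv.const 1))) := by
  have h1 : Commute (varAdd (LinearMap.mulLeft F e)) (LaurentInv.map (LinearMap.mulLeft F f)) := by
    refine (LaurentInv.commute_mulVar_map _).add_left ?_
    exact ((Commute.all e f).map (Algebra.lmul F 𝒱[X])).map (LaurentInv.mapEnd (F := F))
  have h2 : Commute ((sndModule d).right b) (LaurentInv.map (LinearMap.mulLeft F f)) :=
    commute_snd_right_map d b _ fun g p => by simp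
  have hA : varAdd (LinearMap.mulLeft F e + coeffDeriv d) =
      (sndModule d).left (PseudoDiffOp.del d) +
        LaurentInv.map (LinearMap.mulLeft F (e - Polynomial.X)) := by
    refine LinearMap.ext fun G => ?_
    rw [LinearMap.add_apply, DiffModule.left_del]
    refine LaurentInv.ext fun n => ?_
    change G.1 (n - 1) + (e * G.1 n + coeffDeriv d (G.1 n)) =
      G.1 (n - 1) + (Polynomial.X * G.1 n + coeffDeriv d (G.1 n)) + (e - Polynomial.X) * G.1 n
    ring
  have h3 : Commute ((sndModule d).right b) (varAdd (LinearMap.mulLeft F e + coeffDeriv d)) := by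
    rw [hA]
    exact ((sndModule d).left_right_comm _ b).symm.add_right
      (commute_snd_right_map d b _ fun g p => by simp)
  have h4 : (varAdd (LinearMap.mulLeft F e) ^ j) (LaurentInv.const 1) =
      (varAdd (LinearMap.mulLeft F e + coeffDeriv d) ^ j) (LaurentInv.const 1) := by
    have hc : Commute (LaurentInv.map (coeffDeriv d)) (varAdd (LinearMap.mulLeft F e)) := by
      refine (LaurentInv.commute_mulVar_map _).symm.add_right ?_
      refine LinearMap.ext fun G => LaurentInv.ext fun n => ?_
      change coeffDeriv d (e * G.1 n) = e * coeffDeriv d (G.1 n)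
      rw [coeffDeriv_mul, he, zero_mul, zero_add]
    induction j with
    | zero => rfl
    | succ j ih =>
      have hs : varAdd (LinearMap.mulLeft F e + coeffDeriv d) =
        varAdd (LinearMap.mulLeft F e) + LaurentInv.map (coeffDeriv d) := by
        rw [varAdd, varAdd, add_assoc]; rfl
      have h := LinearMap.congr_fun (hc.pow_right j) (LaurentInv.const 1)
      rw [Module.End.mul_apply, Module.End.mul_apply, LaurentInv.map_const, coeffDeriv_one,
        map_zero, map_zero] at h
      rw [pow_succ', pow_succ', Module.End.mul_apply, Module.End.mul_apply, ← ih, hs,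
        LinearMap.add_apply, h, add_zero]
  have h5 : LaurentInv.const (F := F) f =
      LaurentInv.map (LinearMap.mulLeft F f) (LaurentInv.const 1) := by
    rw [LaurentInv.map_const, LinearMap.mulLeft_apply, mul_one]
  have e1 := LinearMap.congr_fun (h1.pow_left j) (LaurentInv.const 1)
  have e3 := LinearMap.congr_fun (h3.pow_right j) (LaurentInv.const 1)
  rw [Module.End.mul_apply, Module.End.mul_apply] at e1 e3
  rw [h5, e1, h4, ← e3]
  exact LinearMap.congr_fun h2 _

/-- `g(z) (z - s (w + e + ∂))⁻¹ b(w)`, where `∂` acts on the coefficients of `b` only, is the right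
action of `b` in `w` on `(z - s (w + e))⁻¹ g(z)`. -/
theorem kernelRight_eq (s : ℤ) {e : 𝒱[X]} (he : coeffDeriv d e = 0) (g : LaurentInv F 𝒱[X])
    (b : PseudoDiffOp d) :
    kernelRight d s (LinearMap.mulLeft F e + coeffDeriv d) g b =
      expand (wRight d b (resolvent (s • varAdd (LinearMap.mulLeft F e))
        (LaurentInv.map LaurentInv.const g))) := by
  funext p q
  have hk : kernelRight d s (LinearMap.mulLeft F e + coeffDeriv d) g b p q =
      (tail (p + 1) g).sum fun j f => s ^ j • ∑ i ∈ Finset.range (j + 1), j.choose i •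
        (f * ((LinearMap.mulLeft F e + coeffDeriv d) ^ (j - i) : Module.End F 𝒱[X])
          (Polynomial.C (b.coeff (q - i)))) := rfl
  rw [hk, expand_apply, wRight_apply, LaurentInv.map_coeff, resolvent_map_coeff, map_finsuppSum,
    LaurentInv.finsuppSum_coeff]
  refine Finset.sum_congr rfl fun j _ => ?_
  dsimp only
  rw [zsmul_end_pow, map_zsmul, right_varAdd_pow d b he, LaurentInv.zsmul_coeff,
    LaurentInv.map_coeff, varAdd_pow_coeff, map_sum]
  congr 1
  refine Finset.sum_congr rfl fun i _ => ?_
  rw [map_nsmul, LinearMap.mulLeft_apply, DiffModule.right_const, sndModule_act,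
    Polynomial.smul_eq_C_mul, mul_one]

/-- The constant double series `1`. -/
def oneSeries : DoubleSeries F 𝒱 := LaurentInv.const (LaurentInv.const 1)

/-- `(z - w - λ)⁻¹`, expanded for large `z`. -/
def alphaKernel : DoubleSeries F 𝒱 :=
  resolvent (varAdd (LinearMap.mulLeft F Polynomial.X)) oneSeries

/-- `(z + w)⁻¹`, expanded for large `z`. -/
def betaKernel : DoubleSeries F 𝒱 := resolvent (-LaurentInv.mulVar) oneSeries

theorem map_coeffDeriv_oneSeries :
    LaurentInv.map (LaurentInv.map (coeffDeriv d)) oneSeries = 0 := by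
  rw [oneSeries, LaurentInv.map_const, LaurentInv.map_const, coeffDeriv_one, map_zero, map_zero]

/-- Since `∂` annihilates `1`, it may be added to the denominator `z - w - λ`. -/
theorem alphaKernel_eq : alphaKernel = resolvent (varAdd (lambdaAdd d)) oneSeries := by
  have h : varAdd (lambdaAdd d) = varAdd (LinearMap.mulLeft F Polynomial.X) +
      LaurentInv.map (coeffDeriv d) := by
    rw [varAdd, varAdd, add_assoc]; rfl
  rw [alphaKernel, h, resolvent_add _ (map_coeffDeriv_oneSeries d)]
  refine (LaurentInv.commute_mulVar_map _).add_left ?_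
  refine LinearMap.ext fun G => LaurentInv.ext fun n => ?_
  exact (coeffDeriv_X_mul d _).symm

/-- Since `∂` annihilates `1`, it may be added to the denominator `z + w`. -/
theorem betaKernel_eq : betaKernel = resolvent (-varAdd (coeffDeriv d)) oneSeries := by
  exact (resolvent_neg_add (LaurentInv.commute_mulVar_map (coeffDeriv d))
    (map_coeffDeriv_oneSeries d)).symm

theorem zLeft_oneSeries (a : PseudoDiffOp d) :
    zLeft d a oneSeries = LaurentInv.map LaurentInv.const (adjointEval d a) := by
  rw [← left_one_eq_adjointEval, zLeft, oneSeries,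
    (fstModule d).map_left (fstModule d).laurent LaurentInv.const, LaurentInv.map_const]
  · exact fun f m => (LaurentInv.map_const _ m).symm
  · exact fun m => (LaurentInv.map_const _ m).symm

theorem zRight_oneSeries (a : PseudoDiffOp d) :
    zRight d a oneSeries = LaurentInv.map LaurentInv.const (symbolConst d a) := by
  rw [← right_one_eq_symbolConst, zRight, oneSeries,
    (fstModule d).map_right (fstModule d).laurent LaurentInv.const, LaurentInv.map_const]
  exact fun f m => (LaurentInv.map_const _ m).symm

theorem zLeft_del (H : DoubleSeries F 𝒱) : zLeft d (PseudoDiffOp.del d) H =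
    LaurentInv.mulVar H -
      LaurentInv.map (LaurentInv.map (LinearMap.mulLeft F Polynomial.X)) H := by
  refine left_del_of_neg (fstModule d).laurent ?_ H
  rfl

theorem zRight_del (H : DoubleSeries F 𝒱) : zRight d (PseudoDiffOp.del d) H =
    LaurentInv.mulVar H := DiffModule.right_del _ H

theorem wLeft_del (H : DoubleSeries F 𝒱) : wLeft d (PseudoDiffOp.del d) H =
    LaurentInv.map (varAdd (lambdaAdd d)) H :=
  LaurentInv.ext fun n => DiffModule.left_del _ (H.1 n)

theorem wRight_del (H : DoubleSeries F 𝒱) : wRight d (PseudoDiffOp.del d) H =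
    LaurentInv.map LaurentInv.mulVar H :=
  LaurentInv.ext fun n => DiffModule.right_del _ (H.1 n)

theorem zLeft_alphaKernel (a : PseudoDiffOp d) : zLeft d a alphaKernel =
    resolvent (varAdd (lambdaAdd d)) (LaurentInv.map LaurentInv.const (adjointEval d a)) := by
  rw [alphaKernel_eq d, ← zLeft_oneSeries]
  refine apply_resolvent _ (fun H => ?_) _
  -- `z` and `w + λ + ∂` are actions of `∂` which commute with the left action in `z`.
  have h1 := LinearMap.congr_fun (commute_zLeft_zRight d a (PseudoDiffOp.del d)) H
  have h2 := LinearMap.congr_fun (commute_zLeft_wLeft d a (PseudoDiffOp.del d)) H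
  simp only [Module.End.mul_apply, zRight_del, wLeft_del] at h1 h2
  rw [map_sub, h1, h2]

theorem zRight_alphaKernel (a : PseudoDiffOp d) : zRight d a alphaKernel =
    resolvent (varAdd (LinearMap.mulLeft F Polynomial.X))
      (LaurentInv.map LaurentInv.const (symbolConst d a)) := by
  rw [alphaKernel, ← zRight_oneSeries]
  refine apply_resolvent _ (fun H => ?_) _
  -- `z - w - λ` is the difference of `z - λ` and `w`, which are actions of `∂`.
  have h : ∀ H : DoubleSeries F 𝒱, LaurentInv.mulVar H -
      LaurentInv.map (varAdd (LinearMap.mulLeft F Polynomial.X)) H =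
      zLeft d (PseudoDiffOp.del d) H - wRight d (PseudoDiffOp.del d) H := fun H => by
    have hs : LaurentInv.map (varAdd (LinearMap.mulLeft F (Polynomial.X : 𝒱[X]))) H =
      LaurentInv.map LaurentInv.mulVar H +
        LaurentInv.map (LaurentInv.map (LinearMap.mulLeft F Polynomial.X)) H := rfl
    rw [hs, zLeft_del, wRight_del]
    abel
  have h1 := LinearMap.congr_fun (commute_zLeft_zRight d (PseudoDiffOp.del d) a) H
  have h2 := LinearMap.congr_fun (commute_zRight_wRight d a (PseudoDiffOp.del d)) H
  simp only [Module.End.mul_apply] at h1 h2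
  rw [h, h, map_sub, h1, h2]

theorem zRight_betaKernel (a : PseudoDiffOp d) : zRight d a betaKernel =
    resolvent (-varAdd (coeffDeriv d))
      (LaurentInv.map LaurentInv.const (symbolConst d a)) := by
  rw [betaKernel_eq d, ← zRight_oneSeries]
  refine apply_resolvent _ (fun H => ?_) _
  -- `z + w + ∂` is the sum of `z - λ` and `w + λ + ∂`, which are actions of `∂`.
  have h : ∀ H : DoubleSeries F 𝒱, LaurentInv.mulVar H -
      LaurentInv.map (-varAdd (coeffDeriv d)) H =
      zLeft d (PseudoDiffOp.del d) H + wLeft d (PseudoDiffOp.del d) H := fun H => by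
    have hs : LaurentInv.map (-varAdd (coeffDeriv d)) H =
      -(LaurentInv.map LaurentInv.mulVar H + LaurentInv.map (LaurentInv.map (coeffDeriv d)) H) :=
        rfl
    have hs' : LaurentInv.map (varAdd (lambdaAdd d)) H =
      LaurentInv.map LaurentInv.mulVar H +
        (LaurentInv.map (LaurentInv.map (LinearMap.mulLeft F Polynomial.X)) H +
          LaurentInv.map (LaurentInv.map (coeffDeriv d)) H) := rfl
    rw [hs, zLeft_del, wLeft_del, hs']
    abel
  have h1 := LinearMap.congr_fun (commute_zLeft_zRight d (PseudoDiffOp.del d) a) H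
  have h2 := LinearMap.congr_fun (commute_zRight_wLeft d a (PseudoDiffOp.del d)) H
  simp only [Module.End.mul_apply] at h1 h2
  rw [h, h, map_add, h1, h2]

theorem zLeft_betaKernel (a : PseudoDiffOp d) : zLeft d a betaKernel =
    resolvent (-LaurentInv.mulVar) (LaurentInv.map LaurentInv.const (adjointEval d a)) := by
  rw [betaKernel, ← zLeft_oneSeries]
  refine apply_resolvent _ (fun H => ?_) _
  -- `z + w` is the sum of two right actions of `∂`.
  have h : ∀ H : DoubleSeries F 𝒱, LaurentInv.mulVar H -
      LaurentInv.map (-LaurentInv.mulVar) H =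
      zRight d (PseudoDiffOp.del d) H + wRight d (PseudoDiffOp.del d) H := fun H => by
    rw [sub_map_neg, zRight_del, wRight_del]
  have h1 := LinearMap.congr_fun (commute_zLeft_zRight d a (PseudoDiffOp.del d)) H
  have h2 := LinearMap.congr_fun (commute_zLeft_wRight d a (PseudoDiffOp.del d)) H
  simp only [Module.End.mul_apply] at h1 h2
  rw [h, h, map_add, h1, h2]

theorem kernelLeft_adjointEval (a b : PseudoDiffOp d) :
    kernelLeft d 1 (lambdaAdd d) (adjointEval d a) b =
      expand (wLeft d b (zLeft d a alphaKernel)) := by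
  rw [kernelLeft_eq, one_smul, zLeft_alphaKernel]

theorem kernelRight_symbolConst (a b : PseudoDiffOp d) :
    kernelRight d 1 (lambdaAdd d) (symbolConst d a) b =
      expand (wRight d b (zRight d a alphaKernel)) := by
  have h : coeffDeriv d (Polynomial.X : 𝒱[X]) = 0 := by
    rw [← mul_one (Polynomial.X : 𝒱[X]), coeffDeriv_X_mul, coeffDeriv_one, mul_zero]
  rw [lambdaAdd, kernelRight_eq d 1 h, one_smul, zRight_alphaKernel]

theorem kernelLeft_symbolConst (a b : PseudoDiffOp d) :
    kernelLeft d (-1) (coeffDeriv d) (symbolConst d a) b =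
      expand (wLeft d b (zRight d a betaKernel)) := by
  have hs : (-1 : ℤ) • varAdd (coeffDeriv d) = -varAdd (coeffDeriv d) := neg_one_zsmul_end _
  rw [kernelLeft_eq, hs, zRight_betaKernel]

theorem kernelRight_adjointEval (a b : PseudoDiffOp d) :
    kernelRight d (-1) (coeffDeriv d) (adjointEval d a) b =
      expand (wRight d b (zLeft d a betaKernel)) := by
  have h := kernelRight_eq d (-1) (map_zero (coeffDeriv d)) (adjointEval d a) b
  have h0 : LinearMap.mulLeft F (0 : 𝒱[X]) = 0 := LinearMap.mulLeft_zero_eq_zero F _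
  have h1 : varAdd (0 : Module.End F 𝒱[X]) = LaurentInv.mulVar :=
    LinearMap.ext fun G => LaurentInv.ext fun n => add_zero _
  have hs : (-1 : ℤ) • (LaurentInv.mulVar : Module.End F (LaurentInv F 𝒱[X])) =
    -LaurentInv.mulVar := neg_one_zsmul_end _
  rw [h0, zero_add, h1, hs] at h
  rw [h, zLeft_betaKernel]

theorem kernelDiff_eq (a b : PseudoDiffOp d) :
    kernelDiff d (adjointEval d a - symbolConst d a) b = expand (gammaSeries d a b) := by
  rw [gammaSeries_apply, left_one_eq_adjointEval, right_one_eq_symbolConst]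
  rfl

end Kernels

/-! ### Pairs of commuting bimodule structures -/

/-- Two commuting bimodule structures over the same algebra on a module: a left and a right action
in each of the variables `z` and `w`. -/
structure BimodulePair (F R S : Type*) [Field F] [Ring R] [Algebra F R] [AddCommMonoid S]
    [Module F S] where
  /-- The left action in the variable `z`. -/
  zl : R →ₗ[F] Module.End F S
  /-- The right action in the variable `z`. -/
  zr : R →ₗ[F] Module.End F S
  /-- The left action in the variable `w`. -/
  wl : R →ₗ[F] Module.End F S
  /-- The right action in the variable `w`. -/
  wr : R →ₗ[F] Module.End F S
  zl_mul : ∀ a b, zl (a * b) = zl a * zl b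
  zr_mul : ∀ a b, zr (a * b) = zr b * zr a
  wl_mul : ∀ a b, wl (a * b) = wl a * wl b
  wr_mul : ∀ a b, wr (a * b) = wr b * wr a
  zl_one : zl 1 = 1
  zr_one : zr 1 = 1
  wl_one : wl 1 = 1
  wr_one : wr 1 = 1
  zl_zr : ∀ a b, Commute (zl a) (zr b)
  wl_wr : ∀ a b, Commute (wl a) (wr b)
  zl_wl : ∀ a b, Commute (zl a) (wl b)
  zl_wr : ∀ a b, Commute (zl a) (wr b)
  zr_wl : ∀ a b, Commute (zr a) (wl b)
  zr_wr : ∀ a b, Commute (zr a) (wr b)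

section TensorOp

variable {F R S Q W : Type*} [Field F] [Ring R] [Algebra F R] [Ring Q] [Algebra F Q]
  [AddCommMonoid S] [Module F S] [AddCommMonoid W] [Module F W]

/-- The operators on `S ⊗ W` defined by operators on `S` and on `W`. -/
def tensorOp (l : R →ₗ[F] Module.End F S) (r : Q →ₗ[F] Module.End F W) :
    R ⊗[F] Q →ₗ[F] Module.End F (S ⊗[F] W) :=
  TensorProduct.lift ((TensorProduct.mapBilinear (RingHom.id F) S W S W).compl₁₂ l r)

theorem tensorOp_tmul (l : R →ₗ[F] Module.End F S) (r : Q →ₗ[F] Module.End F W) (a : R) (x : Q) :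
    tensorOp l r (a ⊗ₜ[F] x) = TensorProduct.map (l a) (r x) := rfl

theorem tensorOp_mul {l : R →ₗ[F] Module.End F S} {r : Q →ₗ[F] Module.End F W}
    (hl : ∀ a b, l (a * b) = l a * l b) (hr : ∀ x y, r (x * y) = r x * r y) (u v : R ⊗[F] Q) :
    tensorOp l r (u * v) = tensorOp l r u * tensorOp l r v := by
  induction u using TensorProduct.induction_on with
  | zero => simp
  | add u u' hu hu' => rw [add_mul, map_add, hu, hu', map_add, add_mul]
  | tmul a x =>
    induction v using TensorProduct.induction_on with
    | zero => simp
    | add v v' hv hv' => rw [mul_add, map_add, hv, hv', map_add, mul_add]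
    | tmul b y =>
      rw [Algebra.TensorProduct.tmul_mul_tmul, tensorOp_tmul, tensorOp_tmul, tensorOp_tmul, hl, hr,
        TensorProduct.map_mul]

theorem tensorOp_mul_rev {l : R →ₗ[F] Module.End F S} {r : Q →ₗ[F] Module.End F W}
    (hl : ∀ a b, l (a * b) = l b * l a) (hr : ∀ x y, r (x * y) = r y * r x) (u v : R ⊗[F] Q) :
    tensorOp l r (u * v) = tensorOp l r v * tensorOp l r u := by
  induction u using TensorProduct.induction_on with
  | zero => simp
  | add u u' hu hu' => rw [add_mul, map_add, hu, hu', map_add, mul_add]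
  | tmul a x =>
    induction v using TensorProduct.induction_on with
    | zero => simp
    | add v v' hv hv' => rw [mul_add, map_add, hv, hv', map_add, add_mul]
    | tmul b y =>
      rw [Algebra.TensorProduct.tmul_mul_tmul, tensorOp_tmul, tensorOp_tmul, tensorOp_tmul, hl, hr,
        TensorProduct.map_mul]

theorem tensorOp_one {l : R →ₗ[F] Module.End F S} {r : Q →ₗ[F] Module.End F W}
    (hl : l 1 = 1) (hr : r 1 = 1) : tensorOp l r 1 = 1 := by
  rw [Algebra.TensorProduct.one_def, tensorOp_tmul, hl, hr, TensorProduct.map_one]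

theorem commute_tensorOp {l l' : R →ₗ[F] Module.End F S} {r r' : Q →ₗ[F] Module.End F W}
    (hl : ∀ a b, Commute (l a) (l' b)) (hr : ∀ x y, Commute (r x) (r' y)) (u v : R ⊗[F] Q) :
    Commute (tensorOp l r u) (tensorOp l' r' v) := by
  induction u using TensorProduct.induction_on with
  | zero => rw [map_zero]; exact Commute.zero_left _
  | add u u' hu hu' => rw [map_add]; exact hu.add_left hu'
  | tmul a x =>
    induction v using TensorProduct.induction_on with
    | zero => rw [map_zero]; exact Commute.zero_right _
    | add v v' hv hv' => rw [map_add]; exact hv.add_right hv'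
    | tmul b y =>
      rw [tensorOp_tmul, tensorOp_tmul]
      change TensorProduct.map _ _ * TensorProduct.map _ _ =
        TensorProduct.map _ _ * TensorProduct.map _ _
      rw [← TensorProduct.map_mul, ← TensorProduct.map_mul, (hl a b).eq, (hr x y).eq]

/-- The tensor product of pairs of bimodule structures. -/
def BimodulePair.tensor (M : BimodulePair F R S) (N : BimodulePair F Q W) :
    BimodulePair F (R ⊗[F] Q) (S ⊗[F] W) where
  zl := tensorOp M.zl N.zl
  zr := tensorOp M.zr N.zr
  wl := tensorOp M.wl N.wl
  wr := tensorOp M.wr N.wr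
  zl_mul := tensorOp_mul M.zl_mul N.zl_mul
  zr_mul := tensorOp_mul_rev M.zr_mul N.zr_mul
  wl_mul := tensorOp_mul M.wl_mul N.wl_mul
  wr_mul := tensorOp_mul_rev M.wr_mul N.wr_mul
  zl_one := tensorOp_one M.zl_one N.zl_one
  zr_one := tensorOp_one M.zr_one N.zr_one
  wl_one := tensorOp_one M.wl_one N.wl_one
  wr_one := tensorOp_one M.wr_one N.wr_one
  zl_zr := commute_tensorOp M.zl_zr N.zl_zr
  wl_wr := commute_tensorOp M.wl_wr N.wl_wr
  zl_wl := commute_tensorOp M.zl_wl N.zl_wl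
  zl_wr := commute_tensorOp M.zl_wr N.zl_wr
  zr_wl := commute_tensorOp M.zr_wl N.zr_wl
  zr_wr := commute_tensorOp M.zr_wr N.zr_wr

variable {T : Type*} [AddCommMonoid T] [Module F T]

/-- A bilinear expression in two tensors which is, on pure tensors, obtained by letting the first
tensor and then the second one act. -/
theorem map₂_eq_tensorOp (ι : S →ₗ[F] T)
    {l l' : R →ₗ[F] Module.End F S} {r r' : Q →ₗ[F] Module.End F W} {f : R →ₗ[F] R →ₗ[F] T}
    {h : Q →ₗ[F] Q →ₗ[F] W} {k : S} {w : W} (hf : ∀ a b, f a b = ι (l' b (l a k)))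
    (hh : ∀ x y, h x y = r' y (r x w)) (u v : R ⊗[F] Q) :
    TensorProduct.map₂ f h u v =
      ι.rTensor W (tensorOp l' r' v (tensorOp l r u (k ⊗ₜ[F] w))) := by
  induction u using TensorProduct.induction_on with
  | zero => simp
  | add u u' hu hu' =>
    rw [map_add, LinearMap.add_apply, hu, hu', map_add, LinearMap.add_apply, map_add, map_add]
  | tmul a x =>
    induction v using TensorProduct.induction_on with
    | zero => simp
    | add v v' hv hv' => rw [map_add, hv, hv', map_add, LinearMap.add_apply, map_add]
    | tmul b y =>
      rw [TensorProduct.map₂_apply_tmul, TensorProduct.map_tmul, hf, hh, tensorOp_tmul,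
        tensorOp_tmul, TensorProduct.map_tmul, TensorProduct.map_tmul, LinearMap.rTensor_tmul]

theorem map₂_eq_rTensor (ι : S →ₗ[F] T)
    {f : R →ₗ[F] R →ₗ[F] T} {g : R →ₗ[F] R →ₗ[F] S} {h : Q →ₗ[F] Q →ₗ[F] W}
    (hf : ∀ a b, f a b = ι (g a b)) (u v : R ⊗[F] Q) :
    TensorProduct.map₂ f h u v = ι.rTensor W (TensorProduct.map₂ g h u v) := by
  induction u using TensorProduct.induction_on with
  | zero => simp
  | add u u' hu hu' =>
    rw [map_add, LinearMap.add_apply, hu, hu', map_add, LinearMap.add_apply, map_add]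
  | tmul a x =>
    induction v using TensorProduct.induction_on with
    | zero => simp
    | add v v' hv hv' => rw [map_add, hv, hv', map_add, map_add]
    | tmul b y =>
      rw [TensorProduct.map₂_apply_tmul, TensorProduct.map_tmul, hf,
        TensorProduct.map₂_apply_tmul, TensorProduct.map_tmul, LinearMap.rTensor_tmul]

end TensorOp

section Regular

variable (F E : Type*) [Field F] [Ring E] [Algebra F E]

/-- `E ⊗ E`, where the variable `z` corresponds to the first factor and `w` to the second one. -/
def BimodulePair.regular : BimodulePair F E (E ⊗[F] E) where
  zl := LinearMap.mul F (E ⊗[F] E) ∘ₗ (TensorProduct.mk F E E).flip 1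
  zr := (LinearMap.mul F (E ⊗[F] E)).flip ∘ₗ (TensorProduct.mk F E E).flip 1
  wl := LinearMap.mul F (E ⊗[F] E) ∘ₗ TensorProduct.mk F E E 1
  wr := (LinearMap.mul F (E ⊗[F] E)).flip ∘ₗ TensorProduct.mk F E E 1
  zl_mul X Y := LinearMap.ext fun W => by
    change ((X * Y) ⊗ₜ[F] 1) * W = (X ⊗ₜ[F] 1) * ((Y ⊗ₜ[F] 1) * W)
    rw [← mul_assoc, Algebra.TensorProduct.tmul_mul_tmul, mul_one]
  zr_mul X Y := LinearMap.ext fun W => by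
    change W * ((X * Y) ⊗ₜ[F] 1) = W * (X ⊗ₜ[F] 1) * (Y ⊗ₜ[F] 1)
    rw [mul_assoc, Algebra.TensorProduct.tmul_mul_tmul, mul_one]
  wl_mul X Y := LinearMap.ext fun W => by
    change (1 ⊗ₜ[F] (X * Y)) * W = (1 ⊗ₜ[F] X) * ((1 ⊗ₜ[F] Y) * W)
    rw [← mul_assoc, Algebra.TensorProduct.tmul_mul_tmul, mul_one]
  wr_mul X Y := LinearMap.ext fun W => by
    change W * (1 ⊗ₜ[F] (X * Y)) = W * (1 ⊗ₜ[F] X) * (1 ⊗ₜ[F] Y)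
    rw [mul_assoc, Algebra.TensorProduct.tmul_mul_tmul, mul_one]
  zl_one := LinearMap.ext fun W => one_mul W
  zr_one := LinearMap.ext fun W => mul_one W
  wl_one := LinearMap.ext fun W => one_mul W
  wr_one := LinearMap.ext fun W => mul_one W
  zl_zr X Y := LinearMap.ext fun W => (mul_assoc (X ⊗ₜ[F] 1) W (Y ⊗ₜ[F] 1)).symm
  wl_wr X Y := LinearMap.ext fun W => (mul_assoc (1 ⊗ₜ[F] X) W (1 ⊗ₜ[F] Y)).symm
  zl_wr X Y := LinearMap.ext fun W => (mul_assoc (X ⊗ₜ[F] 1) W (1 ⊗ₜ[F] Y)).symm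
  zr_wl X Y := LinearMap.ext fun W => mul_assoc (1 ⊗ₜ[F] Y) W (X ⊗ₜ[F] 1)
  zl_wl X Y := LinearMap.ext fun W => by
    change (X ⊗ₜ[F] 1) * ((1 ⊗ₜ[F] Y) * W) = (1 ⊗ₜ[F] Y) * ((X ⊗ₜ[F] 1) * W)
    simp only [← mul_assoc, Algebra.TensorProduct.tmul_mul_tmul, mul_one, one_mul]
  zr_wr X Y := LinearMap.ext fun W => by
    change W * (1 ⊗ₜ[F] Y) * (X ⊗ₜ[F] 1) = W * (X ⊗ₜ[F] 1) * (1 ⊗ₜ[F] Y)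
    simp only [mul_assoc, Algebra.TensorProduct.tmul_mul_tmul, mul_one, one_mul]

end Regular

/-! ### Biderivations and inverses -/

namespace BimodulePair

variable {F R S : Type*} [Field F] [Ring R] [Algebra F R]

/-- A bilinear map which satisfies the Leibniz rule in both arguments. -/
structure IsBiderivation [AddCommMonoid S] [Module F S] (M : BimodulePair F R S)
    (g : R →ₗ[F] R →ₗ[F] S) : Prop where
  mul_left : ∀ a a' b, g (a * a') b = M.zl a (g a' b) + M.zr a' (g a b)
  mul_right : ∀ a b b', g a (b * b') = M.wl b (g a b') + M.wr b' (g a b)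

/-- The extension of a biderivation to operators with values in an algebra. -/
theorem IsBiderivation.map₂_mk [AddCommMonoid S] [Module F S] {M : BimodulePair F R S}
    {g : R →ₗ[F] R →ₗ[F] S} (hg : M.IsBiderivation g) (E : Type*) [Ring E] [Algebra F E] :
    (M.tensor (regular F E)).IsBiderivation
      (TensorProduct.map₂ g (TensorProduct.mk F E E)) := by
  constructor
  · intro u u' v
    induction u using TensorProduct.induction_on with
    | zero => simp
    | add u₁ u₂ h₁ h₂ =>
      simp only [add_mul, map_add, LinearMap.add_apply, h₁, h₂]; exact add_add_add_comm _ _ _ _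
    | tmul a X =>
    induction u' using TensorProduct.induction_on with
    | zero => simp
    | add u₁ u₂ h₁ h₂ =>
      simp only [mul_add, map_add, LinearMap.add_apply, h₁, h₂]; exact add_add_add_comm _ _ _ _
    | tmul a' X' =>
    induction v using TensorProduct.induction_on with
    | zero => simp
    | add v₁ v₂ h₁ h₂ => simp only [map_add, h₁, h₂]; exact add_add_add_comm _ _ _ _
    | tmul b Y =>
      have h1 : ((X * X') ⊗ₜ[F] Y) = (X ⊗ₜ[F] 1) * (X' ⊗ₜ[F] Y) := by
        rw [Algebra.TensorProduct.tmul_mul_tmul, one_mul]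
      have h2 : ((X * X') ⊗ₜ[F] Y) = (X ⊗ₜ[F] Y) * (X' ⊗ₜ[F] 1) := by
        rw [Algebra.TensorProduct.tmul_mul_tmul, mul_one]
      rw [Algebra.TensorProduct.tmul_mul_tmul]
      change g (a * a') b ⊗ₜ[F] ((X * X') ⊗ₜ[F] Y) =
        M.zl a (g a' b) ⊗ₜ[F] ((X ⊗ₜ[F] 1) * (X' ⊗ₜ[F] Y)) +
        M.zr a' (g a b) ⊗ₜ[F] ((X ⊗ₜ[F] Y) * (X' ⊗ₜ[F] 1))
      rw [← h1, ← h2, hg.mul_left, TensorProduct.add_tmul]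
  · intro u v v'
    induction u using TensorProduct.induction_on with
    | zero => simp
    | add u₁ u₂ h₁ h₂ =>
      simp only [map_add, LinearMap.add_apply, h₁, h₂]; exact add_add_add_comm _ _ _ _
    | tmul a X =>
    induction v using TensorProduct.induction_on with
    | zero => simp
    | add u₁ u₂ h₁ h₂ =>
      simp only [add_mul, map_add, LinearMap.add_apply, h₁, h₂]; exact add_add_add_comm _ _ _ _
    | tmul b Y =>
    induction v' using TensorProduct.induction_on with
    | zero => simp
    | add v₁ v₂ h₁ h₂ =>
      simp only [mul_add, map_add, LinearMap.add_apply, h₁, h₂]; exact add_add_add_comm _ _ _ _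
    | tmul b' Y' =>
      have h1 : (X ⊗ₜ[F] (Y * Y')) = (1 ⊗ₜ[F] Y) * (X ⊗ₜ[F] Y') := by
        rw [Algebra.TensorProduct.tmul_mul_tmul, one_mul]
      have h2 : (X ⊗ₜ[F] (Y * Y')) = (X ⊗ₜ[F] Y) * (1 ⊗ₜ[F] Y') := by
        rw [Algebra.TensorProduct.tmul_mul_tmul, mul_one]
      rw [Algebra.TensorProduct.tmul_mul_tmul]
      change g a (b * b') ⊗ₜ[F] (X ⊗ₜ[F] (Y * Y')) =
        M.wl b (g a b') ⊗ₜ[F] ((1 ⊗ₜ[F] Y) * (X ⊗ₜ[F] Y')) +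
        M.wr b' (g a b) ⊗ₜ[F] ((X ⊗ₜ[F] Y) * (1 ⊗ₜ[F] Y'))
      rw [← h1, ← h2, hg.mul_right, TensorProduct.add_tmul]

variable [AddCommGroup S] [Module F S] (M : BimodulePair F R S) {A U : R}

/-- All four actions of an element. -/
def conj (U : R) : Module.End F S := M.zl U * M.zr U * (M.wl U * M.wr U)

theorem conj_apply (x : S) : M.conj U x = M.zl U (M.zr U (M.wl U (M.wr U x))) := rfl

variable {M} in
/-- A biderivation evaluated at an inverse: each argument contributes a sign, and these cancel. -/
theorem IsBiderivation.inverse {g : R →ₗ[F] R →ₗ[F] S} (hg : M.IsBiderivation g)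
    (hAU : A * U = 1) (hUA : U * A = 1) : g U U = M.conj U (g A A) := by
  have left : ∀ v, g U v = -M.zl U (M.zr U (g A v)) := by
    intro v
    have h1 : g 1 v = 0 := by
      have h := hg.mul_left 1 1 v
      rw [mul_one, M.zl_one, M.zr_one, Module.End.one_apply] at h
      simpa using h
    have h2 := hg.mul_left A U v
    rw [hAU, h1] at h2
    have h3 := congrArg (M.zl U) h2
    rw [map_zero, map_add, ← Module.End.mul_apply, ← M.zl_mul, hUA, M.zl_one,
      Module.End.one_apply] at h3
    exact eq_neg_of_add_eq_zero_left h3.symm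
  have right : ∀ v, g v U = -M.wl U (M.wr U (g v A)) := by
    intro v
    have h1 : g v 1 = 0 := by
      have h := hg.mul_right v 1 1
      rw [mul_one, M.wl_one, M.wr_one, Module.End.one_apply] at h
      simpa using h
    have h2 := hg.mul_right v A U
    rw [hAU, h1] at h2
    have h3 := congrArg (M.wl U) h2
    rw [map_zero, map_add, ← Module.End.mul_apply, ← M.wl_mul, hUA, M.wl_one,
      Module.End.one_apply] at h3
    exact eq_neg_of_add_eq_zero_left h3.symm
  rw [left, right, conj_apply]
  simp only [map_neg, neg_neg]

section Conj

variable (x : S)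

theorem zl_cancel (hUA : U * A = 1) : M.zl U (M.zl A x) = x := by
  rw [← Module.End.mul_apply, ← M.zl_mul, hUA, M.zl_one, Module.End.one_apply]

theorem wl_cancel (hUA : U * A = 1) : M.wl U (M.wl A x) = x := by
  rw [← Module.End.mul_apply, ← M.wl_mul, hUA, M.wl_one, Module.End.one_apply]

theorem zr_cancel (hAU : A * U = 1) : M.zr U (M.zr A x) = x := by
  rw [← Module.End.mul_apply, ← M.zr_mul, hAU, M.zr_one, Module.End.one_apply]

theorem wr_cancel (hAU : A * U = 1) : M.wr U (M.wr A x) = x := by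
  rw [← Module.End.mul_apply, ← M.wr_mul, hAU, M.wr_one, Module.End.one_apply]

theorem conj_wl_zl (hUA : U * A = 1) :
    M.conj U (M.wl A (M.zl A x)) = M.wr U (M.zr U x) := by
  have h1 := LinearMap.congr_fun (M.wl_wr A U) (M.zl A x)
  have h2 := LinearMap.congr_fun (M.zl_wr A U) x
  have h3 := LinearMap.congr_fun (M.zl_zr A U) (M.wr U x)
  have h4 := LinearMap.congr_fun (M.zr_wr U U) x
  simp only [Module.End.mul_apply] at h1 h2 h3 h4
  rw [conj_apply, ← h1, wl_cancel _ _ hUA, ← h2, ← h3, zl_cancel _ _ hUA, h4]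

theorem conj_wr_zr (hAU : A * U = 1) :
    M.conj U (M.wr A (M.zr A x)) = M.wl U (M.zl U x) := by
  have h1 := LinearMap.congr_fun (M.zr_wl A U) x
  have h2 := LinearMap.congr_fun (M.zl_wl U U) x
  simp only [Module.End.mul_apply] at h1 h2
  rw [conj_apply, wr_cancel _ _ hAU, ← h1, zr_cancel _ _ hAU, h2]

theorem conj_wl_zr (hUA : U * A = 1) (hAU : A * U = 1) :
    M.conj U (M.wl A (M.zr A x)) = M.wr U (M.zl U x) := by
  have h1 := LinearMap.congr_fun (M.wl_wr A U) (M.zr A x)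
  have h2 := LinearMap.congr_fun (M.zr_wr A U) x
  have h3 := LinearMap.congr_fun (M.zl_wr U U) x
  simp only [Module.End.mul_apply] at h1 h2 h3
  rw [conj_apply, ← h1, wl_cancel _ _ hUA, ← h2, zr_cancel _ _ hAU, h3]

theorem conj_wr_zl (hUA : U * A = 1) (hAU : A * U = 1) :
    M.conj U (M.wr A (M.zl A x)) = M.wl U (M.zr U x) := by
  have h1 := LinearMap.congr_fun (M.zl_wl A U) x
  have h2 := LinearMap.congr_fun (M.zl_zr A U) (M.wl U x)
  have h3 := LinearMap.congr_fun (M.zr_wl U U) x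
  simp only [Module.End.mul_apply] at h1 h2 h3
  rw [conj_apply, wr_cancel _ _ hAU, ← h1, ← h2, zl_cancel _ _ hUA, h3]

end Conj

/-- The shape of the generalized Adler identity: `g` is the bracket, `c` the `γ`-term, and `κ`, `ω`
are the kernels in the `α`-terms and in the `β`-terms. -/
def AdlerShape (g c : R →ₗ[F] R →ₗ[F] S) (κ ω : S) (α β γ : F) (A : R) : Prop :=
  g A A = α • M.wl A (M.zl A κ) - α • M.wr A (M.zr A κ) - β • M.wl A (M.zr A ω)
    + β • M.wr A (M.zl A ω) + γ • c A A

/-- Letting the inverse act in all four ways exchanges the two `α`-terms, and the two `β`-terms. -/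
theorem AdlerShape.inverse {M : BimodulePair F R S} {g c : R →ₗ[F] R →ₗ[F] S} {κ ω : S}
    {α β γ : F} (h : M.AdlerShape g c κ ω α β γ A) (hg : M.IsBiderivation g)
    (hc : M.IsBiderivation c) (hAU : A * U = 1) (hUA : U * A = 1) :
    M.AdlerShape g c κ ω (-α) (-β) γ U := by
  rw [AdlerShape] at h ⊢
  rw [hg.inverse hAU hUA, h, hc.inverse hAU hUA]
  simp only [map_add, map_sub, map_smul, M.conj_wl_zl _ hUA, M.conj_wr_zr _ hAU,
    M.conj_wl_zr _ hUA hAU, M.conj_wr_zl _ hUA hAU, neg_smul]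
  abel

end BimodulePair

/-! ### The generalized Adler identity for the inverse -/

section Abstract

variable {F R S T E : Type*} [Field F] [Ring R] [Algebra F R] [AddCommGroup S] [Module F S]
  [AddCommGroup T] [Module F T] [Ring E] [Algebra F E]

/-- The generalized Adler identity with values in `T`, in terms of actions on a module `S` that
embeds in `T`. -/
theorem adlerShape_iff (M : BimodulePair F R S) {ι : S →ₗ[F] T} (hι : Function.Injective ι)
    {g c : R →ₗ[F] R →ₗ[F] S} {κ ω : S} {f₀ f₁ f₂ f₃ f₄ f₅ : R →ₗ[F] R →ₗ[F] T}
    {h₁ h₂ h₃ h₄ : E →ₗ[F] E →ₗ[F] E ⊗[F] E} {w w' : E ⊗[F] E}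
    (hf₀ : ∀ a b, f₀ a b = ι (g a b))
    (hf₁ : ∀ a b, f₁ a b = ι (M.wl b (M.zl a κ))) (hf₂ : ∀ a b, f₂ a b = ι (M.wr b (M.zr a κ)))
    (hf₃ : ∀ a b, f₃ a b = ι (M.wl b (M.zr a ω))) (hf₄ : ∀ a b, f₄ a b = ι (M.wr b (M.zl a ω)))
    (hf₅ : ∀ a b, f₅ a b = ι (c a b))
    (hh₁ : ∀ X Y, h₁ X Y = (X ⊗ₜ Y) * w) (hh₂ : ∀ X Y, h₂ X Y = w * (X ⊗ₜ Y))
    (hh₃ : ∀ X Y, h₃ X Y = (1 ⊗ₜ Y) * w' * (X ⊗ₜ 1))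
    (hh₄ : ∀ X Y, h₄ X Y = (X ⊗ₜ 1) * w' * (1 ⊗ₜ Y)) (α β γ : F) (A : R ⊗[F] E) :
    TensorProduct.map₂ f₀ (TensorProduct.mk F E E) A A =
      α • TensorProduct.map₂ f₁ h₁ A A - α • TensorProduct.map₂ f₂ h₂ A A
      - β • TensorProduct.map₂ f₃ h₃ A A + β • TensorProduct.map₂ f₄ h₄ A A
      + γ • TensorProduct.map₂ f₅ (TensorProduct.mk F E E) A A ↔
    (M.tensor (BimodulePair.regular F E)).AdlerShape
      (TensorProduct.map₂ g (TensorProduct.mk F E E))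
      (TensorProduct.map₂ c (TensorProduct.mk F E E)) (κ ⊗ₜ w) (ω ⊗ₜ w') α β γ A := by
  have hinj : Function.Injective (ι.rTensor (E ⊗[F] E)) :=
    Module.Flat.rTensor_preserves_injective_linearMap _ hι
  set N := BimodulePair.regular F E
  have e₁ := map₂_eq_tensorOp ι hf₁ (r := N.zl) (r' := N.wl) (h := h₁) (w := w)
    (fun X Y => by
      change _ = ((1 : E) ⊗ₜ[F] Y) * ((X ⊗ₜ[F] (1 : E)) * w)
      rw [hh₁, ← mul_assoc, Algebra.TensorProduct.tmul_mul_tmul, one_mul, mul_one]) A A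
  have e₂ := map₂_eq_tensorOp ι hf₂ (r := N.zr) (r' := N.wr) (h := h₂) (w := w)
    (fun X Y => by
      change _ = w * (X ⊗ₜ[F] (1 : E)) * ((1 : E) ⊗ₜ[F] Y)
      rw [hh₂, mul_assoc, Algebra.TensorProduct.tmul_mul_tmul, one_mul, mul_one]) A A
  have e₃ := map₂_eq_tensorOp ι hf₃ (r := N.zr) (r' := N.wl) (h := h₃) (w := w')
    (fun X Y => (hh₃ X Y).trans (mul_assoc _ _ _)) A A
  have e₄ := map₂_eq_tensorOp ι hf₄ (r := N.zl) (r' := N.wr) (h := h₄) (w := w')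
    (fun X Y => hh₄ X Y) A A
  rw [map₂_eq_rTensor ι hf₀, e₁, e₂, e₃, e₄, map₂_eq_rTensor ι hf₅, BimodulePair.AdlerShape,
    ← hinj.eq_iff]
  simp only [map_add, map_sub, map_smul]
  rfl

/-- The generalized Adler identity passes to inverses, with the signs of `α` and `β` changed. -/
theorem adler_inverse (M : BimodulePair F R S) {ι : S →ₗ[F] T} (hι : Function.Injective ι)
    {g c : R →ₗ[F] R →ₗ[F] S} (hg : M.IsBiderivation g) (hc : M.IsBiderivation c)
    {κ ω : S} {f₀ f₁ f₂ f₃ f₄ f₅ : R →ₗ[F] R →ₗ[F] T}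
    {h₁ h₂ h₃ h₄ : E →ₗ[F] E →ₗ[F] E ⊗[F] E} {w w' : E ⊗[F] E}
    (hf₀ : ∀ a b, f₀ a b = ι (g a b))
    (hf₁ : ∀ a b, f₁ a b = ι (M.wl b (M.zl a κ))) (hf₂ : ∀ a b, f₂ a b = ι (M.wr b (M.zr a κ)))
    (hf₃ : ∀ a b, f₃ a b = ι (M.wl b (M.zr a ω))) (hf₄ : ∀ a b, f₄ a b = ι (M.wr b (M.zl a ω)))
    (hf₅ : ∀ a b, f₅ a b = ι (c a b))
    (hh₁ : ∀ X Y, h₁ X Y = (X ⊗ₜ Y) * w) (hh₂ : ∀ X Y, h₂ X Y = w * (X ⊗ₜ Y))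
    (hh₃ : ∀ X Y, h₃ X Y = (1 ⊗ₜ Y) * w' * (X ⊗ₜ 1))
    (hh₄ : ∀ X Y, h₄ X Y = (X ⊗ₜ 1) * w' * (1 ⊗ₜ Y)) {α β γ : F} {A U : R ⊗[F] E}
    (hAU : A * U = 1) (hUA : U * A = 1)
    (hA : TensorProduct.map₂ f₀ (TensorProduct.mk F E E) A A =
      α • TensorProduct.map₂ f₁ h₁ A A - α • TensorProduct.map₂ f₂ h₂ A A
      - β • TensorProduct.map₂ f₃ h₃ A A + β • TensorProduct.map₂ f₄ h₄ A A
      + γ • TensorProduct.map₂ f₅ (TensorProduct.mk F E E) A A) :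
    TensorProduct.map₂ f₀ (TensorProduct.mk F E E) U U =
      (-α) • TensorProduct.map₂ f₁ h₁ U U - (-α) • TensorProduct.map₂ f₂ h₂ U U
      - (-β) • TensorProduct.map₂ f₃ h₃ U U + (-β) • TensorProduct.map₂ f₄ h₄ U U
      + γ • TensorProduct.map₂ f₅ (TensorProduct.mk F E E) U U :=
  (adlerShape_iff M hι hf₀ hf₁ hf₂ hf₃ hf₄ hf₅ hh₁ hh₂ hh₃ hh₄ _ _ _ _).2
    (((adlerShape_iff M hι hf₀ hf₁ hf₂ hf₃ hf₄ hf₅ hh₁ hh₂ hh₃ hh₄ _ _ _ _).1 hA).inverse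
      (hg.map₂_mk E) (hc.map₂_mk E) hAU hUA)

end Abstract

section Inverse

variable {F 𝒱 V : Type*} [Field F] [CommRing 𝒱] [Algebra F 𝒱] [AddCommGroup V] [Module F V]
  {d : Derivation F 𝒱 𝒱}

/-- The actions of pseudodifferential operators on double series. -/
def seriesPair (d : Derivation F 𝒱 𝒱) :
    BimodulePair F (PseudoDiffOp d) (DoubleSeries F 𝒱) where
  zl := zLeft d
  zr := zRight d
  wl := wLeft d
  wr := wRight d
  zl_mul := zLeft_mul d
  zr_mul := zRight_mul d
  wl_mul := wLeft_mul d
  wr_mul := wRight_mul d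
  zl_one := zLeft_one d
  zr_one := zRight_one d
  wl_one := wLeft_one d
  wr_one := wRight_one d
  zl_zr := commute_zLeft_zRight d
  wl_wr := commute_wLeft_wRight d
  zl_wl := commute_zLeft_wLeft d
  zl_wr := commute_zLeft_wRight d
  zr_wl := commute_zRight_wLeft d
  zr_wr := commute_zRight_wRight d

theorem isBiderivation_bracketSeries (P : LambdaBracket d) :
    (seriesPair d).IsBiderivation (bracketSeries P) :=
  ⟨bracketSeries_mul_left P, bracketSeries_mul_right P⟩

theorem isBiderivation_gammaSeries : (seriesPair d).IsBiderivation (gammaSeries d) :=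
  ⟨gammaSeries_mul_left d, gammaSeries_mul_right d⟩

theorem AdlerIdentity.inverse [FiniteDimensional F V] {P : PoissonVertexStructure d}
    {B : LinearMap.BilinForm F V} {α β γ : F} {A U : PseudoDiffOp d ⊗[F] Module.End F V}
    (h : AdlerIdentity P B α β γ A)
    (hAU : A * U = 1) (hUA : U * A = 1) : AdlerIdentity P B (-α) (-β) γ U :=
  adler_inverse (F := F) (R := PseudoDiffOp d) (S := DoubleSeries F 𝒱) (T := ℤ → ℤ → 𝒱[X])
    (E := Module.End F V) (seriesPair d) (ι := expand) expand_injective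
    (isBiderivation_bracketSeries P.toLambdaBracket)
    isBiderivation_gammaSeries
    (fun a b => (expand_bracketSeries P.toLambdaBracket a b).symm)
    (kernelLeft_adjointEval d) (kernelRight_symbolConst d) (kernelLeft_symbolConst d)
    (kernelRight_adjointEval d) (kernelDiff_eq d)
    (tmulMul_apply _) (mulTmul_apply _) (sandwichRL_apply _) (sandwichLR_apply _) hAU hUA h

end Inverse

/-! ### Adjoints with respect to a bilinear form -/

section Forms

variable {F V : Type*} [Field F] [AddCommGroup V] [Module F V]

theorem eq_of_form_right {B : LinearMap.BilinForm F V} (hB : B.Nondegenerate) {x y : V}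
    (h : ∀ u, B u x = B u y) : x = y :=
  sub_eq_zero.1 (hB.2 _ fun u => by rw [map_sub, h u, sub_self])

variable (F) in
/-- `y ⊗ w ↦ (x ↦ B x y • w)`. -/
def contract (B : LinearMap.BilinForm F V) (W : Type*) [AddCommGroup W] [Module F W] :
    V ⊗[F] W →ₗ[F] V →ₗ[F] W :=
  dualTensorHom F V W ∘ₗ B.flip.rTensor W

theorem contract_tmul (B : LinearMap.BilinForm F V) {W : Type*} [AddCommGroup W] [Module F W]
    (y : V) (w : W) (x : V) : contract F B W (y ⊗ₜ[F] w) x = B x y • w := rfl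

theorem contract_lTensor (B : LinearMap.BilinForm F V) {W W' : Type*} [AddCommGroup W]
    [Module F W] [AddCommGroup W'] [Module F W'] (f : W →ₗ[F] W') (z : V ⊗[F] W) (x : V) :
    contract F B W' (f.lTensor V z) x = f (contract F B W z x) := by
  induction z using TensorProduct.induction_on with
  | zero => simp
  | add z z' h h' => simp only [map_add, LinearMap.add_apply, h, h']
  | tmul y w => rw [LinearMap.lTensor_tmul, contract_tmul, contract_tmul, map_smul]

variable [FiniteDimensional F V]

theorem formAdjoint_one {B : LinearMap.BilinForm F V} (hB : B.Nondegenerate) :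
    formAdjoint B 1 = 1 :=
  LinearMap.ext fun v => eq_of_form_right hB fun u => by
    rw [apply_formAdjoint hB, Module.End.one_apply, Module.End.one_apply]

theorem formAdjoint_mul {B : LinearMap.BilinForm F V} (hB : B.Nondegenerate)
    (X Y : Module.End F V) : formAdjoint B (X * Y) = formAdjoint B Y * formAdjoint B X :=
  LinearMap.ext fun v => eq_of_form_right hB fun u => by
    rw [apply_formAdjoint hB, Module.End.mul_apply, Module.End.mul_apply, apply_formAdjoint hB,
      apply_formAdjoint hB]

section Induced

variable {B : LinearMap.BilinForm F V} (hB : B.Nondegenerate) {T : Module.End F V} {δ : F}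
  (hδ : δ = 1 ∨ δ = -1) (hT : formAdjoint B T = δ • T)

theorem sign_ne_zero (hδ : δ = 1 ∨ δ = -1) : δ ≠ 0 := by
  rcases hδ with rfl | rfl <;> simp

theorem sign_mul_self (hδ : δ = 1 ∨ δ = -1) : δ * δ = 1 := by
  rcases hδ with rfl | rfl <;> simp

include hB hδ hT

theorem form_apply_right (x y : V) : B x (T y) = δ * B (T x) y := by
  rw [← apply_formAdjoint hB, hT, LinearMap.smul_apply, map_smul, smul_eq_mul, ← mul_assoc,
    sign_mul_self hδ, one_mul]

theorem inducedForm_rangeRestrict (x : V) (u : LinearMap.range T) :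
    inducedForm B T (T.rangeRestrict x) u = B x u :=
  inducedForm_apply hB (sign_ne_zero hδ) hT x u

theorem inducedForm_nondegenerate : (inducedForm B T).Nondegenerate := by
  constructor
  · intro u hu
    obtain ⟨x, rfl⟩ := T.surjective_rangeRestrict u
    refine Subtype.ext (hB.1 _ fun y => ?_)
    have h := hu (T.rangeRestrict y)
    rw [inducedForm_rangeRestrict hB hδ hT] at h
    change B x (T y) = 0 at h
    rw [form_apply_right hB hδ hT] at h
    exact (mul_eq_zero.1 h).resolve_left (sign_ne_zero hδ)
  · intro u hu
    refine Subtype.ext (hB.2 _ fun x => ?_)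
    rw [← inducedForm_rangeRestrict hB hδ hT]
    exact hu _

theorem inducedForm_symmetric {ε : F} (h : ∀ u v, B u v = ε * B v u)
    (u v : LinearMap.range T) : inducedForm B T u v = ε * δ * inducedForm B T v u := by
  obtain ⟨x, rfl⟩ := T.surjective_rangeRestrict u
  obtain ⟨y, rfl⟩ := T.surjective_rangeRestrict v
  rw [inducedForm_rangeRestrict hB hδ hT, inducedForm_rangeRestrict hB hδ hT]
  change B x (T y) = ε * δ * B y (T x)
  rw [form_apply_right hB hδ hT x y, h (T x) y]
  ring

theorem formAdjoint_compress (X : Module.End F V) :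
    formAdjoint (inducedForm B T) (compress T X) = δ • compress T (formAdjoint B X) := by
  refine LinearMap.ext fun v => eq_of_form_right (inducedForm_nondegenerate hB hδ hT) fun u => ?_
  obtain ⟨x, rfl⟩ := T.surjective_rangeRestrict u
  obtain ⟨y, rfl⟩ := T.surjective_rangeRestrict v
  rw [apply_formAdjoint (inducedForm_nondegenerate hB hδ hT), LinearMap.smul_apply, map_smul,
    smul_eq_mul]
  change inducedForm B T (T.rangeRestrict (X (T x))) (T.rangeRestrict y) =
    δ * inducedForm B T (T.rangeRestrict x) (T.rangeRestrict (formAdjoint B X (T y)))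
  rw [inducedForm_rangeRestrict hB hδ hT, inducedForm_rangeRestrict hB hδ hT]
  change B (X (T x)) (T y) = δ * B x (T (formAdjoint B X (T y)))
  rw [form_apply_right hB hδ hT x, apply_formAdjoint hB, ← mul_assoc, sign_mul_self hδ, one_mul]

end Induced

/-! ### The permutation operator and its adjoint -/

variable (F V) in
/-- `End V ⊗ End V → End (V ⊗ V)`. -/
def tensorEnd : Module.End F V ⊗[F] Module.End F V →ₗ[F] Module.End F (V ⊗[F] V) :=
  (homTensorHomEquiv F V V V V).toLinearMap

theorem tensorEnd_injective : Function.Injective (tensorEnd F V) :=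
  (homTensorHomEquiv F V V V V).injective

theorem tensorEnd_tmul (X Y : Module.End F V) :
    tensorEnd F V (X ⊗ₜ[F] Y) = TensorProduct.map X Y := by
  rw [tensorEnd, LinearEquiv.coe_coe, homTensorHomEquiv_apply]; rfl

theorem tensorEnd_mul (W W' : Module.End F V ⊗[F] Module.End F V) :
    tensorEnd F V (W * W') = tensorEnd F V W ∘ₗ tensorEnd F V W' := by
  induction W using TensorProduct.induction_on with
  | zero => simp
  | add u u' hu hu' => rw [add_mul, map_add, hu, hu', map_add, LinearMap.add_comp]
  | tmul a x =>
    induction W' using TensorProduct.induction_on with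
    | zero => simp
    | add v v' hv hv' => rw [mul_add, map_add, hv, hv', map_add, LinearMap.comp_add]
    | tmul b y =>
      rw [Algebra.TensorProduct.tmul_mul_tmul, tensorEnd_tmul, tensorEnd_tmul, tensorEnd_tmul]
      exact TensorProduct.map_mul _ _ _ _

theorem tensorEnd_permOmega :
    tensorEnd F V (permOmega F V) = (TensorProduct.comm F V V).toLinearMap :=
  (homTensorHomEquiv F V V V V).apply_symm_apply _

theorem tensorEnd_compress (T : Module.End F V) (W : Module.End F V ⊗[F] Module.End F V) :
    tensorEnd F (LinearMap.range T) (TensorProduct.map (compress T) (compress T) W) =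
      TensorProduct.map T.rangeRestrict T.rangeRestrict ∘ₗ tensorEnd F V W ∘ₗ
        TensorProduct.map (LinearMap.range T).subtype (LinearMap.range T).subtype := by
  induction W using TensorProduct.induction_on with
  | zero => simp
  | add u v hu hv =>
    rw [map_add, map_add, hu, hv, map_add, LinearMap.add_comp, LinearMap.comp_add]
  | tmul X Y =>
    rw [TensorProduct.map_tmul, tensorEnd_tmul, tensorEnd_tmul, ← TensorProduct.map_comp,
      ← TensorProduct.map_comp]
    rfl

/-- The functionals `B x` separate the points of `V`, and hence those of `V ⊗ W`. -/
theorem contract_injective {B : LinearMap.BilinForm F V} (hB : B.Nondegenerate) (W : Type*)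
    [AddCommGroup W] [Module F W] : Function.Injective (contract F B W) := by
  have h1 : Function.Injective (B.flip.rTensor W) :=
    Module.Flat.rTensor_preserves_injective_linearMap _
      (LinearMap.ker_eq_bot.1 (LinearMap.BilinForm.Nondegenerate.flip hB).ker_eq_bot)
  exact (dualTensorHomEquiv F V W).injective.comp h1

/-- `Ω†` maps `u ⊗ v` to `B v u` times the canonical tensor, whose contraction with `B x` is `x`. -/
theorem contract_permOmegaDagger {B : LinearMap.BilinForm F V} (hB : B.Nondegenerate)
    (u v x : V) :
    contract F B V (tensorEnd F V (permOmegaDagger B) (u ⊗ₜ[F] v)) x = B v u • x := by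
  have h : ∀ W : Module.End F V ⊗[F] Module.End F V,
      contract F B V (tensorEnd F V (TensorProduct.map (formAdjoint B) LinearMap.id W)
        (u ⊗ₜ[F] v)) x =
      TensorProduct.lid F V ((B.flip u).rTensor V (tensorEnd F V W (x ⊗ₜ[F] v))) := by
    intro W
    induction W using TensorProduct.induction_on with
    | zero => simp
    | add W W' h h' => simp only [map_add, LinearMap.add_apply, h, h']
    | tmul X Y =>
      rw [TensorProduct.map_tmul, tensorEnd_tmul, tensorEnd_tmul, TensorProduct.map_tmul,
        TensorProduct.map_tmul, contract_tmul, apply_formAdjoint hB, LinearMap.rTensor_tmul,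
        TensorProduct.lid_tmul]
      rfl
  rw [permOmegaDagger, h, tensorEnd_permOmega]
  rfl

section Induced

variable {B : LinearMap.BilinForm F V} (hB : B.Nondegenerate) {T : Module.End F V} {δ : F}
  (hδ : δ = 1 ∨ δ = -1) (hT : formAdjoint B T = δ • T)

include hB hδ hT

/-- `⟨J x | J y⟩ᵀ = ⟨x | T y⟩ = δ ⟨T x | y⟩`, inside a contraction. -/
theorem contract_rTensor_rangeRestrict {W : Type*} [AddCommGroup W] [Module F W]
    (z : V ⊗[F] W) (x : V) :
    contract F (inducedForm B T) W (T.rangeRestrict.rTensor W z) (T.rangeRestrict x) =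
      δ • contract F B W z (T x) := by
  induction z using TensorProduct.induction_on with
  | zero => simp
  | add z z' h h' => simp only [map_add, LinearMap.add_apply, h, h', smul_add]
  | tmul y w =>
    rw [LinearMap.rTensor_tmul, contract_tmul, contract_tmul,
      inducedForm_rangeRestrict hB hδ hT, ← mul_smul, ← form_apply_right hB hδ hT]
    rfl

/-- `⟨x | I u⟩ = ⟨J x | u⟩ᵀ`, inside a contraction. -/
theorem contract_rTensor_subtype {W : Type*} [AddCommGroup W] [Module F W]
    (z : LinearMap.range T ⊗[F] W) (x : V) :
    contract F B W ((LinearMap.range T).subtype.rTensor W z) x =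
      contract F (inducedForm B T) W z (T.rangeRestrict x) := by
  induction z using TensorProduct.induction_on with
  | zero => simp
  | add z z' h h' => simp only [map_add, LinearMap.add_apply, h, h']
  | tmul y w =>
    rw [LinearMap.rTensor_tmul, contract_tmul, contract_tmul,
      inducedForm_rangeRestrict hB hδ hT]
    rfl

/-- `(J ⊗ 1) Ω† (1 ⊗ I) = (1 ⊗ I) Ω† (J ⊗ 1)`. -/
theorem permOmegaDagger_left :
    T.rangeRestrict.rTensor V ∘ₗ tensorEnd F V (permOmegaDagger B) ∘ₗ
        (LinearMap.range T).subtype.lTensor V =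
      (LinearMap.range T).subtype.lTensor (LinearMap.range T) ∘ₗ
        tensorEnd F (LinearMap.range T) (permOmegaDagger (inducedForm B T)) ∘ₗ
          T.rangeRestrict.rTensor (LinearMap.range T) := by
  have hB' := inducedForm_nondegenerate hB hδ hT
  refine TensorProduct.ext' fun v u => contract_injective hB' V (LinearMap.ext fun y => ?_)
  obtain ⟨x, rfl⟩ := T.surjective_rangeRestrict y
  obtain ⟨w, rfl⟩ := T.surjective_rangeRestrict u
  simp only [LinearMap.comp_apply, LinearMap.lTensor_tmul, LinearMap.rTensor_tmul]
  rw [contract_rTensor_rangeRestrict hB hδ hT, contract_lTensor, contract_permOmegaDagger hB,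
    contract_permOmegaDagger hB', inducedForm_rangeRestrict hB hδ hT, map_smul, smul_smul]
  change (δ * B (T w) v) • T x = B w (T v) • T x
  rw [form_apply_right hB hδ hT]

/-- `(1 ⊗ J) Ω† (I ⊗ 1) = (I ⊗ 1) Ω† (1 ⊗ J)`. -/
theorem permOmegaDagger_right :
    T.rangeRestrict.lTensor V ∘ₗ tensorEnd F V (permOmegaDagger B) ∘ₗ
        (LinearMap.range T).subtype.rTensor V =
      (LinearMap.range T).subtype.rTensor (LinearMap.range T) ∘ₗ
        tensorEnd F (LinearMap.range T) (permOmegaDagger (inducedForm B T)) ∘ₗ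
          T.rangeRestrict.lTensor (LinearMap.range T) := by
  have hB' := inducedForm_nondegenerate hB hδ hT
  refine TensorProduct.ext' fun u v => contract_injective hB _ (LinearMap.ext fun x => ?_)
  simp only [LinearMap.comp_apply, LinearMap.lTensor_tmul, LinearMap.rTensor_tmul]
  rw [contract_rTensor_subtype hB hδ hT, contract_lTensor, contract_permOmegaDagger hB,
    contract_permOmegaDagger hB', inducedForm_rangeRestrict hB hδ hT, map_smul]
  rfl

/-- `(J ⊗ J) (1 ⊗ Y) Ω† (X ⊗ 1) (I ⊗ I) = (1 ⊗ J Y) (J ⊗ 1) Ω† (1 ⊗ I) (X I ⊗ 1)`, and here `J` and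
`I` are moved across `Ω†`. -/
theorem compress_sandwichRL (X Y : Module.End F V) :
    TensorProduct.map (compress T) (compress T) (sandwichRL (permOmegaDagger B) X Y) =
      sandwichRL (permOmegaDagger (inducedForm B T)) (compress T X) (compress T Y) := by
  refine tensorEnd_injective ?_
  have h := permOmegaDagger_left hB hδ hT
  rw [tensorEnd_compress, sandwichRL_apply, sandwichRL_apply, tensorEnd_mul, tensorEnd_mul,
    tensorEnd_mul, tensorEnd_mul, tensorEnd_tmul, tensorEnd_tmul, tensorEnd_tmul, tensorEnd_tmul]
  refine TensorProduct.ext' fun u v => ?_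
  have h' := congrArg ((T.rangeRestrict ∘ₗ Y).lTensor (LinearMap.range T))
    (LinearMap.congr_fun h (X u ⊗ₜ[F] v))
  have e₁ : ∀ z : V ⊗[F] V, TensorProduct.map T.rangeRestrict T.rangeRestrict
      (TensorProduct.map (1 : Module.End F V) Y z) =
      (T.rangeRestrict ∘ₗ Y).lTensor (LinearMap.range T) (T.rangeRestrict.rTensor V z) :=
    fun z => by
      rw [← LinearMap.comp_apply, ← LinearMap.comp_apply, ← TensorProduct.map_comp,
        LinearMap.lTensor_comp_rTensor]
      rfl
  have e₂ : ∀ z : LinearMap.range T ⊗[F] LinearMap.range T,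
      TensorProduct.map (1 : Module.End F (LinearMap.range T)) (compress T Y) z =
      (T.rangeRestrict ∘ₗ Y).lTensor (LinearMap.range T)
        ((LinearMap.range T).subtype.lTensor (LinearMap.range T) z) :=
    fun z => by
      rw [← LinearMap.comp_apply, ← LinearMap.lTensor_comp]
      rfl
  exact (e₁ _).trans (h'.trans (e₂ _).symm)

theorem compress_sandwichLR (X Y : Module.End F V) :
    TensorProduct.map (compress T) (compress T) (sandwichLR (permOmegaDagger B) X Y) =
      sandwichLR (permOmegaDagger (inducedForm B T)) (compress T X) (compress T Y) := by
  refine tensorEnd_injective ?_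
  have h := permOmegaDagger_right hB hδ hT
  rw [tensorEnd_compress, sandwichLR_apply, sandwichLR_apply, tensorEnd_mul, tensorEnd_mul,
    tensorEnd_mul, tensorEnd_mul, tensorEnd_tmul, tensorEnd_tmul, tensorEnd_tmul, tensorEnd_tmul]
  refine TensorProduct.ext' fun u v => ?_
  have h' := congrArg ((T.rangeRestrict ∘ₗ X).rTensor (LinearMap.range T))
    (LinearMap.congr_fun h (u ⊗ₜ[F] Y v))
  have e₁ : ∀ z : V ⊗[F] V, TensorProduct.map T.rangeRestrict T.rangeRestrict
      (TensorProduct.map X (1 : Module.End F V) z) =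
      (T.rangeRestrict ∘ₗ X).rTensor (LinearMap.range T) (T.rangeRestrict.lTensor V z) :=
    fun z => by
      rw [← LinearMap.comp_apply, ← LinearMap.comp_apply, ← TensorProduct.map_comp,
        LinearMap.rTensor_comp_lTensor]
      rfl
  have e₂ : ∀ z : LinearMap.range T ⊗[F] LinearMap.range T,
      TensorProduct.map (compress T X) (1 : Module.End F (LinearMap.range T)) z =
      (T.rangeRestrict ∘ₗ X).rTensor (LinearMap.range T)
        ((LinearMap.range T).subtype.rTensor (LinearMap.range T) z) :=
    fun z => by
      rw [← LinearMap.comp_apply, ← LinearMap.rTensor_comp]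
      rfl
  exact (e₁ _).trans (h'.trans (e₂ _).symm)

end Induced

theorem compress_tmulMul (T X Y : Module.End F V) :
    TensorProduct.map (compress T) (compress T) (tmulMul (permOmega F V) X Y) =
      tmulMul (permOmega F (LinearMap.range T)) (compress T X) (compress T Y) := by
  refine tensorEnd_injective ?_
  rw [tensorEnd_compress, tmulMul_apply, tmulMul_apply, tensorEnd_mul, tensorEnd_mul,
    tensorEnd_permOmega, tensorEnd_permOmega, tensorEnd_tmul, tensorEnd_tmul]
  exact TensorProduct.ext' fun u v => rfl

theorem compress_mulTmul (T X Y : Module.End F V) :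
    TensorProduct.map (compress T) (compress T) (mulTmul (permOmega F V) X Y) =
      mulTmul (permOmega F (LinearMap.range T)) (compress T X) (compress T Y) := by
  refine tensorEnd_injective ?_
  rw [tensorEnd_compress, mulTmul_apply, mulTmul_apply, tensorEnd_mul, tensorEnd_mul,
    tensorEnd_permOmega, tensorEnd_permOmega, tensorEnd_tmul, tensorEnd_tmul]
  exact TensorProduct.ext' fun u v => rfl

end Forms

/-! ### Compressions and inverses of operators of generalized Adler type -/

section Adler

/-- A linear map of the second factors which is compatible with the given bilinear maps. -/
theorem map_map₂ {F R T E E' W W' : Type*} [Field F] [AddCommMonoid R] [Module F R]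
    [AddCommMonoid T] [Module F T] [AddCommMonoid E] [Module F E] [AddCommMonoid E'] [Module F E']
    [AddCommMonoid W] [Module F W] [AddCommMonoid W'] [Module F W'] (f : R →ₗ[F] R →ₗ[F] T)
    {h : E →ₗ[F] E →ₗ[F] W} {h' : E' →ₗ[F] E' →ₗ[F] W'} {c : E →ₗ[F] E'} {C : W →ₗ[F] W'}
    (hC : ∀ X Y, C (h X Y) = h' (c X) (c Y)) (u v : R ⊗[F] E) :
    C.lTensor T (TensorProduct.map₂ f h u v) =
      TensorProduct.map₂ f h' (TensorProduct.map LinearMap.id c u)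
        (TensorProduct.map LinearMap.id c v) := by
  induction u using TensorProduct.induction_on with
  | zero => simp
  | add u u' hu hu' => simp only [map_add, LinearMap.add_apply, hu, hu']
  | tmul a X =>
    induction v using TensorProduct.induction_on with
    | zero => simp
    | add v v' hv hv' => simp only [map_add, hv, hv']
    | tmul b Y =>
      simp only [TensorProduct.map₂_apply_tmul, TensorProduct.map_tmul, LinearMap.lTensor_tmul,
        hC, LinearMap.id_apply]

variable {F 𝒱 V : Type*} [Field F] [CommRing 𝒱] [Algebra F 𝒱] [AddCommGroup V] [Module F V]
  [FiniteDimensional F V] {d : Derivation F 𝒱 𝒱}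

/-- Compression acts on the factors `End V` only, and each term of the identity is compatible with
it; this depends on the form only in the terms with coefficient `β`. -/
theorem AdlerIdentity.sandwich {P : PoissonVertexStructure d} {B : LinearMap.BilinForm F V}
    {α β γ δ : F} {A : PseudoDiffOp d ⊗[F] Module.End F V} (h : AdlerIdentity P B α β γ A)
    (hB : β ≠ 0 → B.Nondegenerate) {T : Module.End F V}
    (hT : β ≠ 0 → (δ = 1 ∨ δ = -1) ∧ formAdjoint B T = δ • T) :
    AdlerIdentity P (inducedForm B T) α β γ (GenAdler.sandwich T A) := by
  have h' := congrArg ((TensorProduct.map (compress T) (compress T)).lTensor (ℤ → ℤ → 𝒱[X])) h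
  simp only [map_add, map_sub, map_smul] at h'
  have hmk : ∀ X Y : Module.End F V, TensorProduct.map (compress T) (compress T)
      (TensorProduct.mk F _ _ X Y) = TensorProduct.mk F _ _ (compress T X) (compress T Y) :=
    fun X Y => rfl
  rw [map_map₂ P.symbolBracket hmk, map_map₂ (kernelDiff d ∘ₗ _) hmk,
    map_map₂ _ (compress_tmulMul T), map_map₂ _ (compress_mulTmul T)] at h'
  rw [AdlerIdentity]
  refine h'.trans ?_
  rcases eq_or_ne β 0 with rfl | hβ
  · simp only [zero_smul]
    rfl
  · obtain ⟨hδ, hT'⟩ := hT hβ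
    rw [map_map₂ _ (compress_sandwichRL (hB hβ) hδ hT'),
      map_map₂ _ (compress_sandwichLR (hB hβ) hδ hT')]
    rfl

theorem IsGeneralizedAdler.sandwich {P : PoissonVertexStructure d} {B : LinearMap.BilinForm F V}
    {α β γ η δ : F} {A : PseudoDiffOp d ⊗[F] Module.End F V}
    (h : IsGeneralizedAdler P B α β γ η A) {T : Module.End F V}
    (hT : β ≠ 0 → (δ = 1 ∨ δ = -1) ∧ formAdjoint B T = δ • T) :
    IsGeneralizedAdler P (inducedForm B T) α β γ (η * δ) (GenAdler.sandwich T A) where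
  identity := h.identity.sandwich h.nondegenerate hT
  nondegenerate hβ := inducedForm_nondegenerate (h.nondegenerate hβ) (hT hβ).1 (hT hβ).2
  symmetric_or_skew hβ := by
    obtain ⟨hδ, hT'⟩ := hT hβ
    obtain ⟨ε, hε, hs⟩ := h.symmetric_or_skew hβ
    refine ⟨ε * δ, ?_, inducedForm_symmetric (h.nondegenerate hβ) hδ hT' hs⟩
    rcases hε with rfl | rfl <;> rcases hδ with rfl | rfl <;> simp
  sign hβ := by
    rcases h.sign hβ with rfl | rfl <;> rcases (hT hβ).1 with rfl | rfl <;> simp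
  adjoint hβ := by
    obtain ⟨hδ, hT'⟩ := hT hβ
    have e : ∀ W : PseudoDiffOp d ⊗[F] Module.End F V,
        TensorProduct.map (formalAdjoint d) (formAdjoint (inducedForm B T))
          (GenAdler.sandwich T W) =
        δ • GenAdler.sandwich T (TensorProduct.map (formalAdjoint d) (formAdjoint B) W) := by
      intro W
      induction W using TensorProduct.induction_on with
      | zero => simp
      | add W W' hW hW' => simp only [map_add, hW, hW', smul_add]
      | tmul a X =>
        simp only [GenAdler.sandwich, TensorProduct.map_tmul, LinearMap.id_apply,
          formAdjoint_compress (h.nondegenerate hβ) hδ hT', TensorProduct.tmul_smul]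
    rw [e, h.adjoint hβ, map_smul, smul_smul, mul_comm]

/-- `A ↦ (A*)†` is an antihomomorphism. -/
theorem map_adjoint_mul {B : LinearMap.BilinForm F V} (hB : B.Nondegenerate)
    (W W' : PseudoDiffOp d ⊗[F] Module.End F V) :
    TensorProduct.map (formalAdjoint d) (formAdjoint B) (W * W') =
      TensorProduct.map (formalAdjoint d) (formAdjoint B) W' *
        TensorProduct.map (formalAdjoint d) (formAdjoint B) W := by
  induction W using TensorProduct.induction_on with
  | zero => simp
  | add u u' hu hu' => rw [add_mul, map_add, hu, hu', map_add, mul_add]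
  | tmul a X =>
    induction W' using TensorProduct.induction_on with
    | zero => simp
    | add v v' hv hv' => rw [mul_add, map_add, hv, hv', map_add, add_mul]
    | tmul b Y =>
      rw [Algebra.TensorProduct.tmul_mul_tmul, TensorProduct.map_tmul, TensorProduct.map_tmul,
        TensorProduct.map_tmul, Algebra.TensorProduct.tmul_mul_tmul, formalAdjoint_mul,
        formAdjoint_mul hB]

theorem IsGeneralizedAdler.inverse {P : PoissonVertexStructure d} {B : LinearMap.BilinForm F V}
    {α β γ η : F} {A : PseudoDiffOp d ⊗[F] Module.End F V}
    (h : IsGeneralizedAdler P B α β γ η A) (hA : IsUnit A) :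
    IsGeneralizedAdler P B (-α) (-β) γ η (Ring.inverse A) where
  identity := h.identity.inverse (Ring.mul_inverse_cancel A hA) (Ring.inverse_mul_cancel A hA)
  nondegenerate hβ := h.nondegenerate (neg_ne_zero.1 hβ)
  symmetric_or_skew hβ := h.symmetric_or_skew (neg_ne_zero.1 hβ)
  sign hβ := h.sign (neg_ne_zero.1 hβ)
  adjoint hβ := by
    have hβ' := neg_ne_zero.1 hβ
    have hB := h.nondegenerate hβ'
    have h1 := congrArg (TensorProduct.map (formalAdjoint d) (formAdjoint B))
      (Ring.mul_inverse_cancel A hA)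
    rw [map_adjoint_mul hB, h.adjoint hβ', Algebra.TensorProduct.one_def, TensorProduct.map_tmul,
      formalAdjoint_one, formAdjoint_one hB, ← Algebra.TensorProduct.one_def,
      mul_smul_comm] at h1
    have h2 := congrArg (fun W => η • (W * Ring.inverse A)) h1
    simp only [smul_mul_assoc, mul_assoc, Ring.mul_inverse_cancel A hA, mul_one, one_mul,
      smul_smul, sign_mul_self (h.sign hβ'), one_smul] at h2
    exact h2

/-- Invert, compress, and invert again. -/
theorem IsGeneralizedAdler.quasideterminant {P : PoissonVertexStructure d}
    {B : LinearMap.BilinForm F V} {α β γ η δ : F} {A : PseudoDiffOp d ⊗[F] Module.End F V}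
    (h : IsGeneralizedAdler P B α β γ η A) {T : Module.End F V}
    (hT : β ≠ 0 → (δ = 1 ∨ δ = -1) ∧ formAdjoint B T = δ • T)
    (hA : QuasideterminantExists T A) :
    IsGeneralizedAdler P (inducedForm B T) α β γ (η * δ) (GenAdler.quasideterminant T A) := by
  have h1 := ((h.inverse hA.1).sandwich fun hβ => hT (neg_ne_zero.1 hβ)).inverse hA.2
  rwa [neg_neg, neg_neg] at h1

end Adler

end

end GenAdler

theorem mainTheorem3 {F 𝒱 V : Type*} [Field F] [CharZero F] [CommRing 𝒱] [Algebra F 𝒱]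
    [AddCommGroup V] [Module F V] [FiniteDimensional F V] {d : Derivation F 𝒱 𝒱}
    (P : PoissonVertexStructure d) (B : LinearMap.BilinForm F V) (α β γ η : F)
    (A : PseudoDiffOp d ⊗[F] Module.End F V) (hA : IsGeneralizedAdler P B α β γ η A) :
    (IsUnit A → IsGeneralizedAdler P B (-α) (-β) γ η (Ring.inverse A)) ∧
    ∀ (T : Module.End F V) (δ : F),
      (β ≠ 0 → (δ = 1 ∨ δ = -1) ∧ formAdjoint B T = δ • T) →
      IsGeneralizedAdler P (inducedForm B T) α β γ (η * δ) (sandwich T A) ∧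
      (QuasideterminantExists T A →
        IsGeneralizedAdler P (inducedForm B T) α β γ (η * δ) (quasideterminant T A)) :=
  ⟨hA.inverse, fun _ _ hT => ⟨hA.sandwich hT, hA.quasideterminant hT⟩⟩
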